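/- **Setting.** Let $\mathcal F=\Gamma_s(\mathrm L^2(\mathbb R^3\times\mathbb Z_2))$ be the symmetric Fock space over the one-photon space. Let $H_f=\mathrm d\Gamma(|k|)$, $P_f=\mathrm d\Gamma(k)$, and $\Phi(f)=\frac1{\sqrt2}(a^*(f)+a(f))$. Fix $\Lambda>0$, a smooth cutoff $\kappa^\Lambda:\mathbb R^3\to[0,1]$ supported in $\{|k|\le\Lambda\}$ with $\kappa^\Lambda=1$ on $\{|k|\le 3\Lambda/4\}$, and measurable real polarization vectors $\varepsilon_1(k),\varepsilon_2(k)\in\mathbb R^3$ which, for $k\ne0$, are normalized, orthogonal to each other and orthogonal to $k$. Put $h(k,\lambda)=\kappa^\Lambda(k)|k|^{-1/2}\varepsilon_\lambda(k)$ and let $b=\frac{\mathrm i}{2}(k\cdot\nabla_k+\nabla_k\cdot k)$ be the (self-adjoint) generator of dilatations on $\mathrm L^2(\mathbb R^3\times\mathbb Z_2)$. Assume that (the components of) $h$ belong to $D(b)$ and that $|k|^{-1/2}\,bh$ is square-integrable (this holds for instance if $\varepsilon_\lambda(k)$ depends only on $k/|k|$). For $\alpha\ge0$ and $P\in\mathbb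 R^3$ let $$H(P)=\tfrac12\big(P-P_f-\alpha^{1/2}\Phi(h)\big)^2+H_f ,\qquad E(P)=\inf\sigma(H(P)),\qquad B=\mathrm d\Gamma(b).$$ **Theorem 2.1.** There exist constants $\alpha_0>0$ and $C_0>0$ (depending only on $\Lambda$, $\kappa^\Lambda$ and $\varepsilon_1,\varepsilon_2$) such that, for all $P\in\mathbb R^3$ with $|P|\le p_c:=1/40$, all $0\le\alpha\le\alpha_0$ and all $\sigma\ge C_0\alpha^{1/2}$, the operator $H(P)$ is self-adjoint, $D(H(P))\cap D(B)$ is dense in $D(H(P))$ for the graph norm, the quadratic form $[H(P),\mathrm iB]$, given by $\mathrm i\big(\langle H(P)u,Bv\rangle-\langle Bu,H(P)v\rangle\big)$ on $D(H(P))\cap D(B)$, extends (uniquely) to a form on $D(H(P))$ that is bounded in the graph norm, and this extension satisfies, with $J=J_\sigma^>:=E(P)+[\sigma,2\sigma]$, $$\mathbb 1_{J}(H(P))\,[H(P),\mathrm iB]\,\mathbb 1_{J}(H(P))\ \ge\ \frac{\sigma}{2}\,\mathbb 1_{J}(H(P)).$$ -/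

import Mathlib

open MeasureTheory
open scoped ContDiff InnerProductSpace

noncomputable section

namespace QED

/-! ### One-photon space and symmetric Fock space -/

/-- Momentum space `ℝ³` with the Euclidean norm. -/
abbrev R3 : Type := EuclideanSpace ℝ (Fin 3)

/-- One-photon configurations `(k, lam)`: momentum and polarization index. -/
abbrev Photon : Type := R3 × Fin 2

/-- Lebesgue measure in the momentum times counting measure in the polarization. -/
def photonMeasure : Measure Photon := (volume : Measure R3).prod Measure.count

instance : SigmaFinite photonMeasure := by unfold photonMeasure; infer_instance

/-- `n`-photon configurations. -/
abbrev Conf (n : ℕ) : Type := Fin n → Photon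

/-- The product measure on `n`-photon configurations (for `n = 0` a unit point mass). -/
def confMeasure (n : ℕ) : Measure (Conf n) := Measure.pi fun _ => photonMeasure

instance (n : ℕ) : SigmaFinite (confMeasure n) := by unfold confMeasure; infer_instance

/-- `L²((ℝ³ × ℤ₂)ⁿ)`, that is, the `n`-fold tensor power of the one-photon space. -/
abbrev SectorL2 (n : ℕ) : Type := Lp ℂ 2 (confMeasure n)

theorem measurePreserving_perm {n : ℕ} (p : Equiv.Perm (Fin n)) :
    MeasurePreserving (fun (x : Conf n) (i : Fin n) => x (p i))
      (confMeasure n) (confMeasure n) := by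
  have h := measurePreserving_piCongrLeft (fun _ : Fin n => photonMeasure) p.symm
  have e : (fun (x : Conf n) (i : Fin n) => x (p i)) =
      ⇑(MeasurableEquiv.piCongrLeft (fun _ : Fin n => Photon) p.symm) := by
    funext x i
    have := MeasurableEquiv.piCongrLeft_apply_apply (β := fun _ : Fin n => Photon) p.symm x (p i)
    simpa using this.symm
  rw [e]
  exact h

/-- Permutation of the photons, as an isometry of `L²((ℝ³ × ℤ₂)ⁿ)`. -/
def permute {n : ℕ} (p : Equiv.Perm (Fin n)) : SectorL2 n →ₗᵢ[ℂ] SectorL2 n :=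
  Lp.compMeasurePreservingₗᵢ ℂ (fun (x : Conf n) (i : Fin n) => x (p i)) (measurePreserving_perm p)

/-- The `n`-photon sector: the square-integrable functions of `n` photon variables that are
symmetric under permutations of these variables. -/
def symSector (n : ℕ) : Submodule ℂ (SectorL2 n) where
  carrier := {f | ∀ p : Equiv.Perm (Fin n), permute p f = f}
  add_mem' := by
    intro f g hf hg p
    rw [map_add, hf p, hg p]
  zero_mem' := fun p => map_zero _
  smul_mem' := by
    intro c f hf p
    rw [map_smul, hf p]

theorem isClosed_symSector (n : ℕ) : IsClosed (symSector n : Set (SectorL2 n)) := by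
  have : (symSector n : Set (SectorL2 n)) =
      ⋂ p : Equiv.Perm (Fin n), {f | permute p f = f} := by
    ext f; simp [symSector]
  rw [this]
  exact isClosed_iInter fun p => isClosed_eq (permute p).continuous continuous_id

instance (n : ℕ) : CompleteSpace (symSector n) :=
  (isClosed_symSector n).completeSpace_coe

/-- The symmetric Fock space: the Hilbert direct sum of the `n`-photon sectors. -/
abbrev Fock : Type := lp (fun n : ℕ => symSector n) 2

/-- The `n`-photon wave function of a Fock space vector. -/
def wave (u : Fock) (n : ℕ) : SectorL2 n := (u n : SectorL2 n)

theorem wave_add (u v : Fock) (n : ℕ) : wave (u + v) n = wave u n + wave v n := rfl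

theorem wave_smul (c : ℂ) (u : Fock) (n : ℕ) : wave (c • u) n = c • wave u n := rfl

theorem wave_zero (n : ℕ) : wave 0 n = 0 := rfl

theorem wave_ext {u v : Fock} (h : ∀ n, wave u n = wave v n) : u = v :=
  lp.ext (funext fun n => Subtype.ext (h n))

/-! ### Operators in Fock space

Unbounded operators are partial linear maps with explicit domains.  They are given by their
graphs: `(u, v)` belongs to the graph when `u` is in the domain and `v` is its image. -/

/-- The graph of multiplication by the function `m n` in the `n`-photon sector. -/
def mulGraph (m : ∀ n, Conf n → ℝ) : Submodule ℂ (Fock × Fock) where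
  carrier := {w | ∀ n, ∀ᵐ x ∂confMeasure n, wave w.2 n x = (m n x : ℂ) * wave w.1 n x}
  add_mem' := by
    intro a b ha hb n
    filter_upwards [ha n, hb n, Lp.coeFn_add (wave a.1 n) (wave b.1 n),
      Lp.coeFn_add (wave a.2 n) (wave b.2 n)] with x h1 h2 h3 h4
    rw [Prod.fst_add, Prod.snd_add, wave_add, wave_add, h3, h4, Pi.add_apply, Pi.add_apply,
      h1, h2, mul_add]
  zero_mem' := by
    intro n
    filter_upwards [Lp.coeFn_zero ℂ 2 (confMeasure n)] with x h
    simp only [Prod.fst_zero, Prod.snd_zero, wave_zero, h]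
    simp
  smul_mem' := by
    intro c a ha n
    filter_upwards [ha n, Lp.coeFn_smul c (wave a.1 n),
      Lp.coeFn_smul c (wave a.2 n)] with x h1 h2 h3
    rw [Prod.smul_fst, Prod.smul_snd, wave_smul, wave_smul, h2, h3, Pi.smul_apply, Pi.smul_apply,
      h1, smul_eq_mul, smul_eq_mul]
    ring

/-- Multiplication by `m n` in the `n`-photon sector, on its maximal domain. -/
def mulOp (m : ∀ n, Conf n → ℝ) : Fock →ₗ.[ℂ] Fock := (mulGraph m).toLinearPMap

theorem mulOp_graph (m : ∀ n, Conf n → ℝ) : (mulOp m).graph = mulGraph m := by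
  apply Submodule.toLinearPMap_graph_eq
  rintro ⟨u, v⟩ h (rfl : u = 0)
  apply wave_ext
  intro n
  rw [wave_zero]
  apply Lp.ext
  filter_upwards [h n, Lp.coeFn_zero ℂ 2 (confMeasure n)] with x h1 h2
  rw [h1, h2]
  simp only [wave_zero, h2]
  simp

/-- The field energy `H_f = dΓ(|k|)`. -/
def fieldEnergy : Fock →ₗ.[ℂ] Fock := mulOp fun _ x => ∑ i, ‖(x i).1‖

/-- The `j`-th component of the field momentum `P_f = dΓ(k)`. -/
def fieldMomentum (j : Fin 3) : Fock →ₗ.[ℂ] Fock := mulOp fun _ x => ∑ i, (x i).1 j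

theorem quasiMeasurePreserving_removeNth {n : ℕ} (i : Fin (n + 1)) :
    Measure.QuasiMeasurePreserving (fun x : Conf (n + 1) => i.removeNth x)
      (confMeasure (n + 1)) (confMeasure n) := by
  have h := measurePreserving_piFinSuccAbove (fun _ : Fin (n + 1) => photonMeasure) i
  exact Measure.quasiMeasurePreserving_snd.comp h.quasiMeasurePreserving

/-- The graph of the creation operator `a*(f)`:
`(a*(f) u)_{n+1}(x) = (n+1)^{-1/2} ∑ᵢ f(xᵢ) u_n(x without xᵢ)` and `(a*(f) u)_0 = 0`. -/
def creationGraph (f : Photon → ℂ) : Submodule ℂ (Fock × Fock) where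
  carrier := {w | wave w.2 0 = 0 ∧ ∀ n, ∀ᵐ x ∂confMeasure (n + 1),
    wave w.2 (n + 1) x =
      ((Real.sqrt (n + 1))⁻¹ : ℝ) * ∑ i, f (x i) * wave w.1 n (i.removeNth x)}
  add_mem' := by
    intro a b ha hb
    refine ⟨by rw [Prod.snd_add, wave_add, ha.1, hb.1, add_zero], fun n => ?_⟩
    have hs : ∀ i : Fin (n + 1), ∀ᵐ x ∂confMeasure (n + 1),
        (wave a.1 n + wave b.1 n : SectorL2 n) (i.removeNth x) =
          wave a.1 n (i.removeNth x) + wave b.1 n (i.removeNth x) := fun i =>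
      (quasiMeasurePreserving_removeNth i).ae (Lp.coeFn_add (wave a.1 n) (wave b.1 n))
    filter_upwards [ha.2 n, hb.2 n, ae_all_iff.2 hs,
      Lp.coeFn_add (wave a.2 (n + 1)) (wave b.2 (n + 1))] with x h1 h2 h3 h4
    rw [Prod.fst_add, Prod.snd_add, wave_add, wave_add, h4, Pi.add_apply, h1, h2, ← mul_add,
      ← Finset.sum_add_distrib]
    simp only [h3, mul_add]
  zero_mem' := by
    refine ⟨rfl, fun n => ?_⟩
    have hs : ∀ i : Fin (n + 1), ∀ᵐ x ∂confMeasure (n + 1),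
        (0 : SectorL2 n) (i.removeNth x) = 0 := fun i =>
      (quasiMeasurePreserving_removeNth i).ae (Lp.coeFn_zero ℂ 2 (confMeasure n))
    filter_upwards [ae_all_iff.2 hs, Lp.coeFn_zero ℂ 2 (confMeasure (n + 1))] with x h1 h2
    simp only [Prod.fst_zero, Prod.snd_zero, wave_zero, h1, h2]
    simp
  smul_mem' := by
    intro c a ha
    refine ⟨by rw [Prod.smul_snd, wave_smul, ha.1, smul_zero], fun n => ?_⟩
    have hs : ∀ i : Fin (n + 1), ∀ᵐ x ∂confMeasure (n + 1),
        (c • wave a.1 n : SectorL2 n) (i.removeNth x) = c * wave a.1 n (i.removeNth x) := fun i =>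
      (quasiMeasurePreserving_removeNth i).ae (Lp.coeFn_smul c (wave a.1 n))
    filter_upwards [ha.2 n, ae_all_iff.2 hs, Lp.coeFn_smul c (wave a.2 (n + 1))] with x h1 h2 h3
    rw [Prod.smul_fst, Prod.smul_snd, wave_smul, wave_smul, h3, Pi.smul_apply, h1, smul_eq_mul]
    simp only [h2, Finset.mul_sum]
    exact Finset.sum_congr rfl fun i _ => by ring

/-- The creation operator `a*(f)`, on its maximal domain. -/
def creation (f : Photon → ℂ) : Fock →ₗ.[ℂ] Fock := (creationGraph f).toLinearPMap

theorem creation_graph (f : Photon → ℂ) : (creation f).graph = creationGraph f := by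
  apply Submodule.toLinearPMap_graph_eq
  rintro ⟨u, v⟩ h (rfl : u = 0)
  apply wave_ext
  rintro (_ | n)
  · exact h.1
  have hs : ∀ i : Fin (n + 1), ∀ᵐ x ∂confMeasure (n + 1),
      (0 : SectorL2 n) (i.removeNth x) = 0 := fun i =>
    (quasiMeasurePreserving_removeNth i).ae (Lp.coeFn_zero ℂ 2 (confMeasure n))
  apply Lp.ext
  filter_upwards [h.2 n, ae_all_iff.2 hs, Lp.coeFn_zero ℂ 2 (confMeasure (n + 1))] with x h1 h2 h3
  rw [h1]
  simp only [wave_zero, h2, h3]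
  simp

/-- The annihilation operator `a(f)`, the adjoint of `a*(f)`. -/
def annihilation (f : Photon → ℂ) : Fock →ₗ.[ℂ] Fock := (creation f).adjoint

/-- The field operator `Φ(f) = 2^{-1/2} (a*(f) + a(f))`. -/
def fieldOp (f : Photon → ℂ) : Fock →ₗ.[ℂ] Fock :=
  (((Real.sqrt 2)⁻¹ : ℝ) : ℂ) • (creation f + annihilation f)

/-! ### The generator of dilatations -/

/-- The differential expression `b = (i/2) (k · ∇ + ∇ · k)` applied to a smooth function. -/
def dilExpr (g : R3 → ℂ) (k : R3) : ℂ :=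
  (Complex.I / 2) * ∑ m : Fin 3,
    ((k m : ℂ) * fderiv ℝ g k (EuclideanSpace.single m 1)
      + fderiv ℝ (fun q : R3 => (q m : ℂ) * g q) k (EuclideanSpace.single m 1))

/-- The differential expression `∑ᵢ bᵢ` with `bᵢ` acting on the `i`-th momentum variable. -/
def dilExprN {n : ℕ} (g : (Fin n → R3) → ℂ) (k : Fin n → R3) : ℂ :=
  ∑ i, dilExpr (fun q => g (Function.update k i q)) (k i)

/-- `DilTest n F F'`: the function `F` is a smooth compactly supported function of the momenta for
each value of the polarizations, and `F'` is `∑ᵢ bᵢ` applied to it. -/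
def DilTest (n : ℕ) (F F' : SectorL2 n) : Prop :=
  ∃ g : (Fin n → Fin 2) → (Fin n → R3) → ℂ,
    (∀ p, ContDiff ℝ ∞ (g p) ∧ HasCompactSupport (g p)) ∧
    (∀ᵐ x ∂confMeasure n, F x = g (fun i => (x i).2) (fun i => (x i).1)) ∧
    (∀ᵐ x ∂confMeasure n, F' x = dilExprN (g (fun i => (x i).2)) (fun i => (x i).1))

/-- The graph of `dΓ(b)`: in each sector, `∑ᵢ bᵢ` in the sense of weak derivatives. -/
def dilGraph : Submodule ℂ (Fock × Fock) where
  carrier := {w | ∀ n, ∀ F F' : SectorL2 n, DilTest n F F' →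
    ⟪F', wave w.1 n⟫_ℂ = ⟪F, wave w.2 n⟫_ℂ}
  add_mem' := by
    intro a b ha hb n F F' h
    rw [Prod.fst_add, Prod.snd_add, wave_add, wave_add, inner_add_right, inner_add_right,
      ha n F F' h, hb n F F' h]
  zero_mem' := by
    intro n F F' _
    rw [Prod.fst_zero, Prod.snd_zero, wave_zero, inner_zero_right, inner_zero_right]
  smul_mem' := by
    intro c a ha n F F' h
    rw [Prod.smul_fst, Prod.smul_snd, wave_smul, wave_smul, inner_smul_right, inner_smul_right,
      ha n F F' h]

/-- The generator of dilatations `B = dΓ(b)` in Fock space, `b = (i/2) (k · ∇ + ∇ · k)`. -/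
def dilationGen : Fock →ₗ.[ℂ] Fock := dilGraph.toLinearPMap

/-- `b f = g` in the one-photon space, in the sense of weak derivatives. -/
def WeakDil (f g : Photon → ℂ) : Prop :=
  ∀ (lam : Fin 2) (t : R3 → ℂ), ContDiff ℝ ∞ t → HasCompactSupport t →
    ∫ k, starRingEnd ℂ (dilExpr t k) * f (k, lam) = ∫ k, starRingEnd ℂ (t k) * g (k, lam)

/-! ### The fiber Hamiltonian -/

/-- Smooth ultraviolet cutoff: values in `[0,1]`, supported in `|k| ≤ Λ`, equal to `1` on
`|k| ≤ 3Λ/4`. -/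
structure IsCutoff (Lam : ℝ) (kap : R3 → ℝ) : Prop where
  smooth : ContDiff ℝ ∞ kap
  mem_Icc : ∀ k, kap k ∈ Set.Icc (0 : ℝ) 1
  support : tsupport kap ⊆ Metric.closedBall 0 Lam
  eq_one : ∀ k, ‖k‖ ≤ 3 * Lam / 4 → kap k = 1

/-- Real polarization vectors: for `k ≠ 0`, the vectors `ε_1(k)`, `ε_2(k)` are normalized,
orthogonal to each other and to `k`, and they depend measurably on `k`. -/
structure IsPolarization (eps : Fin 2 → R3 → R3) : Prop where
  measurable : ∀ lam, Measurable (eps lam)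
  orthonormal : ∀ k, k ≠ 0 → Orthonormal ℝ (fun lam => eps lam k)
  transversal : ∀ lam k, k ≠ 0 → ⟪eps lam k, k⟫_ℝ = 0

/-- The `j`-th component of the coupling function `h(k, lam) = κ(k) |k|^{-1/2} ε_lam(k)`. -/
def coupling (kap : R3 → ℝ) (eps : Fin 2 → R3 → R3) (j : Fin 3) (x : Photon) : ℂ :=
  ((kap x.1 / Real.sqrt ‖x.1‖ * eps x.2 x.1 j : ℝ) : ℂ)

/-- Each component of `h` lies in the domain of `b`, and `|k|^{-1/2} b h` is square-integrable. -/
def RegularCoupling (kap : R3 → ℝ) (eps : Fin 2 → R3 → R3) : Prop :=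
  ∀ j, ∃ g : Photon → ℂ, WeakDil (coupling kap eps j) g ∧ MemLp g 2 photonMeasure ∧
    MemLp (fun x : Photon => ((Real.sqrt ‖x.1‖)⁻¹ : ℂ) * g x) 2 photonMeasure

/-- Composition `S ∘ T` of unbounded operators on its natural domain
`{u ∈ D(T) | T u ∈ D(S)}`. -/
def compOp {E : Type*} [AddCommGroup E] [Module ℂ E] (S T : E →ₗ.[ℂ] E) : E →ₗ.[ℂ] E where
  domain := (S.domain.comap T.toFun).map T.domain.subtype
  toFun :=
    S.toFun.comp
      ((T.toFun.comp (Submodule.inclusion (Submodule.map_subtype_le T.domain _))).codRestrict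
        S.domain (by
          rintro ⟨u, y, h, rfl⟩
          exact h))

theorem mem_compOp_graph {E : Type*} [AddCommGroup E] [Module ℂ E] (S T : E →ₗ.[ℂ] E) (u w : E) :
    (u, w) ∈ (compOp S T).graph ↔ ∃ v, (u, v) ∈ T.graph ∧ (v, w) ∈ S.graph := by
  simp only [LinearPMap.mem_graph_iff]
  constructor
  · rintro ⟨⟨_, y, h, rfl⟩, rfl, rfl⟩
    exact ⟨T y, ⟨y, rfl, rfl⟩, ⟨⟨T y, h⟩, rfl, rfl⟩⟩
  · rintro ⟨_, ⟨y, rfl, rfl⟩, ⟨z, hz, rfl⟩⟩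
    have h : T y ∈ S.domain := hz ▸ z.2
    obtain rfl : z = ⟨T y, h⟩ := Subtype.ext hz
    exact ⟨⟨y, y, h, rfl⟩, rfl, rfl⟩

/-- The `j`-th component of the velocity operator `P - P_f - α^{1/2} A`, with `A = Φ(h)`. -/
def velocity (kap : R3 → ℝ) (eps : Fin 2 → R3 → R3) (alpha : ℝ) (P : R3) (j : Fin 3) :
    Fock →ₗ.[ℂ] Fock :=
  ((P j : ℂ) • (LinearMap.id : Fock →ₗ[ℂ] Fock)).toPMap ⊤ - fieldMomentum j
    - (Real.sqrt alpha : ℂ) • fieldOp (coupling kap eps j)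

/-- The fiber Hamiltonian `H(P) = (1/2) (P - P_f - α^{1/2} A)² + H_f`, on the natural domain of
this expression. -/
def hamiltonian (kap : R3 → ℝ) (eps : Fin 2 → R3 → R3) (alpha : ℝ) (P : R3) :
    Fock →ₗ.[ℂ] Fock :=
  (1 / 2 : ℂ) • (∑ j, compOp (velocity kap eps alpha P j) (velocity kap eps alpha P j))
    + fieldEnergy

/-! ### Spectrum, spectral projections, commutators -/

/-- The spectrum of `T`: the `z` for which `T - z : D(T) → Fock` has no bounded inverse defined on
the whole space. -/
def spec (T : Fock →ₗ.[ℂ] Fock) : Set ℂ :=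
  {z | ¬ ∃ R : Fock →L[ℂ] Fock,
    (∀ v, ∃ h : R v ∈ T.domain, T ⟨R v, h⟩ - z • R v = v) ∧
    (∀ u : T.domain, R (T u - z • (u : Fock)) = u)}

/-- `inf σ(T)` for an operator with real spectrum. -/
def infSpec (T : Fock →ₗ.[ℂ] Fock) : ℝ := sInf {x : ℝ | (x : ℂ) ∈ spec T}

/-- The range of the spectral projection `1_{[a,b]}(T)` of a self-adjoint operator `T`: the largest
closed subspace that is contained in `D(T)`, is invariant under `T`, and on which
`a ≤ T ≤ b` as quadratic forms. -/
def spectralSubspace (T : Fock →ₗ.[ℂ] Fock) (a b : ℝ) : Submodule ℂ Fock :=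
  (sSup {M : Submodule ℂ Fock | ∀ u ∈ M, ∃ h : u ∈ T.domain, T ⟨u, h⟩ ∈ M ∧
    a * ‖u‖ ^ 2 ≤ (⟪u, T ⟨u, h⟩⟫_ℂ).re ∧
    (⟪u, T ⟨u, h⟩⟫_ℂ).re ≤ b * ‖u‖ ^ 2}).topologicalClosure

/-- The spectral projection `1_{[a,b]}(T)` of a self-adjoint operator `T`. -/
def spectralProj (T : Fock →ₗ.[ℂ] Fock) (a b : ℝ) : Fock →L[ℂ] Fock :=
  haveI : CompleteSpace (spectralSubspace T a b) := by
    unfold spectralSubspace; infer_instance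
  (spectralSubspace T a b).starProjection

/-- `Q` is the commutator `[H, iB]` as a quadratic form on `D(H)`: it is bounded in the graph norm
of `H`, it is given by `⟨u, [H, iB] v⟩ = i (⟨H u, B v⟩ - ⟨B u, H v⟩)` on `D(H) ∩ D(B)`, and this
intersection is dense in `D(H)` for the graph norm (so that there is at most one such `Q`). -/
structure IsCommutatorForm (H B : Fock →ₗ.[ℂ] Fock)
    (Q : H.domain →ₗ⋆[ℂ] H.domain →ₗ[ℂ] ℂ) : Prop where
  bounded : ∃ C : ℝ, ∀ u v : H.domain,
    ‖Q u v‖ ≤ C * (‖(u : Fock)‖ + ‖H u‖) * (‖(v : Fock)‖ + ‖H v‖)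
  eq_commutator : ∀ (u v : H.domain) (hu : (u : Fock) ∈ B.domain) (hv : (v : Fock) ∈ B.domain),
    Q u v = Complex.I * (⟪H u, B ⟨v, hv⟩⟫_ℂ - ⟪B ⟨u, hu⟩, H v⟫_ℂ)
  dense : ∀ (u : H.domain) (r : ℝ), 0 < r → ∃ v : H.domain, (v : Fock) ∈ B.domain ∧
    ‖(u : Fock) - v‖ < r ∧ ‖H u - H v‖ < r

/-- The Mourre estimate `1_{[a,b]}(H) [H, iB] 1_{[a,b]}(H) ≥ c 1_{[a,b]}(H)`. -/
def MourreEstimate (H B : Fock →ₗ.[ℂ] Fock) (a b c : ℝ) : Prop :=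
  ∃ Q : H.domain →ₗ⋆[ℂ] H.domain →ₗ[ℂ] ℂ, IsCommutatorForm H B Q ∧
    ∀ w : Fock, ∃ h : spectralProj H a b w ∈ H.domain,
      c * (⟪w, spectralProj H a b w⟫_ℂ).re ≤ (Q ⟨spectralProj H a b w, h⟩
        ⟨spectralProj H a b w, h⟩).re

end QED

end

/-! Write `k` for the total photon momentum, `ω` for the total photon energy, `s = √α`, and `v = P -
P_f - sΦ(h)` for the velocity, so that `H = v²/2 + H_f`.

Positivity. Conjugating with the dilation group and differentiating at zero gives, as a form, `[H,
iB] = H_f + Re ⟨v, sΦ(ibh) - P_f⟩`. Since `-P_f = v - P + sΦ(h)`, the second factor is `v - P` up to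
field operators of size `s`, and `Re ⟨v, v - P⟩ ≥ v²/2 - P²/2`. Hence `[H, iB] ≥ H - P²/2 - C s (1 +
H)` on all of `D(H)` (`commutator_lower_bound`). On the other hand `|P - k|²/2 + ω ≥ P²/2 + (1 -
|P|) ω`, and a small coupling costs only `O(s)`, so `E(P) ≥ P²/2 - C s` (`hamiltonian_lower_bound`).
On the spectral window `H ≥ E(P) + σ`, and the two bounds together leave `σ` minus a multiple of `s`
and a fraction of `σ`; for `σ ≥ C₀ s` this is at least `σ/2` (`mourreEstimate_hamiltonian`).

Self-adjointness. A field operator is controlled by `(1 + ω)^{1/2}` with constant `∫ |f|² (1 +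
1/|k|)`, also in weighted norms, because a photon in the support of `h` changes `ω` and `k` by a
bounded amount (`wsq_fieldOp_le`). Therefore `H + 1` differs from multiplication by `1 + ω + |P -
k|²/2` by a relatively bounded operator of norm `O(s)`. A Neumann series makes `H + 1` surjective,
which together with symmetry gives self-adjointness and the domain of the free operator
(`exists_hamiltonian_add_one_eq`, `isSelfAdjoint_of_surjective`, `freeWeight_of_hamiltonian`).

Commutator. `B`, defined by weak derivatives, is the generator of the unitary dilation group
(`hasDerivAt_dil`, `mem_dilGraph_of_hasDerivAt`). The function `t ↦ ⟨D_t u, H D_t v⟩` is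
differentiated twice over: through `B`, and through the explicit scaling of momentum, energy and
form factor (`inner_commutator`). The hypothesis on `|k|^{-1/2} b h` makes the dilated form factor
differentiable in the norm that controls field operators. Averages over dilations give the density
of `D(H) ∩ D(B)` (`exists_approx_dilationGen`).

Spectral data. The spectral subspace is the closed span of invariant subspaces with form bounds, and
form bounds are not additive over such subspaces. They are replaced by growth rates of orbits of `T
- c`, which are, and log-convexity recovers the bounds (`spectralSubspace_spec`). The infimum of the
spectrum is compared with form bounds in `infSpec_bounds`. -/

noncomputable section

namespace QED

/-! ### Weighted square norms in Fock space -/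

/-- The quadratic form of multiplication by `m n` in the `n`-photon sector. -/
def wsq (m : ∀ n, Conf n → ℝ) (u : Fock) : ENNReal :=
  ∑' n, ∫⁻ x, ENNReal.ofReal (m n x * ‖wave u n x‖ ^ 2) ∂confMeasure n

theorem lintegral_normSq_sector {n : ℕ} (f : SectorL2 n) :
    ∫⁻ x, ENNReal.ofReal (‖f x‖ ^ 2) ∂confMeasure n = ENNReal.ofReal (‖f‖ ^ 2) := by
  have h1 : ‖f‖ ^ 2 = ∫ x, ‖f x‖ ^ 2 ∂confMeasure n := by
    have h := L2.inner_def (𝕜 := ℂ) f f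
    rw [inner_self_eq_norm_sq_to_K] at h
    have h2 : ∀ x, ⟪f x, f x⟫_ℂ = ((‖f x‖ ^ 2 : ℝ) : ℂ) := by
      intro x
      rw [inner_self_eq_norm_sq_to_K]; norm_cast
    simp only [h2] at h
    rw [integral_complex_ofReal] at h
    exact Complex.ofReal_injective (by simpa using h)
  rw [h1, ofReal_integral_eq_lintegral_ofReal]
  · exact (memLp_two_iff_integrable_sq_norm (Lp.aestronglyMeasurable f)).1 (Lp.memLp f)
  · exact Filter.Eventually.of_forall fun x => by positivity

theorem wsq_one (u : Fock) : wsq (fun _ _ => 1) u = ENNReal.ofReal (‖u‖ ^ 2) := by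
  have h := lp.hasSum_norm (p := 2) (by norm_num) u
  simp only [ENNReal.toReal_ofNat, Real.rpow_ofNat] at h
  rw [wsq, ← h.tsum_eq, ENNReal.ofReal_tsum_of_nonneg (fun n => by positivity) h.summable]
  refine tsum_congr fun n => ?_
  simp only [one_mul]
  rw [lintegral_normSq_sector]
  rfl

theorem wsq_mono {m m' : ∀ n, Conf n → ℝ} (h : ∀ n x, m n x ≤ m' n x) (u : Fock) :
    wsq m u ≤ wsq m' u := by
  refine ENNReal.tsum_le_tsum fun n => lintegral_mono fun x => ENNReal.ofReal_le_ofReal ?_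
  exact mul_le_mul_of_nonneg_right (h n x) (by positivity)

theorem wsq_const_mul {c : ℝ} (hc : 0 ≤ c) (m : ∀ n, Conf n → ℝ) (u : Fock) :
    wsq (fun n x => c * m n x) u = ENNReal.ofReal c * wsq m u := by
  simp only [wsq]
  rw [← ENNReal.tsum_mul_left]
  refine tsum_congr fun n => ?_
  rw [← lintegral_const_mul' _ _ ENNReal.ofReal_ne_top]
  refine lintegral_congr fun x => ?_
  rw [mul_assoc, ENNReal.ofReal_mul hc]

theorem wave_permute (u : Fock) {n : ℕ} (p : Equiv.Perm (Fin n)) :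
    ∀ᵐ x ∂confMeasure n, wave u n (fun i => x (p i)) = wave u n x := by
  have h : permute p (wave u n) = wave u n := (u n).2 p
  have h2 := Lp.coeFn_compMeasurePreserving (wave u n) (measurePreserving_perm p)
  have h3 : (permute p (wave u n) : Conf n → ℂ) =ᵐ[confMeasure n]
      fun x => wave u n (fun i => x (p i)) := h2
  rw [h] at h3
  exact h3.symm

theorem aemeasurable_wave (u : Fock) (n : ℕ) :
    AEStronglyMeasurable (wave u n) (confMeasure n) := Lp.aestronglyMeasurable _

theorem wsq_add {m m' : ∀ n, Conf n → ℝ} (hm : ∀ n, Measurable (m n)) (h : ∀ n x, 0 ≤ m n x)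
    (h' : ∀ n x, 0 ≤ m' n x) (u : Fock) :
    wsq (fun n x => m n x + m' n x) u = wsq m u + wsq m' u := by
  simp only [wsq]
  rw [← ENNReal.tsum_add]
  refine tsum_congr fun n => ?_
  rw [← lintegral_add_left']
  · refine lintegral_congr fun x => ?_
    rw [add_mul, ENNReal.ofReal_add (mul_nonneg (h n x) (by positivity))
      (mul_nonneg (h' n x) (by positivity))]
  · exact ((hm n).aemeasurable.mul ((aemeasurable_wave u n).norm.aemeasurable.pow_const 2)).ennreal_ofReal

theorem wsq_add_le (m : ∀ n, Conf n → ℝ) (hm : ∀ n, Measurable (m n)) (h : ∀ n x, 0 ≤ m n x)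
    (u v : Fock) : wsq m (u + v) ≤ 2 * wsq m u + 2 * wsq m v := by
  have h2 : (2 : ENNReal) = ENNReal.ofReal 2 := by simp
  simp only [h2, ← wsq_const_mul zero_le_two]
  simp only [wsq]
  rw [← ENNReal.tsum_add]
  refine ENNReal.tsum_le_tsum fun n => ?_
  rw [← lintegral_add_left']
  · refine lintegral_mono_ae ?_
    filter_upwards [Lp.coeFn_add (wave u n) (wave v n)] with x hx
    rw [wave_add, hx, Pi.add_apply, ← ENNReal.ofReal_add (by have := h n x; positivity)
      (by have := h n x; positivity)]
    refine ENNReal.ofReal_le_ofReal ?_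
    have h3 := norm_add_le (wave u n x) (wave v n x)
    have h4 : ‖wave u n x + wave v n x‖ ^ 2 ≤ 2 * ‖wave u n x‖ ^ 2 + 2 * ‖wave v n x‖ ^ 2 := by
      nlinarith [norm_nonneg (wave u n x + wave v n x), norm_nonneg (wave u n x),
        norm_nonneg (wave v n x), sq_nonneg (‖wave u n x‖ - ‖wave v n x‖)]
    nlinarith [mul_le_mul_of_nonneg_left h4 (h n x)]
  · exact ((hm n).const_mul 2).aemeasurable.mul ((aemeasurable_wave u n).norm.aemeasurable.pow_const 2)
      |>.ennreal_ofReal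

theorem wsq_smul (m : ∀ n, Conf n → ℝ) (c : ℂ) (u : Fock) :
    wsq m (c • u) = ENNReal.ofReal (‖c‖ ^ 2) * wsq m u := by
  simp only [wsq]
  rw [← ENNReal.tsum_mul_left]
  refine tsum_congr fun n => ?_
  rw [← lintegral_const_mul' _ _ ENNReal.ofReal_ne_top]
  refine lintegral_congr_ae ?_
  filter_upwards [Lp.coeFn_smul c (wave u n)] with x hx
  rw [wave_smul, hx, Pi.smul_apply, norm_smul, mul_pow, ← ENNReal.ofReal_mul (by positivity)]
  congr 1; ring

/-- Construction of a Fock space vector from its wave functions. -/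
theorem exists_fock (φ : ∀ n, Conf n → ℂ)
    (hφ : ∀ n, AEStronglyMeasurable (φ n) (confMeasure n))
    (hs : ∀ n (p : Equiv.Perm (Fin n)), ∀ᵐ x ∂confMeasure n, φ n (fun i => x (p i)) = φ n x)
    (hfin : ∑' n, ∫⁻ x, ENNReal.ofReal (‖φ n x‖ ^ 2) ∂confMeasure n ≠ ⊤) :
    ∃ u : Fock, ∀ n, wave u n =ᵐ[confMeasure n] φ n := by
  have hn : ∀ n, ∫⁻ x, ENNReal.ofReal (‖φ n x‖ ^ 2) ∂confMeasure n ≠ ⊤ := fun n =>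
    ENNReal.ne_top_of_tsum_ne_top hfin n
  have hL : ∀ n, MemLp (φ n) 2 (confMeasure n) := by
    intro n
    rw [memLp_two_iff_integrable_sq_norm (hφ n)]
    refine ⟨(hφ n).norm.pow 2, ?_⟩
    rw [hasFiniteIntegral_iff_ofReal (Filter.Eventually.of_forall fun x => by positivity)]
    exact (hn n).lt_top
  have hsym : ∀ n, (hL n).toLp (φ n) ∈ symSector n := by
    intro n p
    apply Lp.ext
    have h2 := Lp.coeFn_compMeasurePreserving ((hL n).toLp (φ n)) (measurePreserving_perm p)
    have h3 : (permute p ((hL n).toLp (φ n)) : Conf n → ℂ) =ᵐ[confMeasure n]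
      fun x => (hL n).toLp (φ n) (fun i => x (p i)) := h2
    have h4 := (measurePreserving_perm p).quasiMeasurePreserving.ae (hL n).coeFn_toLp
    filter_upwards [h3, h4, (hL n).coeFn_toLp, hs n p] with x a b c d
    rw [a, b, d, c]
  have hsum : ∑' n, ENNReal.ofReal (‖(hL n).toLp (φ n)‖ ^ 2) ≠ ⊤ := by
    refine ne_of_eq_of_ne (tsum_congr fun n => ?_) hfin
    rw [← lintegral_normSq_sector]
    refine lintegral_congr_ae ?_
    filter_upwards [(hL n).coeFn_toLp] with x hx
    rw [hx]
  refine ⟨⟨fun n => ⟨(hL n).toLp (φ n), hsym n⟩, ?_⟩, fun n => (hL n).coeFn_toLp⟩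
  refine memℓp_gen ?_
  have := ENNReal.summable_toReal hsum
  refine this.congr fun n => ?_
  rw [ENNReal.toReal_ofReal (by positivity)]
  simp

/-- Invariance of a weight under permutations of the photons. -/
def SymWeight (m : ∀ n, Conf n → ℝ) : Prop :=
  (∀ n, Measurable (m n)) ∧ ∀ n (p : Equiv.Perm (Fin n)) x, m n (fun i => x (p i)) = m n x

/-- Multiplication operators carry their maximal domain, so finiteness of one weighted norm is the
only condition; symmetry of the weight keeps the product in the symmetric sectors. -/
theorem exists_mulGraph {m : ∀ n, Conf n → ℝ} (hm : SymWeight m) {u : Fock}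
    (h : wsq (fun n x => m n x ^ 2) u ≠ ⊤) : ∃ v, (u, v) ∈ mulGraph m := by
  refine exists_fock (fun n x => (m n x : ℂ) * wave u n x) (fun n => ?_) (fun n p => ?_) ?_
  · exact (Complex.measurable_ofReal.comp (hm.1 n)).aestronglyMeasurable.mul (aemeasurable_wave u n)
  · filter_upwards [wave_permute u p] with x hx
    rw [hx, hm.2]
  · refine ne_of_eq_of_ne (tsum_congr fun n => lintegral_congr fun x => ?_) h
    rw [norm_mul, mul_pow, Complex.norm_real, Real.norm_eq_abs, sq_abs]

/-- Reduces operator inequalities between multiplication operators to pointwise inequalities between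
weights. -/
theorem wsq_of_mulGraph {r : ∀ n, Conf n → ℝ} {u v : Fock} (h : (u, v) ∈ mulGraph r)
    (m : ∀ n, Conf n → ℝ) : wsq m v = wsq (fun n x => m n x * r n x ^ 2) u := by
  refine tsum_congr fun n => lintegral_congr_ae ?_
  filter_upwards [h n] with x hx
  rw [hx, norm_mul, mul_pow, Complex.norm_real, Real.norm_eq_abs, sq_abs, mul_assoc]

theorem mulGraph_unique {r : ∀ n, Conf n → ℝ} {u v v' : Fock} (h : (u, v) ∈ mulGraph r)
    (h' : (u, v') ∈ mulGraph r) : v = v' := by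
  apply wave_ext
  intro n
  apply Lp.ext
  filter_upwards [h n, h' n] with x a b
  exact a.trans b.symm

theorem mulGraph_add_weight {r s : ∀ n, Conf n → ℝ} {u v w : Fock} (h : (u, v) ∈ mulGraph r)
    (h' : (u, w) ∈ mulGraph s) : (u, v + w) ∈ mulGraph fun n x => r n x + s n x := by
  intro n
  filter_upwards [h n, h' n, Lp.coeFn_add (wave v n) (wave w n)] with x a b c
  rw [wave_add, c, Pi.add_apply, a, b, Complex.ofReal_add, add_mul]

theorem mulGraph_smul_weight {r : ∀ n, Conf n → ℝ} {u v : Fock} (h : (u, v) ∈ mulGraph r)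
    (c : ℝ) : (u, (c : ℂ) • v) ∈ mulGraph fun n x => c * r n x := by
  intro n
  filter_upwards [h n, Lp.coeFn_smul (c : ℂ) (wave v n)] with x a b
  rw [wave_smul, b, Pi.smul_apply, a, Complex.ofReal_mul, smul_eq_mul, mul_assoc]

theorem mulGraph_comp {r s : ∀ n, Conf n → ℝ} {u v w : Fock} (h : (u, v) ∈ mulGraph r)
    (h' : (v, w) ∈ mulGraph s) : (u, w) ∈ mulGraph fun n x => s n x * r n x := by
  intro n
  filter_upwards [h n, h' n] with x a b
  rw [b, a, Complex.ofReal_mul, mul_assoc]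

theorem inner_eq_tsum_wave (u v : Fock) : ⟪u, v⟫_ℂ = ∑' n, ⟪wave u n, wave v n⟫_ℂ :=
  lp.inner_eq_tsum u v

theorem inner_wave (f g : SectorL2 n) :
    ⟪f, g⟫_ℂ = ∫ x, g x * (starRingEnd ℂ) (f x) ∂confMeasure n := by
  rw [L2.inner_def]; rfl

/-- Multiplication operators by real functions are symmetric. -/
theorem mulGraph_symm {r : ∀ n, Conf n → ℝ} {u v u' v' : Fock} (h : (u, v) ∈ mulGraph r)
    (h' : (u', v') ∈ mulGraph r) : ⟪u, v'⟫_ℂ = ⟪v, u'⟫_ℂ := by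
  rw [inner_eq_tsum_wave, inner_eq_tsum_wave]
  refine tsum_congr fun n => ?_
  rw [inner_wave, inner_wave]
  refine integral_congr_ae ?_
  filter_upwards [h n, h' n] with x a b
  rw [a, b, map_mul, Complex.conj_ofReal]; ring

/-- A multiplication operator as a quadratic form. -/
theorem inner_mulGraph {r : ∀ n, Conf n → ℝ} (hr : ∀ n x, 0 ≤ r n x) {u v : Fock}
    (h : (u, v) ∈ mulGraph r) : ENNReal.ofReal (⟪u, v⟫_ℂ).re = wsq r u := by
  have hs := lp.hasSum_inner (𝕜 := ℂ) u v
  have hs2 : HasSum (fun n => (⟪wave u n, wave v n⟫_ℂ).re) (⟪u, v⟫_ℂ).re :=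
    (Complex.hasSum_re hs :)
  have hre : ∀ n, (⟪wave u n, wave v n⟫_ℂ).re =
      ∫ x, r n x * ‖wave u n x‖ ^ 2 ∂confMeasure n := by
    intro n
    have : ⟪wave u n, wave v n⟫_ℂ = ((∫ x, r n x * ‖wave u n x‖ ^ 2 ∂confMeasure n : ℝ) : ℂ) := by
      rw [inner_wave, ← integral_complex_ofReal]
      refine integral_congr_ae ?_
      filter_upwards [h n] with x a
      rw [a, mul_assoc, Complex.mul_conj, Complex.normSq_eq_norm_sq]
      push_cast; ring
    rw [this, Complex.ofReal_re]
  have hint : ∀ n, Integrable (fun x => r n x * ‖wave u n x‖ ^ 2) (confMeasure n) := by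
    intro n
    have h1 : Integrable (fun x => ⟪wave u n x, wave v n x⟫_ℂ) (confMeasure n) :=
      L2.integrable_inner (wave u n) (wave v n)
    refine (h1.norm).congr ?_
    filter_upwards [h n] with x a
    rw [a, ← smul_eq_mul, inner_smul_right, norm_mul, Complex.norm_real, Real.norm_eq_abs,
      abs_of_nonneg (hr n x), inner_self_eq_norm_sq_to_K]
    simp
  have hnn : ∀ n, 0 ≤ (⟪wave u n, wave v n⟫_ℂ).re := fun n => by
    rw [hre]; exact integral_nonneg fun x => mul_nonneg (hr n x) (by positivity)
  rw [← hs2.tsum_eq, ENNReal.ofReal_tsum_of_nonneg hnn hs2.summable]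
  refine tsum_congr fun n => ?_
  rw [hre, ofReal_integral_eq_lintegral_ofReal (hint n)]
  exact Filter.Eventually.of_forall fun x => mul_nonneg (hr n x) (by positivity)

theorem norm_sq_le_of_wsq_le {u : Fock} {C : ℝ} (hC : 0 ≤ C)
    (h : wsq (fun _ _ => 1) u ≤ ENNReal.ofReal C) : ‖u‖ ^ 2 ≤ C := by
  rw [wsq_one] at h
  exact (ENNReal.ofReal_le_ofReal_iff hC).1 h

theorem wsq_one_ne_top (u : Fock) : wsq (fun _ _ => 1) u ≠ ⊤ := by
  rw [wsq_one]; exact ENNReal.ofReal_ne_top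

/-- Multiplication by a bounded symmetric function. -/
theorem exists_mulGraph_of_bounded {m : ∀ n, Conf n → ℝ} (hm : SymWeight m) {C : ℝ}
    (hC : ∀ n x, |m n x| ≤ C) (u : Fock) : ∃ v, (u, v) ∈ mulGraph m := by
  refine exists_mulGraph hm (ne_top_of_le_ne_top ?_
    (wsq_mono (m' := fun n x => C ^ 2 * 1) (fun n x => ?_) u))
  · rw [wsq_const_mul (by positivity)]
    exact ENNReal.mul_ne_top ENNReal.ofReal_ne_top (wsq_one_ne_top u)
  · rw [mul_one]
    exact sq_le_sq' (by linarith [neg_abs_le (m n x), hC n x]) ((le_abs_self _).trans (hC n x))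

/-! ### Creation operators -/

/-- The total photon energy `∑ |kᵢ|`. -/
def omega (n : ℕ) (x : Conf n) : ℝ := ∑ i, ‖(x i).1‖

theorem omega_nonneg (n : ℕ) (x : Conf n) : 0 ≤ omega n x :=
  Finset.sum_nonneg fun _ _ => norm_nonneg _

theorem symWeight_omega : SymWeight omega := by
  refine ⟨fun n => ?_, fun n p x => ?_⟩
  · exact Finset.measurable_sum _ fun i _ => (measurable_pi_apply i).fst.norm
  · exact Equiv.sum_comp p fun i => ‖(x i).1‖

theorem omega_removeNth {n : ℕ} (x : Conf (n + 1)) (i : Fin (n + 1)) :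
    omega (n + 1) x = ‖(x i).1‖ + omega n (i.removeNth x) := by
  unfold omega
  rw [Fin.sum_univ_succAbove _ i]
  rfl

/-- The one-photon norm `∫ |f|² (1 + 1 / |k|)`. -/
def photonNormSq (f : Photon → ℂ) : ENNReal :=
  ∫⁻ y, ENNReal.ofReal (‖f y‖ ^ 2 * (1 + ‖y.1‖⁻¹)) ∂photonMeasure

theorem ae_photon_ne_zero : ∀ᵐ y ∂photonMeasure, y.1 ≠ 0 := by
  have h : ∀ᵐ k ∂(volume : Measure R3), k ≠ 0 := by
    rw [ae_iff]
    simp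
  exact (Measure.quasiMeasurePreserving_fst (μ := (volume : Measure R3)) (ν := Measure.count)).ae h

theorem quasiMeasurePreserving_eval_conf {n : ℕ} (i : Fin n) :
    Measure.QuasiMeasurePreserving (fun x : Conf n => x i) (confMeasure n) photonMeasure :=
  Measure.quasiMeasurePreserving_eval (fun _ : Fin n => photonMeasure) i

theorem ae_conf_ne_zero (n : ℕ) : ∀ᵐ x ∂confMeasure n, ∀ i, (x i).1 ≠ 0 :=
  ae_all_iff.2 fun i => (quasiMeasurePreserving_eval_conf i).ae ae_photon_ne_zero

/-- Tonelli, after splitting off the `i`-th photon. -/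
theorem lintegral_removeNth {n : ℕ} (i : Fin (n + 1)) {G : Photon → ENNReal} {F : Conf n → ENNReal}
    (hG : AEMeasurable G photonMeasure) (hF : AEMeasurable F (confMeasure n)) :
    ∫⁻ x, G (x i) * F (i.removeNth x) ∂confMeasure (n + 1) =
      (∫⁻ y, G y ∂photonMeasure) * ∫⁻ x, F x ∂confMeasure n := by
  have h := measurePreserving_piFinSuccAbove (fun _ : Fin (n + 1) => photonMeasure) i
  have h2 := h.lintegral_comp_emb (MeasurableEquiv.measurableEmbedding _)
    (fun z => G z.1 * F z.2)
  have h3 : ∫⁻ x, G (x i) * F (i.removeNth x) ∂confMeasure (n + 1) =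
      ∫⁻ z, G z.1 * F z.2 ∂(photonMeasure.prod (confMeasure n)) := by
    exact h2
  rw [h3, lintegral_prod_mul hG hF]

/-- Cauchy–Schwarz with weights `|kᵢ|` gives `(∑ aᵢ)² ≤ ω ∑ aᵢ² / |kᵢ|`, and `ω = |kᵢ| + ω'` yields
`ω / |kᵢ| ≤ (1 + 1/|kᵢ|)(1 + ω')`. This is why the field energy, and not the photon number, controls
creation operators. -/
theorem sq_sum_le_omega_mul {n : ℕ} (x : Conf (n + 1)) (hx : ∀ i, (x i).1 ≠ 0)
    (a : Fin (n + 1) → ℝ) :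
    (∑ i, a i) ^ 2 ≤ ∑ i, a i ^ 2 * (1 + ‖(x i).1‖⁻¹) * (1 + omega n (i.removeNth x)) := by
  have hpos : ∀ i, 0 < ‖(x i).1‖ := fun i => norm_pos_iff.2 (hx i)
  have hO : 0 < omega (n + 1) x := Finset.sum_pos (fun i _ => hpos i) ⟨0, Finset.mem_univ _⟩
  have h := Finset.sq_sum_div_le_sum_sq_div Finset.univ a (g := fun i => ‖(x i).1‖)
    (fun i _ => hpos i)
  rw [← omega, div_le_iff₀ hO, Finset.sum_mul] at h
  refine h.trans (Finset.sum_le_sum fun i _ => ?_)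
  rw [omega_removeNth x i, div_mul_eq_mul_div, mul_assoc, mul_div_assoc]
  refine mul_le_mul_of_nonneg_left ?_ (sq_nonneg _)
  have h1 := omega_nonneg n (i.removeNth x)
  have h2 := hpos i
  rw [div_le_iff₀ h2]
  have : (1 + ‖(x i).1‖⁻¹) * (1 + omega n (i.removeNth x)) * ‖(x i).1‖ =
      (‖(x i).1‖ + 1) * (1 + omega n (i.removeNth x)) := by
    field_simp
  rw [this]
  nlinarith

theorem lintegral_creation_le {f : Photon → ℂ} (hf : AEStronglyMeasurable f photonMeasure)
    {n : ℕ} (u : SectorL2 n) {m : Conf (n + 1) → ℝ} {m' : Conf n → ℝ} {c : ℝ} (hc : 0 ≤ c)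
    (hmeas : Measurable m') (hm' : ∀ x, 0 ≤ m' x)
    (hmm : ∀ x i, f (x i) ≠ 0 → m x ≤ c * m' (i.removeNth x)) :
    ∫⁻ x, ENNReal.ofReal (m x * ‖(((Real.sqrt (n + 1))⁻¹ : ℝ) : ℂ) *
        ∑ i, f (x i) * u (i.removeNth x)‖ ^ 2) ∂confMeasure (n + 1) ≤
      ENNReal.ofReal c * photonNormSq f *
        ∫⁻ x, ENNReal.ofReal (m' x * (1 + omega n x) * ‖u x‖ ^ 2) ∂confMeasure n := by
  have hn : (0 : ℝ) < n + 1 := by positivity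
  have key : ∀ᵐ x ∂confMeasure (n + 1), ENNReal.ofReal (m x *
      ‖(((Real.sqrt (n + 1))⁻¹ : ℝ) : ℂ) * ∑ i, f (x i) * u (i.removeNth x)‖ ^ 2) ≤
      ENNReal.ofReal (c / (n + 1)) * ∑ i, ENNReal.ofReal (‖f (x i)‖ ^ 2 * (1 + ‖(x i).1‖⁻¹)) *
        ENNReal.ofReal (m' (i.removeNth x) * (1 + omega n (i.removeNth x)) *
          ‖u (i.removeNth x)‖ ^ 2) := by
    filter_upwards [ae_conf_ne_zero (n + 1)] with x hx
    have hnn : ∀ i, 0 ≤ ‖f (x i)‖ ^ 2 * (1 + ‖(x i).1‖⁻¹) := fun i => by positivity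
    have hnn' : ∀ i : Fin (n + 1), 0 ≤ m' (i.removeNth x) * (1 + omega n (i.removeNth x)) *
        ‖u (i.removeNth x)‖ ^ 2 := fun i =>
      mul_nonneg (mul_nonneg (hm' _) (by linarith [omega_nonneg n (i.removeNth x)])) (sq_nonneg _)
    simp only [← ENNReal.ofReal_mul (hnn _)]
    rw [← ENNReal.ofReal_sum_of_nonneg (fun i _ => mul_nonneg (hnn i) (hnn' i)),
      ← ENNReal.ofReal_mul (by positivity)]
    refine ENNReal.ofReal_le_ofReal ?_
    -- The weight `m` carries no sign hypothesis; where it is nonpositive the left side is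
    -- nonpositive too.
    by_cases hmx : m x ≤ 0
    · exact (mul_nonpos_of_nonpos_of_nonneg hmx (sq_nonneg _)).trans
        (mul_nonneg (by positivity) (Finset.sum_nonneg fun i _ => mul_nonneg (hnn i) (hnn' i)))
    push Not at hmx
    rw [norm_mul, mul_pow, Complex.norm_real, Real.norm_eq_abs, sq_abs, inv_pow,
      Real.sq_sqrt hn.le]
    have h1 : ‖∑ i, f (x i) * u (i.removeNth x)‖ ^ 2 ≤
        (∑ i, ‖f (x i)‖ * ‖u (i.removeNth x)‖) ^ 2 := by
      refine pow_le_pow_left₀ (norm_nonneg _) ((norm_sum_le _ _).trans_eq ?_) 2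
      exact Finset.sum_congr rfl fun i _ => norm_mul _ _
    have h2 := h1.trans (sq_sum_le_omega_mul x hx _)
    have h3 : m x * ‖∑ i, f (x i) * u (i.removeNth x)‖ ^ 2 ≤
        c * ∑ i, ‖f (x i)‖ ^ 2 * (1 + ‖(x i).1‖⁻¹) *
          (m' (i.removeNth x) * (1 + omega n (i.removeNth x)) * ‖u (i.removeNth x)‖ ^ 2) := by
      refine (mul_le_mul_of_nonneg_left h2 hmx.le).trans ?_
      rw [Finset.mul_sum, Finset.mul_sum]
      refine Finset.sum_le_sum fun i _ => ?_
      -- The growth hypothesis is only available for photons in the support of `f`.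
      by_cases h0 : f (x i) = 0
      · simp [h0]
      have h4 := mul_le_mul_of_nonneg_right (hmm x i h0) (show 0 ≤
        (‖f (x i)‖ * ‖u (i.removeNth x)‖) ^ 2 * (1 + ‖(x i).1‖⁻¹) *
          (1 + omega n (i.removeNth x)) from by
        have := omega_nonneg n (i.removeNth x)
        positivity)
      refine h4.trans_eq ?_
      ring
    have h5 := mul_le_mul_of_nonneg_left h3 (show (0 : ℝ) ≤ (n + 1 : ℝ)⁻¹ by positivity)
    refine (Eq.trans_le ?_ h5).trans_eq ?_ <;> ring
  refine (lintegral_mono_ae key).trans ?_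
  rw [lintegral_const_mul' _ _ ENNReal.ofReal_ne_top]
  have hG : AEMeasurable (fun y => ENNReal.ofReal (‖f y‖ ^ 2 * (1 + ‖y.1‖⁻¹))) photonMeasure :=
    ((hf.norm.aemeasurable.pow_const 2).mul
      ((measurable_fst.norm.inv.const_add 1).aemeasurable)).ennreal_ofReal
  have hF : AEMeasurable (fun x => ENNReal.ofReal (m' x * (1 + omega n x) * ‖u x‖ ^ 2))
      (confMeasure n) :=
    (((hmeas.mul ((symWeight_omega.1 n).const_add 1)).aemeasurable).mul
      ((Lp.aestronglyMeasurable u).norm.aemeasurable.pow_const 2)).ennreal_ofReal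
  rw [lintegral_finsetSum']
  -- All `n + 1` summands have the same integral, which cancels the factor `1 / (n + 1)`.
  · simp only [lintegral_removeNth _ hG hF, Finset.sum_const, Finset.card_univ, Fintype.card_fin]
    rw [← photonNormSq, nsmul_eq_mul, ← mul_assoc, ← mul_assoc]
    gcongr
    rw [← ENNReal.ofReal_natCast, ← ENNReal.ofReal_mul (by positivity)]
    refine ENNReal.ofReal_le_ofReal (le_of_eq ?_)
    push_cast
    field_simp
  · intro i _
    exact (hG.comp_quasiMeasurePreserving (quasiMeasurePreserving_eval_conf i)).mul
      (hF.comp_quasiMeasurePreserving (quasiMeasurePreserving_removeNth i))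

/-- `m` grows at most by the factor `c` when a photon in the support of `f` is added. -/
def AddStable (f : Photon → ℂ) (c : ℝ) (m : ∀ n, Conf n → ℝ) : Prop :=
  ∀ n (x : Conf (n + 1)) i, f (x i) ≠ 0 → m (n + 1) x ≤ c * m n (i.removeNth x)

theorem wsq_creation_le {f : Photon → ℂ} (hf : AEStronglyMeasurable f photonMeasure)
    {u v : Fock} (h : (u, v) ∈ creationGraph f) {m : ∀ n, Conf n → ℝ} {c : ℝ} (hc : 0 ≤ c)
    (hmeas : ∀ n, Measurable (m n)) (hm : ∀ n x, 0 ≤ m n x) (hmm : AddStable f c m) :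
    wsq m v ≤ ENNReal.ofReal c * photonNormSq f * wsq (fun n x => m n x * (1 + omega n x)) u := by
  rw [wsq, tsum_eq_zero_add' ENNReal.summable, wsq, ← ENNReal.tsum_mul_left]
  have h0 : ∫⁻ x, ENNReal.ofReal (m 0 x * ‖wave v 0 x‖ ^ 2) ∂confMeasure 0 = 0 := by
    rw [lintegral_eq_zero_iff']
    · rw [h.1]
      filter_upwards [Lp.coeFn_zero ℂ 2 (confMeasure 0)] with x hx
      rw [hx]; simp
    · exact ((hmeas 0).aemeasurable.mul
        ((aemeasurable_wave v 0).norm.aemeasurable.pow_const 2)).ennreal_ofReal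
  rw [h0, zero_add]
  refine ENNReal.tsum_le_tsum fun n => ?_
  refine le_trans (le_of_eq (lintegral_congr_ae ?_))
    (lintegral_creation_le hf (wave u n) hc (hmeas n) (hm n) (hmm n))
  filter_upwards [h.2 n] with x hx
  rw [hx]

/-- The defining formula is symmetric in the photons, and the preceding estimate with unit weight
makes it square-integrable. -/
theorem exists_creation {f : Photon → ℂ} (hf : AEStronglyMeasurable f photonMeasure)
    (hfin : photonNormSq f ≠ ⊤) {u : Fock} (hu : wsq (fun n x => 1 + omega n x) u ≠ ⊤) :
    ∃ v, (u, v) ∈ creationGraph f := by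
  let φ : ∀ n, Conf n → ℂ := fun n => match n with
    | 0 => fun _ => 0
    | n + 1 => fun x => (((Real.sqrt (n + 1))⁻¹ : ℝ) : ℂ) *
        ∑ i, f (x i) * wave u n (i.removeNth x)
  suffices h : ∃ v : Fock, ∀ n, wave v n =ᵐ[confMeasure n] φ n by
    obtain ⟨v, hv⟩ := h
    refine ⟨v, ?_, fun n => hv (n + 1)⟩
    apply Lp.ext
    filter_upwards [hv 0, Lp.coeFn_zero ℂ 2 (confMeasure 0)] with x h1 h2
    rw [h1]; exact h2.symm
  refine exists_fock φ (fun n => ?_) (fun n p => ?_) ?_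
  · rcases n with _ | n
    · exact aestronglyMeasurable_const
    · refine aestronglyMeasurable_const.mul ?_
      refine Finset.aestronglyMeasurable_fun_sum _ fun i _ => ?_
      exact (hf.comp_quasiMeasurePreserving (quasiMeasurePreserving_eval_conf i)).mul
        ((aemeasurable_wave u n).comp_quasiMeasurePreserving (quasiMeasurePreserving_removeNth i))
  · rcases n with _ | n
    · exact Filter.Eventually.of_forall fun _ => rfl
    · have hsym : ∀ i : Fin (n + 1), ∀ᵐ x ∂confMeasure (n + 1),
          wave u n (i.removeNth fun j => x (p j)) = wave u n ((p i).removeNth x) := by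
        intro i
        -- `p` maps the complement of `i` onto the complement of `p i`; relabelling both by `Fin n`
        -- gives a permutation of the remaining photons, under which the wave function is invariant.
        let e : Fin n ≃ Fin n :=
          (finSuccAboveEquiv i).trans
            ((p.subtypeEquiv (fun a => by simp)).trans (finSuccAboveEquiv (p i)).symm)
        have he : ∀ j, (p i).succAbove (e j) = p (i.succAbove j) := by
          intro j
          have := (finSuccAboveEquiv (p i)).apply_symm_apply
            ((p.subtypeEquiv (fun a => by simp)) ((finSuccAboveEquiv i) j))
          exact congrArg Subtype.val this
        filter_upwards [(quasiMeasurePreserving_removeNth (p i)).ae (wave_permute u e)] with x hx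
        rw [← hx]
        congr 1
        funext j
        simp only [Fin.removeNth, he]
      filter_upwards [ae_all_iff.2 hsym] with x hx
      simp only [φ, hx]
      congr 1
      exact Equiv.sum_comp p fun i => f (x i) * wave u n (i.removeNth x)
  · refine ne_top_of_le_ne_top (ENNReal.mul_ne_top hfin hu) ?_
    rw [tsum_eq_zero_add' ENNReal.summable, wsq, ← ENNReal.tsum_mul_left]
    simp only [φ, norm_zero, ne_eq, OfNat.ofNat_ne_zero, not_false_eq_true, zero_pow,
      ENNReal.ofReal_zero, lintegral_zero, zero_add]
    refine ENNReal.tsum_le_tsum fun n => ?_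
    have := lintegral_creation_le hf (wave u n) (m := fun _ => 1) (m' := fun _ => 1) zero_le_one
      measurable_const (fun _ => zero_le_one) (fun x i _ => by simp)
    simpa using this

theorem creationGraph_unique {f : Photon → ℂ} {u v v' : Fock} (h : (u, v) ∈ creationGraph f)
    (h' : (u, v') ∈ creationGraph f) : v = v' := by
  rw [← creation_graph] at h h'
  exact (creation f).mem_graph_snd_inj h h' rfl

theorem creationGraph_add {f g : Photon → ℂ} {u v w : Fock} (h : (u, v) ∈ creationGraph f)
    (h' : (u, w) ∈ creationGraph g) : (u, v + w) ∈ creationGraph (f + g) := by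
  refine ⟨by rw [wave_add, h.1, h'.1, add_zero], fun n => ?_⟩
  filter_upwards [h.2 n, h'.2 n, Lp.coeFn_add (wave v (n + 1)) (wave w (n + 1))] with x a b c
  rw [wave_add, c, Pi.add_apply, a, b, ← mul_add, ← Finset.sum_add_distrib]
  simp only [Pi.add_apply, add_mul]

theorem creationGraph_smul {f : Photon → ℂ} {u v : Fock} (h : (u, v) ∈ creationGraph f) (c : ℂ) :
    (u, c • v) ∈ creationGraph (c • f) := by
  refine ⟨by rw [wave_smul, h.1, smul_zero], fun n => ?_⟩
  filter_upwards [h.2 n, Lp.coeFn_smul c (wave v (n + 1))] with x a b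
  rw [wave_smul, b, Pi.smul_apply, a]
  simp only [Pi.smul_apply, smul_eq_mul, Finset.mul_sum]
  exact Finset.sum_congr rfl fun i _ => by ring

/-! ### Annihilation operators -/

/-- `m` grows at most by the factor `c` when a photon in the support of `f` is removed. -/
def RemoveStable (f : Photon → ℂ) (c : ℝ) (m : ∀ n, Conf n → ℝ) : Prop :=
  ∀ n (x : Conf (n + 1)) i, f (x i) ≠ 0 → m n (i.removeNth x) ≤ c * m (n + 1) x

theorem two_mul_ofReal (a : ℝ) : 2 * ENNReal.ofReal a = ENNReal.ofReal (2 * a) := by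
  rw [ENNReal.ofReal_mul zero_le_two, ENNReal.ofReal_ofNat]

theorem enorm_inner_le (u v : Fock) :
    ‖⟪u, v⟫_ℂ‖ₑ ≤
      ∑' n, ∫⁻ x, ENNReal.ofReal (‖wave u n x‖ * ‖wave v n x‖) ∂confMeasure n := by
  rw [inner_eq_tsum_wave]
  have hs : Summable fun n => ⟪wave u n, wave v n⟫_ℂ := lp.summable_inner (𝕜 := ℂ) u v
  refine enorm_tsum_le_tsum_enorm.trans ?_
  refine ENNReal.tsum_le_tsum fun n => ?_
  rw [inner_wave]
  refine (enorm_integral_le_lintegral_enorm _).trans (le_of_eq (lintegral_congr fun x => ?_))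
  rw [← ofReal_norm, norm_mul, RCLike.norm_conj, mul_comm]

/-- The dual form of the creation estimate, from which both the domain and the bounds of `a(f)`
follow. The free parameter `s` distributes the constant between the two sides; the weight appears
directly on `u` and inverted on `w`. -/
theorem enorm_inner_creation_le {f : Photon → ℂ} (hf : AEStronglyMeasurable f photonMeasure)
    {u w w' : Fock} (h : (w, w') ∈ creationGraph f) {m : ∀ n, Conf n → ℝ} {c s : ℝ} (hc : 0 ≤ c)
    (hs : 0 < s) (hmeas : ∀ n, Measurable (m n)) (hm : ∀ n x, 0 < m n x)
    (hmm : RemoveStable f c m) :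
    2 * ‖⟪u, w'⟫_ℂ‖ₑ ≤ ENNReal.ofReal (s * c) * wsq (fun n x => m n x * omega n x) u +
      ENNReal.ofReal s⁻¹ * photonNormSq f * wsq (fun n x => (m n x)⁻¹) w := by
  have step : ∀ n, 2 * ∫⁻ x, ENNReal.ofReal (‖wave u (n + 1) x‖ * ‖wave w' (n + 1) x‖)
      ∂confMeasure (n + 1) ≤
      ENNReal.ofReal (s * c) * ∫⁻ x, ENNReal.ofReal (m (n + 1) x * omega (n + 1) x *
        ‖wave u (n + 1) x‖ ^ 2) ∂confMeasure (n + 1) +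
      ENNReal.ofReal s⁻¹ * photonNormSq f * ∫⁻ x, ENNReal.ofReal ((m n x)⁻¹ * ‖wave w n x‖ ^ 2)
        ∂confMeasure n := by
    intro n
    have hn : (0 : ℝ) < n + 1 := by positivity
    have key : ∀ᵐ x ∂confMeasure (n + 1),
        2 * ENNReal.ofReal (‖wave u (n + 1) x‖ * ‖wave w' (n + 1) x‖) ≤
        ENNReal.ofReal (s * c) * ENNReal.ofReal (m (n + 1) x * omega (n + 1) x *
          ‖wave u (n + 1) x‖ ^ 2) + ENNReal.ofReal (s⁻¹ / (n + 1)) *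
          ∑ i, ENNReal.ofReal (‖f (x i)‖ ^ 2 * (1 + ‖(x i).1‖⁻¹)) *
            ENNReal.ofReal ((m n (i.removeNth x))⁻¹ * ‖wave w n (i.removeNth x)‖ ^ 2) := by
      filter_upwards [ae_conf_ne_zero (n + 1), h.2 n] with x hx hw
      have hnn : ∀ i, 0 ≤ ‖f (x i)‖ ^ 2 * (1 + ‖(x i).1‖⁻¹) := fun i => by positivity
      have hnn' : ∀ i : Fin (n + 1), 0 ≤ (m n (i.removeNth x))⁻¹ *
          ‖wave w n (i.removeNth x)‖ ^ 2 := fun i => by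
        have := hm n (i.removeNth x)
        positivity
      simp only [← ENNReal.ofReal_mul (hnn _)]
      have hO := omega_nonneg (n + 1) x
      have hmx := hm (n + 1) x
      rw [← ENNReal.ofReal_sum_of_nonneg (fun i _ => mul_nonneg (hnn i) (hnn' i)),
        ← ENNReal.ofReal_mul (by positivity), ← ENNReal.ofReal_mul (by positivity),
        ← ENNReal.ofReal_add (by positivity) (mul_nonneg (by positivity)
          (Finset.sum_nonneg fun i _ => mul_nonneg (hnn i) (hnn' i))),
        two_mul_ofReal]
      refine ENNReal.ofReal_le_ofReal ?_
      rw [hw, norm_mul, Complex.norm_real, Real.norm_eq_abs, abs_inv,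
        abs_of_nonneg (Real.sqrt_nonneg _)]
      set a := ‖wave u (n + 1) x‖
      set q := (Real.sqrt (n + 1))⁻¹
      have hq : q ^ 2 = (n + 1 : ℝ)⁻¹ := by rw [inv_pow, Real.sq_sqrt hn.le]
      have hq0 : 0 ≤ q := by positivity
      have h1 : ‖∑ i, f (x i) * wave w n (i.removeNth x)‖ ≤
          ∑ i, ‖f (x i)‖ * ‖wave w n (i.removeNth x)‖ :=
        (norm_sum_le _ _).trans_eq (Finset.sum_congr rfl fun i _ => norm_mul _ _)
      calc 2 * (a * (q * ‖∑ i, f (x i) * wave w n (i.removeNth x)‖))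
          ≤ 2 * (a * (q * ∑ i, ‖f (x i)‖ * ‖wave w n (i.removeNth x)‖)) := by gcongr
        _ = ∑ i, 2 * a * q * (‖f (x i)‖ * ‖wave w n (i.removeNth x)‖) := by
            simp only [Finset.mul_sum]
            exact Finset.sum_congr rfl fun i _ => by ring
        _ ≤ ∑ i, (s * c * (m (n + 1) x * ‖(x i).1‖ * a ^ 2) + s⁻¹ / (n + 1) *
            ((‖f (x i)‖ ^ 2 * (1 + ‖(x i).1‖⁻¹)) *
              ((m n (i.removeNth x))⁻¹ * ‖wave w n (i.removeNth x)‖ ^ 2))) := by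
            refine Finset.sum_le_sum fun i _ => ?_
            by_cases h0 : f (x i) = 0
            · simp only [h0, norm_zero, zero_mul, mul_zero]
              have := hnn' i
              positivity
            have hk : 0 < ‖(x i).1‖ := norm_pos_iff.2 (hx i)
            have hmi := hm n (i.removeNth x)
            set k := ‖(x i).1‖
            set μ := m n (i.removeNth x)
            set b := ‖f (x i)‖ * ‖wave w n (i.removeNth x)‖
            -- Young's inequality with the photon's own energy in the weight: summed over `i`, the
            -- first term produces `ω`, and the second the infrared factor `1/|kᵢ|`.
            have h2 : 2 * a * q * b ≤ s * μ * k * a ^ 2 + (s * μ * k)⁻¹ * (q ^ 2 * b ^ 2) := by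
              have hp : 0 < s * μ * k := by positivity
              have h3 : 0 ≤ (s * μ * k)⁻¹ * (s * μ * k * a - q * b) ^ 2 := by positivity
              have h4 : (s * μ * k)⁻¹ * (s * μ * k * a - q * b) ^ 2 =
                  s * μ * k * a ^ 2 - 2 * a * q * b + (s * μ * k)⁻¹ * (q ^ 2 * b ^ 2) := by
                field_simp
                ring
              linarith
            refine h2.trans (add_le_add ?_ ?_)
            · have h5 := hmm n x i h0
              have : s * μ * k * a ^ 2 ≤ s * (c * m (n + 1) x) * k * a ^ 2 := by gcongr
              linarith
            · rw [hq]
              have h6 : k⁻¹ ≤ 1 + k⁻¹ := by linarith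
              calc (s * μ * k)⁻¹ * ((n + 1 : ℝ)⁻¹ * b ^ 2)
                  = s⁻¹ / (n + 1) * ((‖f (x i)‖ ^ 2 * k⁻¹) *
                    (μ⁻¹ * ‖wave w n (i.removeNth x)‖ ^ 2)) := by
                    simp only [b]; field_simp
                _ ≤ _ := by gcongr
        _ = _ := by
            rw [Finset.sum_add_distrib, ← Finset.mul_sum, ← Finset.mul_sum, omega]
            congr 2
            rw [Finset.mul_sum, Finset.sum_mul]
    rw [← lintegral_const_mul' _ _ ENNReal.ofNat_ne_top]
    refine (lintegral_mono_ae key).trans ?_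
    have hG : AEMeasurable (fun y => ENNReal.ofReal (‖f y‖ ^ 2 * (1 + ‖y.1‖⁻¹))) photonMeasure :=
      ((hf.norm.aemeasurable.pow_const 2).mul
        ((measurable_fst.norm.inv.const_add 1).aemeasurable)).ennreal_ofReal
    have hF : AEMeasurable (fun x => ENNReal.ofReal ((m n x)⁻¹ * ‖wave w n x‖ ^ 2))
        (confMeasure n) :=
      ((hmeas n).inv.aemeasurable.mul
        ((aemeasurable_wave w n).norm.aemeasurable.pow_const 2)).ennreal_ofReal
    rw [lintegral_add_left', lintegral_const_mul' _ _ ENNReal.ofReal_ne_top,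
      lintegral_const_mul' _ _ ENNReal.ofReal_ne_top, lintegral_finsetSum']
    · simp only [lintegral_removeNth _ hG hF, Finset.sum_const, Finset.card_univ, Fintype.card_fin]
      rw [← photonNormSq, nsmul_eq_mul, ← mul_assoc, ← mul_assoc]
      gcongr
      rw [← ENNReal.ofReal_natCast, ← ENNReal.ofReal_mul (by positivity)]
      refine ENNReal.ofReal_le_ofReal (le_of_eq ?_)
      push_cast
      field_simp
    · intro i _
      exact (hG.comp_quasiMeasurePreserving (quasiMeasurePreserving_eval_conf i)).mul
        (hF.comp_quasiMeasurePreserving (quasiMeasurePreserving_removeNth i))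
    · exact ((((hmeas _).mul (symWeight_omega.1 _)).aemeasurable.mul
        ((aemeasurable_wave u _).norm.aemeasurable.pow_const 2)).ennreal_ofReal).const_mul _
  refine (mul_le_mul_right (enorm_inner_le u w') 2).trans ?_
  have h0 : ∫⁻ x, ENNReal.ofReal (‖wave u 0 x‖ * ‖wave w' 0 x‖) ∂confMeasure 0 = 0 := by
    rw [lintegral_eq_zero_iff']
    · rw [h.1]
      filter_upwards [Lp.coeFn_zero ℂ 2 (confMeasure 0)] with x hx
      rw [hx]; simp
    · exact ((aemeasurable_wave u 0).norm.aemeasurable.mul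
        (aemeasurable_wave w' 0).norm.aemeasurable).ennreal_ofReal
  rw [tsum_eq_zero_add' ENNReal.summable, h0, zero_add, ← ENNReal.tsum_mul_left]
  refine (ENNReal.tsum_le_tsum step).trans ?_
  rw [ENNReal.tsum_add, ENNReal.tsum_mul_left, ENNReal.tsum_mul_left]
  refine add_le_add (mul_le_mul_right ?_ _) le_rfl
  rw [wsq, tsum_eq_zero_add' ENNReal.summable (f := fun n => ∫⁻ x, ENNReal.ofReal
    (m n x * omega n x * ‖wave u n x‖ ^ 2) ∂confMeasure n)]
  exact le_add_self

theorem symWeight_comp {m : ∀ n, Conf n → ℝ} (hm : SymWeight m) {φ : ℝ → ℝ} (hφ : Measurable φ) :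
    SymWeight fun n x => φ (m n x) :=
  ⟨fun n => hφ.comp (hm.1 n), fun n p x => congrArg φ (hm.2 n p x)⟩

/-- A submodule containing the range of a nowhere vanishing bounded multiplication operator is
dense. -/
theorem dense_of_mulGraph {r : ∀ n, Conf n → ℝ} (hr : SymWeight r) {C : ℝ}
    (hC : ∀ n x, |r n x| ≤ C) (h0 : ∀ n x, r n x ≠ 0) {D : Submodule ℂ Fock}
    (hD : ∀ u v, (u, v) ∈ mulGraph r → v ∈ D) : Dense (D : Set Fock) := by
  rw [Submodule.dense_iff_topologicalClosure_eq_top, Submodule.topologicalClosure_eq_top_iff,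
    Submodule.eq_bot_iff]
  intro z hz
  obtain ⟨v, hv⟩ := exists_mulGraph_of_bounded hr hC z
  have hv0 : v = 0 := by
    obtain ⟨v', hv'⟩ := exists_mulGraph_of_bounded hr hC v
    have h1 := mulGraph_symm hv hv'
    rw [← inner_conj_symm, hz v' (hD _ _ hv'), map_zero] at h1
    exact inner_self_eq_zero.1 h1.symm
  apply wave_ext
  intro n
  apply Lp.ext
  filter_upwards [hv n, Lp.coeFn_zero ℂ 2 (confMeasure n)] with x h1 h2
  rw [hv0, wave_zero, h2, Pi.zero_apply, eq_comm] at h1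
  rw [wave_zero, h2]
  simpa [h0 n x] using h1

theorem mem_creation_domain {f : Photon → ℂ} {u v : Fock} (h : (u, v) ∈ creationGraph f) :
    u ∈ (creation f).domain := by
  rw [← creation_graph] at h
  exact LinearPMap.mem_domain_of_mem_graph h

/-- The range of `(1 + ω)⁻¹` is dense and lies in the domain. -/
theorem dense_creation {f : Photon → ℂ} (hf : AEStronglyMeasurable f photonMeasure)
    (hfin : photonNormSq f ≠ ⊤) : Dense ((creation f).domain : Set Fock) := by
  have hr : SymWeight fun n x => (1 + omega n x)⁻¹ :=
    symWeight_comp symWeight_omega (φ := fun t => (1 + t)⁻¹) (by fun_prop)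
  have hp : ∀ n x, 0 < 1 + omega n x := fun n x => by linarith [omega_nonneg n x]
  refine dense_of_mulGraph hr (C := 1) (fun n x => ?_) (fun n x => (inv_pos.2 (hp n x)).ne') ?_
  · rw [abs_inv, abs_of_pos (hp n x)]
    exact inv_le_one_of_one_le₀ (by linarith [omega_nonneg n x])
  · intro u v huv
    have : wsq (fun n x => 1 + omega n x) v ≠ ⊤ := by
      rw [wsq_of_mulGraph huv]
      refine ne_top_of_le_ne_top (wsq_one_ne_top u) (wsq_mono (fun n x => ?_) u)
      have := hp n x
      rw [inv_pow, sq, mul_inv, ← mul_assoc, mul_inv_cancel₀ this.ne', one_mul]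
      exact inv_le_one_of_one_le₀ (by linarith [omega_nonneg n x])
    obtain ⟨w, hw⟩ := exists_creation hf hfin this
    exact mem_creation_domain hw

theorem mem_annihilation_graph {f : Photon → ℂ} (hf : AEStronglyMeasurable f photonMeasure)
    (hfin : photonNormSq f ≠ ⊤) {u d : Fock} :
    (u, d) ∈ (annihilation f).graph ↔
      ∀ w w', (w, w') ∈ creationGraph f → ⟪d, w⟫_ℂ = ⟪u, w'⟫_ℂ := by
  have hd := dense_creation hf hfin
  constructor
  · intro h w w' hw
    obtain ⟨⟨y, hy⟩, rfl, rfl⟩ := LinearPMap.mem_graph_iff _ |>.1 h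
    rw [← creation_graph] at hw
    obtain ⟨⟨z, hz⟩, rfl, rfl⟩ := LinearPMap.mem_graph_iff _ |>.1 hw
    exact LinearPMap.adjoint_isFormalAdjoint hd ⟨y, hy⟩ ⟨z, hz⟩
  · intro h
    have h1 : ∀ x : (creation f).domain, ⟪d, x⟫_ℂ = ⟪u, creation f x⟫_ℂ := fun x => by
      refine h _ _ ?_
      rw [← creation_graph]
      exact LinearPMap.mem_graph _ x
    have hu : u ∈ (annihilation f).domain := LinearPMap.mem_adjoint_domain_of_exists u ⟨d, h1⟩
    rw [LinearPMap.mem_graph_iff]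
    exact ⟨⟨u, hu⟩, rfl, LinearPMap.adjoint_apply_eq hd _ h1⟩

/-- The functional `w ↦ ⟨u, a*(f) w⟩` is bounded by the dual estimate, so `u` is in the domain of
the adjoint. -/
theorem exists_annihilation {f : Photon → ℂ} (hf : AEStronglyMeasurable f photonMeasure)
    (hfin : photonNormSq f ≠ ⊤) {u : Fock} (hu : wsq omega u ≠ ⊤) :
    ∃ d, (u, d) ∈ (annihilation f).graph := by
  set A := (wsq omega u).toReal
  set B := (photonNormSq f).toReal
  suffices hu' : u ∈ (annihilation f).domain from ⟨_, LinearPMap.mem_graph _ ⟨u, hu'⟩⟩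
  refine (LinearPMap.mem_adjoint_domain_iff _ u).2 ?_
  refine AddMonoidHomClass.continuous_of_bound _ ((A + B) / 2) fun w => ?_
  by_cases hw : (w : Fock) = 0
  · have : w = 0 := Subtype.ext hw
    simp [this]
  have hw' : ((w : Fock), creation f w) ∈ creationGraph f := by
    rw [← creation_graph]; exact LinearPMap.mem_graph _ w
  have hpos : 0 < ‖(w : Fock)‖ := norm_pos_iff.2 hw
  -- Taking `s = ‖w‖` makes both terms of the bound linear in `‖w‖`.
  have h := enorm_inner_creation_le hf (u := u) hw' (m := fun _ _ => 1) (c := 1) zero_le_one hpos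
    (fun n => measurable_const) (fun _ _ => zero_lt_one) (fun n x i _ => by simp)
  simp only [one_mul, inv_one, mul_one] at h
  rw [wsq_one, mul_assoc, ← ENNReal.ofReal_toReal (show wsq (fun n x => omega n x) u ≠ ⊤ from hu),
    ← ENNReal.ofReal_toReal hfin, ← ENNReal.ofReal_mul (by positivity),
    ← ENNReal.ofReal_mul (by positivity), ← ENNReal.ofReal_mul (by positivity),
    ← ENNReal.ofReal_add (by positivity) (by positivity), ← ofReal_norm,
    two_mul_ofReal, ENNReal.ofReal_le_ofReal_iff (by positivity)] at h
  have h2 : ‖(w : Fock)‖⁻¹ * (B * ‖(w : Fock)‖ ^ 2) = B * ‖(w : Fock)‖ := by field_simp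
  change 2 * _ ≤ ‖(w : Fock)‖ * A + ‖(w : Fock)‖⁻¹ * (B * ‖(w : Fock)‖ ^ 2) at h
  rw [h2] at h
  change ‖⟪u, creation f w⟫_ℂ‖ ≤ (A + B) / 2 * ‖(w : Fock)‖
  linarith

/-- Monotone convergence on each finite set of sectors. -/
theorem wsq_le_of_truncation {m b : ∀ n, Conf n → ℝ} (hmeas : ∀ n, Measurable (m n))
    (hb : ∀ n, Measurable (b n)) (hm : ∀ n x, 0 ≤ m n x) {d : Fock} {C : ENNReal}
    (h : ∀ N : ℕ, wsq (fun n x => if b n x ≤ N then m n x else 0) d ≤ C) : wsq m d ≤ C := by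
  rw [wsq, ENNReal.tsum_eq_iSup_sum]
  refine iSup_le fun s => ?_
  have hlim : Filter.Tendsto (fun N : ℕ => ∑ n ∈ s, ∫⁻ x, ENNReal.ofReal
      ((if b n x ≤ N then m n x else 0) * ‖wave d n x‖ ^ 2) ∂confMeasure n) Filter.atTop
      (nhds (∑ n ∈ s, ∫⁻ x, ENNReal.ofReal (m n x * ‖wave d n x‖ ^ 2) ∂confMeasure n)) := by
    refine tendsto_finsetSum _ fun n _ => ?_
    refine lintegral_tendsto_of_tendsto_of_monotone (fun N => ?_) ?_ ?_
    · exact ((Measurable.ite (measurableSet_le (hb n) measurable_const) (hmeas n)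
        measurable_const).aemeasurable.mul
        ((aemeasurable_wave d n).norm.aemeasurable.pow_const 2)).ennreal_ofReal
    · refine Filter.Eventually.of_forall fun x => ?_
      intro N N' hN
      refine ENNReal.ofReal_le_ofReal (mul_le_mul_of_nonneg_right ?_ (sq_nonneg _))
      have hN' : (N : ℝ) ≤ N' := by exact_mod_cast hN
      have := hm n x
      split_ifs <;> linarith
    · refine Filter.Eventually.of_forall fun x => ?_
      refine tendsto_const_nhds.congr' ?_
      filter_upwards [Filter.eventually_ge_atTop ⌈b n x⌉₊] with N hN
      rw [if_pos ((Nat.le_ceil _).trans (by exact_mod_cast hN))]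
  exact le_of_tendsto' hlim fun N => (ENNReal.sum_le_tsum s).trans (h N)

/-- Pair `d = a(f) u` with `χ d`, where `χ` is a truncation of `m`: `⟨d, χ d⟩ = ⟨u, a*(f) χ d⟩`, and
the dual estimate bounds twice this by the desired right side plus `⟨d, χ d⟩` itself, which is
absorbed. -/
theorem wsq_annihilation_le {f : Photon → ℂ} (hf : AEStronglyMeasurable f photonMeasure)
    {F : ℝ} (hF : 0 < F) (hfF : photonNormSq f ≤ ENNReal.ofReal F)
    {u d : Fock} (h : (u, d) ∈ (annihilation f).graph) {m : ∀ n, Conf n → ℝ} {c : ℝ} (hc : 0 ≤ c)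
    (hm : SymWeight m) (hpos : ∀ n x, 0 < m n x) (hmm : RemoveStable f c m) :
    wsq m d ≤ ENNReal.ofReal (c * F) * wsq (fun n x => m n x * omega n x) u := by
  have hfin : photonNormSq f ≠ ⊤ := ne_top_of_le_ne_top ENNReal.ofReal_ne_top hfF
  have hb : SymWeight fun n x => m n x + omega n x :=
    ⟨fun n => (hm.1 n).add (symWeight_omega.1 n), fun n p x => by
      simp only [hm.2, symWeight_omega.2]⟩
  refine wsq_le_of_truncation hm.1 hb.1 (fun n x => (hpos n x).le) fun N => ?_
  -- Cutting off `m + ω` puts `χ d` in the domain of `a*(f)` and makes the quantity to be absorbed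
  -- finite.
  set χ : ∀ n, Conf n → ℝ := fun n x => if m n x + omega n x ≤ N then m n x else 0
  have hχ : SymWeight χ := by
    refine ⟨fun n => Measurable.ite (measurableSet_le (hb.1 n) measurable_const) (hm.1 n)
      measurable_const, fun n p x => ?_⟩
    simp only [χ, hm.2, symWeight_omega.2]
  have hχ0 : ∀ n x, 0 ≤ χ n x := fun n x => by
    have := (hpos n x).le
    simp only [χ]; split_ifs <;> simp [this]
  have hχN : ∀ n x, χ n x ≤ N := fun n x => by
    have h1 := omega_nonneg n x
    simp only [χ]; split_ifs with h2
    · linarith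
    · positivity
  obtain ⟨w, hw⟩ := exists_mulGraph_of_bounded hχ (C := N)
    (fun n x => by rw [abs_of_nonneg (hχ0 n x)]; exact hχN n x) d
  have hw1 : wsq (fun n x => 1 + omega n x) w ≠ ⊤ := by
    rw [wsq_of_mulGraph hw]
    refine ne_top_of_le_ne_top ?_ (wsq_mono (m' := fun n x => (1 + N) * N ^ 2 * 1)
      (fun n x => ?_) d)
    · rw [wsq_const_mul (by positivity)]
      exact ENNReal.mul_ne_top ENNReal.ofReal_ne_top (wsq_one_ne_top _)
    · rw [mul_one]
      by_cases h2 : m n x + omega n x ≤ N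
      · have h3 := hpos n x
        have h4 := hχ0 n x
        have h5 := hχN n x
        have h6 := omega_nonneg n x
        have h7 : omega n x ≤ N := by linarith
        gcongr
      · simp only [χ, if_neg h2]
        rw [zero_pow two_ne_zero, mul_zero]
        positivity
  obtain ⟨w', hw'⟩ := exists_creation hf hfin hw1
  have hS : wsq χ d ≠ ⊤ := by
    refine ne_top_of_le_ne_top ?_ (wsq_mono (m' := fun n x => N * 1) (fun n x => ?_) d)
    · rw [wsq_const_mul (by positivity)]
      exact ENNReal.mul_ne_top ENNReal.ofReal_ne_top (wsq_one_ne_top _)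
    · rw [mul_one]; exact hχN n x
  have hSw : wsq (fun n x => (m n x)⁻¹) w = wsq χ d := by
    rw [wsq_of_mulGraph hw]
    congr 1
    funext n x
    have := (hpos n x).ne'
    simp only [χ]; split_ifs
    · field_simp
    · simp
  have h1 : wsq χ d ≤ ‖⟪u, w'⟫_ℂ‖ₑ := by
    rw [← inner_mulGraph hχ0 hw, (mem_annihilation_graph hf hfin).1 h w w' hw',
      ← ofReal_norm]
    exact ENNReal.ofReal_le_ofReal (Complex.re_le_norm _)
  -- With `s = F` the coefficient of the absorbed term is at most one.
  have h2 := enorm_inner_creation_le hf (u := u) hw' hc hF hm.1 hpos hmm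
  rw [hSw] at h2
  have h3 : ENNReal.ofReal F⁻¹ * photonNormSq f ≤ 1 := by
    refine (mul_le_mul_right hfF _).trans ?_
    rw [← ENNReal.ofReal_mul (by positivity), inv_mul_cancel₀ hF.ne', ENNReal.ofReal_one]
  have h4 : 2 * wsq χ d ≤ ENNReal.ofReal (c * F) * wsq (fun n x => m n x * omega n x) u +
      wsq χ d := by
    refine (mul_le_mul_right h1 2).trans (h2.trans ?_)
    rw [mul_comm c F]
    exact add_le_add le_rfl ((mul_le_mul_left h3 _).trans_eq (one_mul _))
  rw [two_mul] at h4
  exact (ENNReal.add_le_add_iff_right hS).1 h4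

/-! ### Graphs of sums of unbounded operators -/

section Graph

variable {E : Type*} [AddCommGroup E] [Module ℂ E]

theorem mem_add_graph {S T : E →ₗ.[ℂ] E} {u z : E} :
    (u, z) ∈ (S + T).graph ↔ ∃ a b, (u, a) ∈ S.graph ∧ (u, b) ∈ T.graph ∧ z = a + b := by
  simp only [LinearPMap.mem_graph_iff]
  constructor
  · rintro ⟨⟨x, hx⟩, rfl, rfl⟩
    exact ⟨_, _, ⟨⟨x, hx.1⟩, rfl, rfl⟩, ⟨⟨x, hx.2⟩, rfl, rfl⟩, rfl⟩
  · rintro ⟨a, b, ⟨x, rfl, rfl⟩, ⟨y, hy, rfl⟩, rfl⟩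
    obtain ⟨x, hx⟩ := x
    obtain ⟨y, hy'⟩ := y
    obtain rfl : y = x := hy
    exact ⟨⟨y, hx, hy'⟩, rfl, rfl⟩

theorem mem_sub_graph {S T : E →ₗ.[ℂ] E} {u z : E} :
    (u, z) ∈ (S - T).graph ↔ ∃ a b, (u, a) ∈ S.graph ∧ (u, b) ∈ T.graph ∧ z = a - b := by
  simp only [LinearPMap.mem_graph_iff]
  constructor
  · rintro ⟨⟨x, hx⟩, rfl, rfl⟩
    exact ⟨_, _, ⟨⟨x, hx.1⟩, rfl, rfl⟩, ⟨⟨x, hx.2⟩, rfl, rfl⟩, rfl⟩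
  · rintro ⟨a, b, ⟨x, rfl, rfl⟩, ⟨y, hy, rfl⟩, rfl⟩
    obtain ⟨x, hx⟩ := x
    obtain ⟨y, hy'⟩ := y
    obtain rfl : y = x := hy
    exact ⟨⟨y, hx, hy'⟩, rfl, rfl⟩

theorem mem_smul_graph {T : E →ₗ.[ℂ] E} {c : ℂ} {u z : E} :
    (u, z) ∈ (c • T).graph ↔ ∃ a, (u, a) ∈ T.graph ∧ z = c • a := by
  simp only [LinearPMap.mem_graph_iff]
  constructor
  · rintro ⟨⟨x, hx⟩, rfl, rfl⟩
    exact ⟨_, ⟨⟨x, hx⟩, rfl, rfl⟩, rfl⟩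
  · rintro ⟨a, ⟨⟨x, hx⟩, rfl, rfl⟩, rfl⟩
    exact ⟨⟨x, hx⟩, rfl, rfl⟩

theorem mem_toPMap_top_graph {f : E →ₗ[ℂ] E} {u z : E} :
    (u, z) ∈ (f.toPMap ⊤).graph ↔ z = f u := by
  simp only [LinearPMap.mem_graph_iff]
  constructor
  · rintro ⟨⟨x, hx⟩, rfl, rfl⟩
    rfl
  · rintro rfl
    exact ⟨⟨u, trivial⟩, rfl, rfl⟩

end Graph

/-! ### Field operators -/

/-- `f` is measurable and `∫ |f|² (1 + 1 / |k|) ≤ F`. -/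
structure PhotonBound (f : Photon → ℂ) (F : ℝ) : Prop where
  meas : AEStronglyMeasurable f photonMeasure
  pos : 0 < F
  le : photonNormSq f ≤ ENNReal.ofReal F

theorem PhotonBound.ne_top {f : Photon → ℂ} {F : ℝ} (h : PhotonBound f F) : photonNormSq f ≠ ⊤ :=
  ne_top_of_le_ne_top ENNReal.ofReal_ne_top h.le

theorem mem_fieldOp_graph {f : Photon → ℂ} {u a : Fock} :
    (u, a) ∈ (fieldOp f).graph ↔ ∃ c d, (u, c) ∈ creationGraph f ∧
      (u, d) ∈ (annihilation f).graph ∧ a = (((Real.sqrt 2)⁻¹ : ℝ) : ℂ) • (c + d) := by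
  rw [fieldOp, mem_smul_graph]
  constructor
  · rintro ⟨b, hb, rfl⟩
    obtain ⟨c, d, hc, hd, rfl⟩ := mem_add_graph.1 hb
    exact ⟨c, d, creation_graph f ▸ hc, hd, rfl⟩
  · rintro ⟨c, d, hc, hd, rfl⟩
    exact ⟨c + d, mem_add_graph.2 ⟨c, d, (creation_graph f).symm ▸ hc, hd, rfl⟩, rfl⟩

theorem wsq_omega_le (u : Fock) : wsq omega u ≤ wsq (fun n x => 1 + omega n x) u :=
  wsq_mono (fun _ _ => by linarith) u

theorem exists_fieldOp {f : Photon → ℂ} {F : ℝ} (hf : PhotonBound f F) {u : Fock}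
    (hu : wsq (fun n x => 1 + omega n x) u ≠ ⊤) : ∃ a, (u, a) ∈ (fieldOp f).graph := by
  obtain ⟨c, hc⟩ := exists_creation hf.meas hf.ne_top hu
  obtain ⟨d, hd⟩ := exists_annihilation hf.meas hf.ne_top (ne_top_of_le_ne_top hu (wsq_omega_le u))
  exact ⟨_, mem_fieldOp_graph.2 ⟨c, d, hc, hd, rfl⟩⟩

theorem norm_sq_inv_sqrt_two : ‖(((Real.sqrt 2)⁻¹ : ℝ) : ℂ)‖ ^ 2 = 2⁻¹ := by
  rw [Complex.norm_real, Real.norm_eq_abs, sq_abs, inv_pow, Real.sq_sqrt zero_le_two]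

theorem wsq_fieldOp_le {f : Photon → ℂ} {F : ℝ} (hf : PhotonBound f F) {u a : Fock}
    (h : (u, a) ∈ (fieldOp f).graph) {m : ∀ n, Conf n → ℝ} {c : ℝ} (hc : 0 ≤ c)
    (hm : SymWeight m) (hpos : ∀ n x, 0 < m n x) (hadd : AddStable f c m)
    (hrem : RemoveStable f c m) :
    wsq m a ≤ ENNReal.ofReal (2 * c * F) * wsq (fun n x => m n x * (1 + omega n x)) u := by
  obtain ⟨v, d, hv, hd, rfl⟩ := mem_fieldOp_graph.1 h
  have h1 := wsq_creation_le hf.meas hv hc hm.1 (fun n x => (hpos n x).le) hadd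
  have h2 := wsq_annihilation_le hf.meas hf.pos hf.le hd hc hm hpos hrem
  set X := wsq (fun n x => m n x * (1 + omega n x)) u
  have h3 : wsq m v ≤ ENNReal.ofReal (c * F) * X := by
    refine h1.trans (mul_le_mul_left ?_ _)
    rw [ENNReal.ofReal_mul hc]
    exact mul_le_mul_right hf.le _
  have h4 : wsq m d ≤ ENNReal.ofReal (c * F) * X :=
    h2.trans (mul_le_mul_right (wsq_mono (fun n x => mul_le_mul_of_nonneg_left (by linarith)
      (hpos n x).le) u) _)
  rw [wsq_smul, norm_sq_inv_sqrt_two]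
  have h5 := (wsq_add_le m hm.1 (fun n x => (hpos n x).le) v d).trans
    (add_le_add (mul_le_mul_right h3 2) (mul_le_mul_right h4 2))
  refine (mul_le_mul_right h5 _).trans (le_of_eq ?_)
  rw [← two_mul, ← mul_assoc, ← mul_assoc, ← mul_assoc]
  congr 1
  rw [← ENNReal.ofReal_ofNat 2, ← ENNReal.ofReal_mul (by norm_num),
    ← ENNReal.ofReal_mul (by norm_num), ← ENNReal.ofReal_mul (by norm_num)]
  congr 1
  ring

theorem fieldOp_symm {f : Photon → ℂ} {F : ℝ} (hf : PhotonBound f F) {u a u' a' : Fock}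
    (h : (u, a) ∈ (fieldOp f).graph) (h' : (u', a') ∈ (fieldOp f).graph) :
    ⟪u, a'⟫_ℂ = ⟪a, u'⟫_ℂ := by
  obtain ⟨c, d, hc, hd, rfl⟩ := mem_fieldOp_graph.1 h
  obtain ⟨c', d', hc', hd', rfl⟩ := mem_fieldOp_graph.1 h'
  have h1 := (mem_annihilation_graph hf.meas hf.ne_top).1 hd _ _ hc'
  have h2 := (mem_annihilation_graph hf.meas hf.ne_top).1 hd' _ _ hc
  have h3 := congrArg (starRingEnd ℂ) h2
  rw [inner_conj_symm, inner_conj_symm] at h3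
  rw [inner_smul_right, inner_smul_left, inner_add_right, inner_add_left, Complex.conj_ofReal,
    h1, h3, add_comm]

/-! ### The velocity operators and the Hamiltonian -/

/-- The total photon momentum. -/
def momentum (n : ℕ) (x : Conf n) : R3 := ∑ i, (x i).1

theorem momentum_apply (n : ℕ) (x : Conf n) (j : Fin 3) : momentum n x j = ∑ i, (x i).1 j := by
  unfold momentum
  simp

theorem measurable_momentum (n : ℕ) : Measurable (momentum n) :=
  Finset.measurable_sum _ fun i _ => (measurable_pi_apply i).fst

theorem momentum_perm (n : ℕ) (p : Equiv.Perm (Fin n)) (x : Conf n) :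
    momentum n (fun i => x (p i)) = momentum n x := Equiv.sum_comp p fun i => (x i).1

theorem symWeight_of_momentum {φ : R3 → ℝ} (hφ : Measurable φ) :
    SymWeight fun n x => φ (momentum n x) :=
  ⟨fun n => hφ.comp (measurable_momentum n), fun n p x => congrArg φ (momentum_perm n p x)⟩

theorem momentum_removeNth {n : ℕ} (x : Conf (n + 1)) (i : Fin (n + 1)) :
    momentum (n + 1) x = (x i).1 + momentum n (i.removeNth x) := by
  unfold momentum
  rw [Fin.sum_univ_succAbove _ i]
  rfl

theorem norm_momentum_le (n : ℕ) (x : Conf n) : ‖momentum n x‖ ≤ omega n x := norm_sum_le _ _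

theorem mem_fieldMomentum_graph {j : Fin 3} {u p : Fock} :
    (u, p) ∈ (fieldMomentum j).graph ↔ (u, p) ∈ mulGraph fun n x => momentum n x j := by
  rw [fieldMomentum, mulOp_graph]
  simp only [momentum_apply]

theorem mem_fieldEnergy_graph {u e : Fock} :
    (u, e) ∈ fieldEnergy.graph ↔ (u, e) ∈ mulGraph omega := by
  rw [fieldEnergy, mulOp_graph]
  rfl

section Hamiltonian

variable {kap : R3 → ℝ} {eps : Fin 2 → R3 → R3} {alpha : ℝ} {P : R3}

theorem mem_velocity_graph {j : Fin 3} {u v : Fock} :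
    (u, v) ∈ (velocity kap eps alpha P j).graph ↔
      ∃ p a, (u, p) ∈ mulGraph (fun n x => P j - momentum n x j) ∧
        (u, a) ∈ (fieldOp (coupling kap eps j)).graph ∧ v = p - (Real.sqrt alpha : ℂ) • a := by
  have h1 : (u, u) ∈ mulGraph fun _ _ => 1 := fun n =>
    Filter.Eventually.of_forall fun x => by simp
  rw [velocity, mem_sub_graph]
  constructor
  · rintro ⟨b, c, hb, hc, rfl⟩
    obtain ⟨d, p, hd, hp, rfl⟩ := mem_sub_graph.1 hb
    obtain ⟨a, ha, rfl⟩ := mem_smul_graph.1 hc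
    rw [mem_toPMap_top_graph.1 hd]
    refine ⟨_, a, ?_, ha, rfl⟩
    have h2 := mulGraph_add_weight (mulGraph_smul_weight h1 (P j))
      (mulGraph_smul_weight (mem_fieldMomentum_graph.1 hp) (-1))
    convert h2 using 2
    · funext n x; ring
    · rw [Complex.ofReal_neg, Complex.ofReal_one, neg_one_smul, ← sub_eq_add_neg]; rfl
  · rintro ⟨p, a, hp, ha, rfl⟩
    refine ⟨p, _, mem_sub_graph.2 ⟨(P j : ℂ) • u, (P j : ℂ) • u - p, mem_toPMap_top_graph.2 rfl,
      mem_fieldMomentum_graph.2 ?_, by simp⟩, mem_smul_graph.2 ⟨a, ha, rfl⟩, rfl⟩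
    have h2 := mulGraph_add_weight (mulGraph_smul_weight h1 (P j)) (mulGraph_smul_weight hp (-1))
    convert h2 using 2
    · funext n x; ring
    · simp [sub_eq_add_neg]

/-- Unfolds the nested natural domains into explicit intermediate vectors `v j` and `w j`;
afterwards only graphs are handled. -/
theorem mem_hamiltonian_graph {u z : Fock} :
    (u, z) ∈ (hamiltonian kap eps alpha P).graph ↔
      ∃ (v w : Fin 3 → Fock) (e : Fock), (∀ j, (u, v j) ∈ (velocity kap eps alpha P j).graph) ∧
        (∀ j, (v j, w j) ∈ (velocity kap eps alpha P j).graph) ∧ (u, e) ∈ mulGraph omega ∧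
        z = (1 / 2 : ℂ) • ∑ j, w j + e := by
  rw [hamiltonian, mem_add_graph]
  constructor
  · rintro ⟨b, e, hb, he, rfl⟩
    obtain ⟨s, hs, rfl⟩ := mem_smul_graph.1 hb
    rw [Fin.sum_univ_three] at hs
    obtain ⟨s', w2, hs', h2, rfl⟩ := mem_add_graph.1 hs
    obtain ⟨w0, w1, h0, h1, rfl⟩ := mem_add_graph.1 hs'
    obtain ⟨v0, hv0, hw0⟩ := (mem_compOp_graph _ _ _ _).1 h0
    obtain ⟨v1, hv1, hw1⟩ := (mem_compOp_graph _ _ _ _).1 h1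
    obtain ⟨v2, hv2, hw2⟩ := (mem_compOp_graph _ _ _ _).1 h2
    refine ⟨![v0, v1, v2], ![w0, w1, w2], e, ?_, ?_, mem_fieldEnergy_graph.1 he, ?_⟩
    · intro j; fin_cases j <;> assumption
    · intro j; fin_cases j <;> assumption
    · simp [Fin.sum_univ_three]
  · rintro ⟨v, w, e, hv, hw, he, rfl⟩
    refine ⟨_, e, mem_smul_graph.2 ⟨_, ?_, rfl⟩, mem_fieldEnergy_graph.2 he, rfl⟩
    rw [Fin.sum_univ_three, Fin.sum_univ_three]
    have h : ∀ j, (u, w j) ∈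
        (compOp (velocity kap eps alpha P j) (velocity kap eps alpha P j)).graph := fun j =>
      (mem_compOp_graph _ _ _ _).2 ⟨v j, hv j, hw j⟩
    exact mem_add_graph.2 ⟨_, _, mem_add_graph.2 ⟨_, _, h 0, h 1, rfl⟩, h 2, rfl⟩

theorem velocity_symm {F : ℝ} {j : Fin 3} (hf : PhotonBound (coupling kap eps j) F)
    {u v u' v' : Fock} (h : (u, v) ∈ (velocity kap eps alpha P j).graph)
    (h' : (u', v') ∈ (velocity kap eps alpha P j).graph) : ⟪u, v'⟫_ℂ = ⟪v, u'⟫_ℂ := by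
  obtain ⟨p, a, hp, ha, rfl⟩ := mem_velocity_graph.1 h
  obtain ⟨p', a', hp', ha', rfl⟩ := mem_velocity_graph.1 h'
  rw [inner_sub_right, inner_sub_left, inner_smul_right, inner_smul_left, mulGraph_symm hp hp',
    fieldOp_symm hf ha ha', Complex.conj_ofReal]

/-- The Hamiltonian as a quadratic form. -/
theorem inner_hamiltonian {F : ℝ} (hf : ∀ j, PhotonBound (coupling kap eps j) F)
    {u z : Fock} {v v' w' : Fin 3 → Fock} {e' : Fock}
    (hv : ∀ j, (u, v j) ∈ (velocity kap eps alpha P j).graph)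
    (hw' : ∀ j, (v' j, w' j) ∈ (velocity kap eps alpha P j).graph) (hz : z = (1 / 2 : ℂ) • ∑ j, w' j + e') :
    ⟪u, z⟫_ℂ = (1 / 2 : ℂ) * ∑ j, ⟪v j, v' j⟫_ℂ + ⟪u, e'⟫_ℂ := by
  rw [hz, inner_add_right, inner_smul_right, inner_sum]
  congr 2
  exact Finset.sum_congr rfl fun j _ => velocity_symm (hf j) (hv j) (hw' j)

theorem hamiltonian_symm {F : ℝ} (hf : ∀ j, PhotonBound (coupling kap eps j) F)
    {u z u' z' : Fock} (h : (u, z) ∈ (hamiltonian kap eps alpha P).graph)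
    (h' : (u', z') ∈ (hamiltonian kap eps alpha P).graph) : ⟪u, z'⟫_ℂ = ⟪z, u'⟫_ℂ := by
  obtain ⟨v, w, e, hv, hw, he, hz⟩ := mem_hamiltonian_graph.1 h
  obtain ⟨v', w', e', hv', hw', he', hz'⟩ := mem_hamiltonian_graph.1 h'
  have h1 := inner_hamiltonian hf hv hw' hz'
  have h2 := inner_hamiltonian hf hv' hw hz
  rw [h1, ← inner_conj_symm z u', h2, map_add, map_mul, map_sum, inner_conj_symm,
    mulGraph_symm he he']
  simp only [inner_conj_symm]
  congr 2
  simp [map_ofNat]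

end Hamiltonian

/-! ### Self-adjointness -/

section Pair

variable {E : Type*} [AddCommGroup E] [Module ℂ E] (p : Submodule ℂ (E × E))

theorem pair_add_mem {a b c d : E} (h : (a, b) ∈ p) (h' : (c, d) ∈ p) : (a + c, b + d) ∈ p :=
  p.add_mem h h'

theorem pair_sub_mem {a b c d : E} (h : (a, b) ∈ p) (h' : (c, d) ∈ p) : (a - c, b - d) ∈ p :=
  p.sub_mem h h'

theorem pair_smul_mem {a b : E} (c : ℂ) (h : (a, b) ∈ p) : (c • a, c • b) ∈ p :=
  p.smul_mem c h

/-- A relation that is linear, single-valued and everywhere defined. -/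
theorem exists_linearMap_of_graph (huniq : ∀ a b c, (a, b) ∈ p → (a, c) ∈ p → b = c)
    (htot : ∀ a, ∃ b, (a, b) ∈ p) : ∃ R : E →ₗ[ℂ] E, ∀ a, (a, R a) ∈ p := by
  choose R hR using htot
  exact ⟨{ toFun := R
           map_add' := fun x y => huniq _ _ _ (hR (x + y)) (pair_add_mem p (hR x) (hR y))
           map_smul' := fun c x => huniq _ _ _ (hR (c • x)) (pair_smul_mem p c (hR x)) }, hR⟩

end Pair

theorem exists_CLM_of_graph {E : Type*} [NormedAddCommGroup E] [NormedSpace ℂ E]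
    (p : Submodule ℂ (E × E)) (huniq : ∀ a b c, (a, b) ∈ p → (a, c) ∈ p → b = c)
    (htot : ∀ a, ∃ b, (a, b) ∈ p) {C : ℝ} (hC : ∀ a b, (a, b) ∈ p → ‖b‖ ≤ C * ‖a‖) :
    ∃ R : E →L[ℂ] E, ∀ a, (a, R a) ∈ p := by
  obtain ⟨R, hR⟩ := exists_linearMap_of_graph p huniq htot
  exact ⟨R.mkContinuous C fun a => hC _ _ (hR a), hR⟩

/-- A symmetric operator `A` for which `A + 1` is surjective is self-adjoint. -/
theorem isSelfAdjoint_of_surjective {E : Type*} [NormedAddCommGroup E] [InnerProductSpace ℂ E]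
    [CompleteSpace E] {A : E →ₗ.[ℂ] E}
    (hsymm : ∀ u z u' z', (u, z) ∈ A.graph → (u', z') ∈ A.graph → ⟪u, z'⟫_ℂ = ⟪z, u'⟫_ℂ)
    (hsurj : ∀ w, ∃ u z, (u, z) ∈ A.graph ∧ z + u = w) : IsSelfAdjoint A := by
  have hdense : Dense (A.domain : Set E) := by
    rw [Submodule.dense_iff_topologicalClosure_eq_top, Submodule.topologicalClosure_eq_top_iff,
      Submodule.eq_bot_iff]
    intro w hw
    -- A vector orthogonal to the domain has the form `(A + 1) u`; by symmetry `u` is orthogonal to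
    -- the range of `A + 1`, which is everything.
    obtain ⟨u, z, huz, rfl⟩ := hsurj w
    have hu : u = 0 := by
      obtain ⟨u', z', h', hw'⟩ := hsurj u
      have h1 : ⟪u', z + u⟫_ℂ = 0 := hw u' (LinearPMap.mem_domain_of_mem_graph h')
      rw [inner_add_right, hsymm _ _ _ _ h' huz, ← inner_add_left, hw'] at h1
      exact inner_self_eq_zero.1 h1
    subst hu
    have hz : z = 0 := A.graph_fst_eq_zero_snd huz rfl
    rw [hz, zero_add]
  rw [LinearPMap.isSelfAdjoint_def]
  refine le_antisymm ?_ (LinearPMap.IsFormalAdjoint.le_adjoint hdense ?_)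
  · rw [← LinearPMap.le_graph_iff]
    rintro ⟨u, z⟩ h
    have hadj : ∀ u' z', (u', z') ∈ A.graph → ⟪z, u'⟫_ℂ = ⟪u, z'⟫_ℂ := by
      intro u' z' h'
      obtain ⟨⟨y, hy⟩, rfl, rfl⟩ := (LinearPMap.mem_graph_iff _).1 h
      obtain ⟨⟨x, hx⟩, rfl, rfl⟩ := (LinearPMap.mem_graph_iff _).1 h'
      exact LinearPMap.adjoint_isFormalAdjoint hdense ⟨y, hy⟩ ⟨x, hx⟩
    -- An element `u` of the adjoint domain is compared with the solution `u1` in `D(A)` of the same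
    -- equation; the difference is orthogonal to the range of `A + 1`.
    obtain ⟨u1, z1, h1, hw⟩ := hsurj (z + u)
    have hu : u - u1 = 0 := by
      obtain ⟨u', z', h', hw'⟩ := hsurj (u - u1)
      have h2 : ⟪u - u1, z' + u'⟫_ℂ = 0 := by
        rw [inner_add_right, inner_sub_left, inner_sub_left, ← hadj _ _ h',
          hsymm _ _ _ _ h1 h']
        have : ⟪z + u, u'⟫_ℂ = ⟪z1 + u1, u'⟫_ℂ := by rw [hw]
        rw [inner_add_left, inner_add_left] at this
        linear_combination this
      rw [hw'] at h2
      exact inner_self_eq_zero.1 h2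
    have hu' : u = u1 := sub_eq_zero.1 hu
    subst hu'
    have : z1 = z := add_right_cancel hw
    rwa [this] at h1
  · intro x y
    exact (hsymm _ _ _ _ (A.mem_graph x) (A.mem_graph y)).symm

/-- Solvability of `y - S y = w` for a contraction `S`. -/
theorem exists_sub_eq_of_contraction {E : Type*} [NormedAddCommGroup E] [NormedSpace ℂ E]
    [CompleteSpace E] {S : E →ₗ[ℂ] E} (hS : ∀ y, ‖S y‖ ≤ 1 / 2 * ‖y‖) (w : E) :
    ∃ y, y - S y = w := by
  let S' : E →L[ℂ] E := S.mkContinuous (1 / 2) hS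
  have hS' : ‖S'‖ < 1 := (S.mkContinuous_norm_le (by norm_num) hS).trans_lt (by norm_num)
  obtain ⟨U, hU⟩ := isUnit_one_sub_of_norm_lt_one hS'
  refine ⟨(↑U⁻¹ : E →L[ℂ] E) w, ?_⟩
  change (1 - S') ((↑U⁻¹ : E →L[ℂ] E) w) = w
  rw [← hU]
  change ((U : E →L[ℂ] E) * (↑U⁻¹ : E →L[ℂ] E)) w = w
  rw [Units.mul_inv]; rfl

theorem norm_le_of_mulGraph {r : ∀ n, Conf n → ℝ} (h1 : ∀ n x, |r n x| ≤ 1) {y v : Fock}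
    (h : (y, v) ∈ mulGraph r) : ‖v‖ ≤ ‖y‖ := by
  refine (sq_le_sq₀ (norm_nonneg _) (norm_nonneg _)).1 (norm_sq_le_of_wsq_le (sq_nonneg _) ?_)
  rw [wsq_of_mulGraph h, ← wsq_one]
  refine wsq_mono (fun n x => ?_) y
  rw [one_mul, ← sq_abs]
  exact pow_le_one₀ (abs_nonneg _) (h1 n x)

/-- The bounded operator of multiplication by a bounded function. -/
theorem exists_mulCLM {r : ∀ n, Conf n → ℝ} (hr : SymWeight r) (h1 : ∀ n x, |r n x| ≤ 1) :
    ∃ R : Fock →L[ℂ] Fock, ∀ y, (y, R y) ∈ mulGraph r := by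
  exact exists_CLM_of_graph _ (fun _ _ _ => mulGraph_unique) (exists_mulGraph_of_bounded hr h1)
    (C := 1) fun a b h => (norm_le_of_mulGraph h1 h).trans_eq (one_mul _).symm

/-! ### The free Hamiltonian as a gauge for relative bounds -/

/-- The function `1 + |P - k|² / 2 + |k|` of the free Hamiltonian. -/
def freeWeight (P : R3) (n : ℕ) (x : Conf n) : ℝ :=
  1 + omega n x + ‖P - momentum n x‖ ^ 2 / 2

theorem symWeight_freeWeight (P : R3) : SymWeight (freeWeight P) := by
  refine ⟨fun n => ?_, fun n p x => ?_⟩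
  · exact ((symWeight_omega.1 n).const_add 1).add
      (((measurable_momentum n).const_sub P).norm.pow_const 2 |>.div_const 2)
  · simp only [freeWeight, symWeight_omega.2, momentum_perm]

theorem one_add_omega_le_freeWeight (P : R3) (n : ℕ) (x : Conf n) :
    1 + omega n x ≤ freeWeight P n x := by
  unfold freeWeight
  have : 0 ≤ ‖P - momentum n x‖ ^ 2 / 2 := by positivity
  linarith

theorem one_le_freeWeight (P : R3) (n : ℕ) (x : Conf n) : 1 ≤ freeWeight P n x :=
  (by linarith [omega_nonneg n x] : 1 ≤ 1 + omega n x).trans (one_add_omega_le_freeWeight P n x)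

theorem sq_component_le (P : R3) (n : ℕ) (x : Conf n) (j : Fin 3) :
    (P j - momentum n x j) ^ 2 ≤ 2 * freeWeight P n x := by
  have h : ‖(P - momentum n x) j‖ ≤ ‖P - momentum n x‖ := PiLp.norm_apply_le _ j
  rw [PiLp.sub_apply, Real.norm_eq_abs] at h
  have h2 : (P j - momentum n x j) ^ 2 ≤ ‖P - momentum n x‖ ^ 2 := by
    rw [← sq_abs]; exact pow_le_pow_left₀ (abs_nonneg _) h 2
  unfold freeWeight
  linarith [omega_nonneg n x]

theorem one_add_sq_momentum_le {P : R3} (hP : ‖P‖ ≤ 1 / 40) (n : ℕ) (x : Conf n) :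
    1 + ‖momentum n x‖ ^ 2 ≤ 5 * freeWeight P n x := by
  have h : ‖momentum n x‖ ≤ ‖P‖ + ‖P - momentum n x‖ := by
    have := norm_sub_norm_le (momentum n x) P
    rw [norm_sub_rev] at this
    linarith
  unfold freeWeight
  have h1 := omega_nonneg n x
  have h2 : ‖momentum n x‖ ^ 2 ≤ (1 / 40 + ‖P - momentum n x‖) ^ 2 :=
    pow_le_pow_left₀ (norm_nonneg _) (by linarith) 2
  nlinarith [sq_nonneg (1 / 40 - ‖P - momentum n x‖)]

theorem wsq_le_of_freeWeight {P : R3} {u y : Fock} (h : (u, y) ∈ mulGraph (freeWeight P))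
    {m : ∀ n, Conf n → ℝ} {C : ℝ} (hC : 0 ≤ C) (hm : ∀ n x, m n x ≤ C * freeWeight P n x ^ 2) :
    wsq m u ≤ ENNReal.ofReal (C * ‖y‖ ^ 2) := by
  refine (wsq_mono hm u).trans ?_
  rw [wsq_const_mul hC, ENNReal.ofReal_mul hC, ← wsq_one, wsq_of_mulGraph h]
  simp

theorem norm_le_of_wsq_le {v y : Fock} {C : ℝ} (hC : 0 ≤ C)
    (h : wsq (fun _ _ => 1) v ≤ ENNReal.ofReal (C * ‖y‖ ^ 2)) : ‖v‖ ≤ Real.sqrt C * ‖y‖ := by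
  have := norm_sq_le_of_wsq_le (by positivity) h
  rw [← Real.sqrt_sq (norm_nonneg y), ← Real.sqrt_mul hC]
  exact Real.le_sqrt_of_sq_le this

theorem wsq_one_of_mulGraph {r : ∀ n, Conf n → ℝ} {u v : Fock} (h : (u, v) ∈ mulGraph r) :
    wsq (fun _ _ => 1) v = wsq (fun n x => r n x ^ 2) u := by
  rw [wsq_of_mulGraph h]; simp

/-! ### Change of weights when a photon of bounded momentum is added or removed -/

section Stable

variable {f : Photon → ℂ} {L : ℝ}

theorem addStable_omega (hL : 0 ≤ L) (hsupp : ∀ y, f y ≠ 0 → ‖y.1‖ ≤ L) :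
    AddStable f (2 + L + 2 * L ^ 2) fun n x => 1 + omega n x := by
  intro n x i h
  have h1 := hsupp _ h
  have h2 := omega_nonneg n (i.removeNth x)
  simp only [omega_removeNth x i]
  nlinarith [mul_nonneg hL h2, mul_nonneg (sq_nonneg L) h2]

theorem removeStable_omega (hL : 0 ≤ L) :
    RemoveStable f (2 + L + 2 * L ^ 2) fun n x => 1 + omega n x := by
  intro n x i h
  have h2 := omega_nonneg n (i.removeNth x)
  have h1 : omega n (i.removeNth x) ≤ omega (n + 1) x := by
    rw [omega_removeNth x i]; linarith [norm_nonneg (x i).1]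
  nlinarith [mul_nonneg hL (h2.trans h1), mul_nonneg (sq_nonneg L) (h2.trans h1)]

/-- Uses `(L + b)² ≤ 2L² + 2b²`. The factor is larger than needed, so that one constant serves the
weights `1 + ω` and `1 + |k|²` alike. -/
theorem sq_add_le_of_le {a b L : ℝ} (ha : 0 ≤ a) (hL : 0 ≤ L) (h : a ≤ L + b) :
    1 + a ^ 2 ≤ (2 + L + 2 * L ^ 2) * (1 + b ^ 2) := by
  have h1 : a ^ 2 ≤ (L + b) ^ 2 := pow_le_pow_left₀ ha h 2
  have h3 : 0 ≤ L * b ^ 2 := by positivity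
  have h4 : 0 ≤ L ^ 2 * b ^ 2 := by positivity
  nlinarith [sq_nonneg (L - b)]

theorem addStable_momentum (hL : 0 ≤ L) (hsupp : ∀ y, f y ≠ 0 → ‖y.1‖ ≤ L) :
    AddStable f (2 + L + 2 * L ^ 2) fun n x => 1 + ‖momentum n x‖ ^ 2 := by
  intro n x i h
  refine sq_add_le_of_le (norm_nonneg _) hL ?_
  rw [momentum_removeNth x i]
  exact (norm_add_le _ _).trans (add_le_add (hsupp _ h) le_rfl)

theorem removeStable_momentum (hL : 0 ≤ L) (hsupp : ∀ y, f y ≠ 0 → ‖y.1‖ ≤ L) :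
    RemoveStable f (2 + L + 2 * L ^ 2) fun n x => 1 + ‖momentum n x‖ ^ 2 := by
  intro n x i h
  refine sq_add_le_of_le (norm_nonneg _) hL ?_
  have : momentum n (i.removeNth x) = momentum (n + 1) x - (x i).1 := by
    rw [momentum_removeNth x i]; abel
  rw [this]
  refine (norm_sub_le _ _).trans ?_
  linarith [hsupp _ h]

theorem addStable_one (f : Photon → ℂ) : AddStable f 1 fun _ _ => 1 := fun _ _ _ _ => by simp

theorem removeStable_one (f : Photon → ℂ) : RemoveStable f 1 fun _ _ => 1 := fun _ _ _ _ => by simp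

theorem symWeight_one : SymWeight fun _ _ => 1 := ⟨fun _ => measurable_const, fun _ _ _ => rfl⟩

theorem wsq_one_fieldOp_le {F : ℝ} (hf : PhotonBound f F) {u a : Fock}
    (h : (u, a) ∈ (fieldOp f).graph) : wsq (fun _ _ => 1) a ≤
      ENNReal.ofReal (2 * F) * wsq (fun n x => 1 + omega n x) u := by
  have := wsq_fieldOp_le hf h zero_le_one symWeight_one (fun _ _ => zero_lt_one) (addStable_one f)
    (removeStable_one f)
  simpa using this

end Stable

/-! ### The relative bound of Kato–Rellich type and self-adjointness -/

section Hamiltonian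

variable {kap : R3 → ℝ} {eps : Fin 2 → R3 → R3} {alpha : ℝ} {P : R3} {F L : ℝ}

/-- The constant in the Kato-Rellich bound for the Hamiltonian. -/
def katoConst (F L : ℝ) : ℝ :=
  -- Three components and the factor `1/2` of the kinetic energy give `3/2`; the three roots bound
  -- `(P - k)Φu`, `Φ(P - k)u` and `ΦΦu`, in this order.
  3 / 2 * (Real.sqrt (20 * (2 + L + 2 * L ^ 2) * F) + Real.sqrt (4 * F) +
    Real.sqrt (4 * (2 + L + 2 * L ^ 2) * F ^ 2))

theorem katoConst_nonneg (F L : ℝ) : 0 ≤ katoConst F L := by unfold katoConst; positivity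

theorem symWeight_component (P : R3) (j : Fin 3) : SymWeight fun n x => P j - momentum n x j :=
  symWeight_of_momentum (φ := fun k => P j - k j) (by fun_prop)

theorem freeWeight_le_sq (P : R3) (n : ℕ) (x : Conf n) :
    freeWeight P n x ≤ freeWeight P n x ^ 2 := by
  nlinarith [one_le_freeWeight P n x]

theorem wsq_one_add_omega_le {u y : Fock} (h : (u, y) ∈ mulGraph (freeWeight P)) :
    wsq (fun n x => 1 + omega n x) u ≤ ENNReal.ofReal (1 * ‖y‖ ^ 2) :=
  wsq_le_of_freeWeight h zero_le_one fun n x => by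
    linarith [freeWeight_le_sq P n x, one_add_omega_le_freeWeight P n x]

theorem exists_component {u y : Fock} (h : (u, y) ∈ mulGraph (freeWeight P)) (j : Fin 3) :
    ∃ p, (u, p) ∈ mulGraph (fun n x => P j - momentum n x j) ∧
      wsq (fun n x => 1 + omega n x) p ≤ ENNReal.ofReal (2 * ‖y‖ ^ 2) := by
  obtain ⟨p, hp⟩ := exists_mulGraph (symWeight_component P j) (u := u)
    (ne_top_of_le_ne_top ENNReal.ofReal_ne_top
    (wsq_le_of_freeWeight h (C := 2) zero_le_two fun n x => by
      linarith [sq_component_le P n x j, freeWeight_le_sq P n x]))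
  refine ⟨p, hp, ?_⟩
  rw [wsq_of_mulGraph hp]
  refine wsq_le_of_freeWeight h (by norm_num) fun n x => ?_
  have h5 := mul_le_mul (one_add_omega_le_freeWeight P n x) (sq_component_le P n x j) (sq_nonneg _)
    (by linarith [one_le_freeWeight P n x])
  nlinarith

/-- A field operator changes the momentum by at most `L`, so the weight `1 + |k|²` passes through it
at the cost of a constant and no commutator of `P_f` with `Φ(f)` is needed. The `20` is `2 · 2 · 5`:
component of `P - k`, field operator, free weight. -/
theorem wsq_fieldOp_component_le {f : Photon → ℂ} (hL : 0 ≤ L) (hf : PhotonBound f F)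
    (hsupp : ∀ y, f y ≠ 0 → ‖y.1‖ ≤ L) (hP : ‖P‖ ≤ 1 / 40) {u y a : Fock}
    (h : (u, y) ∈ mulGraph (freeWeight P)) (ha : (u, a) ∈ (fieldOp f).graph) (j : Fin 3) :
    wsq (fun n x => (P j - momentum n x j) ^ 2) a ≤
      ENNReal.ofReal (20 * (2 + L + 2 * L ^ 2) * F * ‖y‖ ^ 2) := by
  have hF := hf.pos.le
  have h2 : wsq (fun n x => (P j - momentum n x j) ^ 2) a ≤
      ENNReal.ofReal 2 * wsq (fun n x => 1 + ‖momentum n x‖ ^ 2) a := by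
    rw [← wsq_const_mul zero_le_two]
    refine wsq_mono (fun n x => ?_) a
    have h3 : ‖P j‖ ≤ ‖P‖ := PiLp.norm_apply_le _ j
    have h4 : ‖momentum n x j‖ ≤ ‖momentum n x‖ := PiLp.norm_apply_le _ j
    rw [Real.norm_eq_abs] at h3 h4
    have h5 : (P j) ^ 2 ≤ 1 := by
      rw [← sq_abs]; exact pow_le_one₀ (abs_nonneg _) (by linarith)
    have h6 : (momentum n x j) ^ 2 ≤ ‖momentum n x‖ ^ 2 := by
      rw [← sq_abs]; exact pow_le_pow_left₀ (abs_nonneg _) h4 2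
    nlinarith [sq_nonneg (P j + momentum n x j)]
  have h3 := wsq_fieldOp_le hf ha (c := 2 + L + 2 * L ^ 2) (by positivity)
    (symWeight_of_momentum (φ := fun k => 1 + ‖k‖ ^ 2) (by fun_prop))
    (fun n x => by positivity) (addStable_momentum hL hsupp) (removeStable_momentum hL hsupp)
  have h4 : wsq (fun n x => (1 + ‖momentum n x‖ ^ 2) * (1 + omega n x)) u ≤
      ENNReal.ofReal (5 * ‖y‖ ^ 2) := by
    refine wsq_le_of_freeWeight h (by norm_num) fun n x => ?_
    have h5 := mul_le_mul (one_add_sq_momentum_le hP n x) (one_add_omega_le_freeWeight P n x)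
      (by linarith [omega_nonneg n x]) (by linarith [one_le_freeWeight P n x])
    linarith
  refine h2.trans ((mul_le_mul_right (h3.trans (mul_le_mul_right h4 _)) _).trans_eq ?_)
  rw [← ENNReal.ofReal_mul (by positivity), ← ENNReal.ofReal_mul (by positivity)]
  congr 1; ring

theorem wsq_fieldOp_omega_le {f : Photon → ℂ} (hL : 0 ≤ L) (hf : PhotonBound f F)
    (hsupp : ∀ y, f y ≠ 0 → ‖y.1‖ ≤ L) {u y a : Fock}
    (h : (u, y) ∈ mulGraph (freeWeight P)) (ha : (u, a) ∈ (fieldOp f).graph) :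
    wsq (fun n x => 1 + omega n x) a ≤
      ENNReal.ofReal (2 * (2 + L + 2 * L ^ 2) * F * ‖y‖ ^ 2) := by
  have hF := hf.pos.le
  have h3 := wsq_fieldOp_le hf ha (c := 2 + L + 2 * L ^ 2) (by positivity)
    (symWeight_comp symWeight_omega (φ := fun t => 1 + t) (by fun_prop))
    (fun n x => by linarith [omega_nonneg n x]) (addStable_omega hL hsupp) (removeStable_omega hL)
  have h4 : wsq (fun n x => (1 + omega n x) * (1 + omega n x)) u ≤
      ENNReal.ofReal (1 * ‖y‖ ^ 2) := by
    refine wsq_le_of_freeWeight h (by norm_num) fun n x => ?_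
    have h6 := one_add_omega_le_freeWeight P n x
    have h5 := mul_le_mul h6 h6 (by linarith [omega_nonneg n x])
      (by linarith [one_le_freeWeight P n x])
    linarith
  refine h3.trans ((mul_le_mul_right h4 _).trans_eq ?_)
  rw [← ENNReal.ofReal_mul (by positivity)]
  congr 1; ring

/-- Expands the square of `p - √α Φ` on vectors in the free domain. Every cross term carries a
factor `√α`, and `α ≤ 1` reduces the quadratic term to the same order. -/
theorem exists_velocity_sq (hL : 0 ≤ L) {j : Fin 3} (hf : PhotonBound (coupling kap eps j) F)
    (hsupp : ∀ y, coupling kap eps j y ≠ 0 → ‖y.1‖ ≤ L) (h1 : alpha ≤ 1)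
    (hP : ‖P‖ ≤ 1 / 40) {u y : Fock} (h : (u, y) ∈ mulGraph (freeWeight P)) :
    ∃ v w q, (u, v) ∈ (velocity kap eps alpha P j).graph ∧
      (v, w) ∈ (velocity kap eps alpha P j).graph ∧
      (u, q) ∈ mulGraph (fun n x => (P j - momentum n x j) * (P j - momentum n x j)) ∧
      ‖w - q‖ ≤ Real.sqrt alpha * (2 / 3 * katoConst F L) * ‖y‖ := by
  have hF := hf.pos.le
  obtain ⟨p, hp, hps⟩ := exists_component h j
  obtain ⟨a, ha⟩ := exists_fieldOp hf (ne_top_of_le_ne_top ENNReal.ofReal_ne_top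
    (wsq_one_add_omega_le h))
  obtain ⟨q, hq⟩ := exists_mulGraph (symWeight_component P j) (u := p) (by
    rw [wsq_of_mulGraph hp]
    refine ne_top_of_le_ne_top ENNReal.ofReal_ne_top
      (wsq_le_of_freeWeight h (C := 4) (by norm_num) fun n x => ?_)
    have h3 := sq_component_le P n x j
    have := mul_le_mul h3 h3 (sq_nonneg _) (by linarith [one_le_freeWeight P n x])
    linarith)
  have har := wsq_fieldOp_component_le hL hf hsupp hP h ha j
  have hat := wsq_fieldOp_omega_le hL hf hsupp h ha
  obtain ⟨r, hr⟩ := exists_mulGraph (symWeight_component P j) (u := a)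
    (ne_top_of_le_ne_top ENNReal.ofReal_ne_top har)
  obtain ⟨s, hs⟩ := exists_fieldOp hf (ne_top_of_le_ne_top ENNReal.ofReal_ne_top hps)
  obtain ⟨t, ht⟩ := exists_fieldOp hf (ne_top_of_le_ne_top ENNReal.ofReal_ne_top hat)
  have hrn : ‖r‖ ≤ Real.sqrt (20 * (2 + L + 2 * L ^ 2) * F) * ‖y‖ := by
    refine norm_le_of_wsq_le (by positivity) ?_
    rwa [wsq_one_of_mulGraph hr]
  have hsn : ‖s‖ ≤ Real.sqrt (4 * F) * ‖y‖ := by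
    refine norm_le_of_wsq_le (by positivity) ((wsq_one_fieldOp_le hf hs).trans
      ((mul_le_mul_right hps _).trans_eq ?_))
    rw [← ENNReal.ofReal_mul (by positivity)]
    congr 1; ring
  have htn : ‖t‖ ≤ Real.sqrt (4 * (2 + L + 2 * L ^ 2) * F ^ 2) * ‖y‖ := by
    refine norm_le_of_wsq_le (by positivity) ((wsq_one_fieldOp_le hf ht).trans
      ((mul_le_mul_right hat _).trans_eq ?_))
    rw [← ENNReal.ofReal_mul (by positivity)]
    congr 1; ring
  set β : ℂ := (Real.sqrt alpha : ℂ) with hβ'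
  have hβ : ‖β‖ = Real.sqrt alpha := by
    rw [Complex.norm_real, Real.norm_of_nonneg (Real.sqrt_nonneg _)]
  have hβ1 : Real.sqrt alpha ≤ 1 := Real.sqrt_le_one.2 h1
  clear_value β
  refine ⟨p - β • a, (q - β • r) - β • (s - β • t), q,
    mem_velocity_graph.2 ⟨p, a, hp, ha, by rw [hβ']⟩,
    mem_velocity_graph.2 ⟨q - β • r, s - β • t,
      pair_sub_mem _ hq (pair_smul_mem _ β hr), pair_sub_mem _ hs (pair_smul_mem _ β ht),
      by rw [hβ']⟩,
    mulGraph_comp hp hq, ?_⟩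
  have e1 : q - β • r - β • (s - β • t) - q = β • (β • t - r - s) := by
    simp only [smul_sub]; abel
  rw [e1, norm_smul, hβ]
  have h2 : ‖β • t - r - s‖ ≤ ‖t‖ + ‖r‖ + ‖s‖ := by
    refine (norm_sub_le _ _).trans (add_le_add ((norm_sub_le _ _).trans (add_le_add ?_ le_rfl))
      le_rfl)
    rw [norm_smul, hβ]
    exact mul_le_of_le_one_left (norm_nonneg _) hβ1
  rw [mul_assoc]
  refine mul_le_mul_of_nonneg_left (h2.trans ?_) (Real.sqrt_nonneg _)
  unfold katoConst
  linarith

/-- The `1` contained in `freeWeight` accounts for the `u` added to `z`: it is `H + 1` that is close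
to the free operator. -/
theorem exists_hamiltonian (hL : 0 ≤ L) (hf : ∀ j, PhotonBound (coupling kap eps j) F)
    (hsupp : ∀ j y, coupling kap eps j y ≠ 0 → ‖y.1‖ ≤ L) (h1 : alpha ≤ 1)
    (hP : ‖P‖ ≤ 1 / 40) {u y : Fock} (h : (u, y) ∈ mulGraph (freeWeight P)) :
    ∃ z, (u, z) ∈ (hamiltonian kap eps alpha P).graph ∧
      ‖z + u - y‖ ≤ Real.sqrt alpha * katoConst F L * ‖y‖ := by
  choose v w q hv hw hq hn using fun j =>
    exists_velocity_sq hL (hf j) (hsupp j) h1 hP h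
  obtain ⟨e, he⟩ := exists_mulGraph symWeight_omega (u := u)
    (ne_top_of_le_ne_top ENNReal.ofReal_ne_top (wsq_le_of_freeWeight h zero_le_one fun n x => by
      have := one_add_omega_le_freeWeight P n x
      have h2 := omega_nonneg n x
      nlinarith))
  refine ⟨_, mem_hamiltonian_graph.2 ⟨v, w, e, hv, hw, he, rfl⟩, ?_⟩
  have h2 : (u, u) ∈ mulGraph fun _ _ => 1 := fun n =>
    Filter.Eventually.of_forall fun x => by simp
  have hy : y = u + e + (1 / 2 : ℂ) • ∑ j, q j := by
    refine mulGraph_unique h ?_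
    have h3 := mulGraph_add_weight (mulGraph_add_weight h2 he)
      (mulGraph_smul_weight (mulGraph_add_weight (mulGraph_add_weight (hq 0) (hq 1)) (hq 2)) (1 / 2))
    convert h3 using 2
    · funext n x
      rw [freeWeight, EuclideanSpace.norm_sq_eq, Fin.sum_univ_three]
      simp only [PiLp.sub_apply, Real.norm_eq_abs, sq_abs]
      ring
    · rw [Fin.sum_univ_three]; push_cast; rfl
  have h3 : (1 / 2 : ℂ) • ∑ j, w j + e + u - y = (1 / 2 : ℂ) • ∑ j, (w j - q j) := by
    rw [hy, Finset.sum_sub_distrib, smul_sub]; abel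
  rw [h3, norm_smul]
  have h4 : ‖∑ j, (w j - q j)‖ ≤ ∑ _j : Fin 3, Real.sqrt alpha * (2 / 3 * katoConst F L) * ‖y‖ :=
    (norm_sum_le _ _).trans (Finset.sum_le_sum fun j _ => hn j)
  rw [Finset.sum_const, Finset.card_univ, Fintype.card_fin, nsmul_eq_mul] at h4
  have h5 : ‖(1 / 2 : ℂ)‖ = 1 / 2 := by norm_num
  rw [h5]
  push_cast at h4
  linarith

/-- With `R` the inverse of the free weight, `(H + 1) R` differs from the identity by a contraction
and is therefore onto. -/
theorem exists_hamiltonian_add_one_eq (hL : 0 ≤ L) (hf : ∀ j, PhotonBound (coupling kap eps j) F)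
    (hsupp : ∀ j y, coupling kap eps j y ≠ 0 → ‖y.1‖ ≤ L) (h1 : alpha ≤ 1)
    (hα : Real.sqrt alpha * katoConst F L ≤ 1 / 2) (hP : ‖P‖ ≤ 1 / 40) (w : Fock) :
    ∃ u y z, (u, y) ∈ mulGraph (freeWeight P) ∧ (u, z) ∈ (hamiltonian kap eps alpha P).graph ∧
      z + u = w := by
  set H := hamiltonian kap eps alpha P
  have hκ := one_le_freeWeight P
  obtain ⟨R, hR⟩ := exists_mulCLM (r := fun n x => (freeWeight P n x)⁻¹)
    (symWeight_comp (symWeight_freeWeight P) (φ := fun t => t⁻¹) (by fun_prop)) (fun n x => by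
      rw [abs_inv, abs_of_pos (by linarith [hκ n x])]
      exact inv_le_one_of_one_le₀ (hκ n x))
  have hR' : ∀ y, (R y, y) ∈ mulGraph (freeWeight P) := by
    intro y n
    filter_upwards [hR y n] with x hx
    rw [hx, ← mul_assoc, ← Complex.ofReal_mul, mul_inv_cancel₀ (by linarith [hκ n x]),
      Complex.ofReal_one, one_mul]
  have hdom : ∀ y, R y ∈ H.domain := fun y => by
    obtain ⟨z, hz, _⟩ := exists_hamiltonian hL hf hsupp h1 hP (hR' y)
    exact LinearPMap.mem_domain_of_mem_graph hz
  let S : Fock →ₗ[ℂ] Fock :=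
    LinearMap.id - (H.toFun ∘ₗ (R : Fock →ₗ[ℂ] Fock).codRestrict H.domain hdom +
      (R : Fock →ₗ[ℂ] Fock))
  have hS : ∀ y, ‖S y‖ ≤ 1 / 2 * ‖y‖ := by
    intro y
    obtain ⟨z, hz, hn⟩ := exists_hamiltonian hL hf hsupp h1 hP (hR' y)
    have hz' : H ⟨R y, hdom y⟩ = z := H.mem_graph_snd_inj (H.mem_graph ⟨R y, hdom y⟩) hz rfl
    have e : S y = -(z + R y - y) := by
      rw [← hz']
      change y - (H ⟨R y, hdom y⟩ + R y) = _
      abel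
    rw [e, norm_neg]
    exact hn.trans (mul_le_mul_of_nonneg_right hα (norm_nonneg _))
  obtain ⟨y, hy⟩ := exists_sub_eq_of_contraction hS w
  refine ⟨R y, y, H ⟨R y, hdom y⟩, hR' y, H.mem_graph ⟨R y, hdom y⟩, ?_⟩
  rw [← hy]
  change _ = y - (y - (H ⟨R y, hdom y⟩ + R y))
  abel

theorem isSelfAdjoint_hamiltonian (hL : 0 ≤ L) (hf : ∀ j, PhotonBound (coupling kap eps j) F)
    (hsupp : ∀ j y, coupling kap eps j y ≠ 0 → ‖y.1‖ ≤ L) (h1 : alpha ≤ 1)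
    (hα : Real.sqrt alpha * katoConst F L ≤ 1 / 2) (hP : ‖P‖ ≤ 1 / 40) :
    IsSelfAdjoint (hamiltonian kap eps alpha P) := by
  refine isSelfAdjoint_of_surjective (fun u z u' z' h h' => hamiltonian_symm hf h h') fun w => ?_
  obtain ⟨u, y, z, _, hz, hw⟩ := exists_hamiltonian_add_one_eq hL hf hsupp h1 hα hP w
  exact ⟨u, z, hz, hw⟩

/-- The domain of the Hamiltonian is the domain of the free Hamiltonian. -/
theorem freeWeight_of_hamiltonian (hL : 0 ≤ L) (hf : ∀ j, PhotonBound (coupling kap eps j) F)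
    (hsupp : ∀ j y, coupling kap eps j y ≠ 0 → ‖y.1‖ ≤ L) (h1 : alpha ≤ 1)
    (hα : Real.sqrt alpha * katoConst F L ≤ 1 / 2) (hP : ‖P‖ ≤ 1 / 40) {u z : Fock}
    (h : (u, z) ∈ (hamiltonian kap eps alpha P).graph) :
    ∃ y, (u, y) ∈ mulGraph (freeWeight P) ∧ ‖y‖ ≤ 2 * ‖z + u‖ := by
  obtain ⟨u1, y, z1, hy, hz1, hw⟩ := exists_hamiltonian_add_one_eq hL hf hsupp h1 hα hP (z + u)
  -- `H + 1` is symmetric and onto, hence injective; this places any vector of `D(H)` in the free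
  -- domain.
  have hu : u - u1 = 0 := by
    obtain ⟨u', _, z', _, hz', hw'⟩ :=
      exists_hamiltonian_add_one_eq hL hf hsupp h1 hα hP (u - u1)
    have h2 : ⟪u - u1, z' + u'⟫_ℂ = 0 := by
      rw [inner_add_right, inner_sub_left, inner_sub_left, hamiltonian_symm hf h hz',
        hamiltonian_symm hf hz1 hz']
      have : ⟪z + u, u'⟫_ℂ = ⟪z1 + u1, u'⟫_ℂ := by rw [hw]
      rw [inner_add_left, inner_add_left] at this
      linear_combination this
    rw [hw'] at h2
    exact inner_self_eq_zero.1 h2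
  obtain rfl : u = u1 := sub_eq_zero.1 hu
  obtain ⟨z2, hz2, hn⟩ := exists_hamiltonian hL hf hsupp h1 hP hy
  obtain rfl : z = z2 := (hamiltonian kap eps alpha P).mem_graph_snd_inj h hz2 rfl
  refine ⟨y, hy, ?_⟩
  have h3 := hn.trans (mul_le_mul_of_nonneg_right hα (norm_nonneg y))
  have h4 := norm_sub_norm_le y (z + u)
  rw [norm_sub_rev] at h4
  linarith

theorem hamiltonian_of_freeWeight (hL : 0 ≤ L) (hf : ∀ j, PhotonBound (coupling kap eps j) F)
    (hsupp : ∀ j y, coupling kap eps j y ≠ 0 → ‖y.1‖ ≤ L) (h1 : alpha ≤ 1)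
    (hα : Real.sqrt alpha * katoConst F L ≤ 1 / 2) (hP : ‖P‖ ≤ 1 / 40) {u y : Fock}
    (h : (u, y) ∈ mulGraph (freeWeight P)) :
    ∃ z, (u, z) ∈ (hamiltonian kap eps alpha P).graph ∧ ‖z + u‖ ≤ 2 * ‖y‖ := by
  obtain ⟨z, hz, hn⟩ := exists_hamiltonian hL hf hsupp h1 hP h
  refine ⟨z, hz, ?_⟩
  have h3 := hn.trans (mul_le_mul_of_nonneg_right hα (norm_nonneg y))
  have h4 := norm_sub_norm_le (z + u) y
  linarith [norm_nonneg y]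

end Hamiltonian

/-! ### Spectral subspaces -/

/-- Log-convexity makes the ratios `a (k+1) / a k` nondecreasing; a first ratio above `r` would
force growth faster than `C r ^ k`. -/
theorem le_mul_of_logConvex {a : ℕ → ℝ} {C r : ℝ} (h0 : ∀ k, 0 ≤ a k) (hr : 0 ≤ r)
    (hconv : ∀ k, a (k + 1) ^ 2 ≤ a k * a (k + 2)) (hb : ∀ k, a k ≤ C * r ^ k) :
    a 1 ≤ r * a 0 := by
  by_contra! h
  have ha1 : 0 < a 1 := (mul_nonneg hr (h0 0)).trans_lt h
  have ha0 : 0 < a 0 := by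
    refine (h0 0).lt_of_ne fun h' => ?_
    have := hconv 0
    rw [← h', zero_mul] at this
    nlinarith
  set ρ := a 1 / a 0
  have hρr : r < ρ := (lt_div_iff₀ ha0).2 h
  have hρ : 0 < ρ := div_pos ha1 ha0
  have hstep : ∀ k, 0 < a k ∧ ρ * a k ≤ a (k + 1) := by
    intro k
    induction k with
    | zero => exact ⟨ha0, (div_mul_cancel₀ _ ha0.ne').le⟩
    | succ k ih =>
      have hpos : 0 < a (k + 1) := (mul_pos hρ ih.1).trans_le ih.2
      refine ⟨hpos, ?_⟩
      have h1 := hconv k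
      have h2 : a k * (ρ * a (k + 1)) ≤ a k * a (k + 2) := by nlinarith [ih.2]
      exact le_of_mul_le_mul_left h2 ih.1
  have hpow : ∀ k, ρ ^ k * a 0 ≤ a k := by
    intro k
    induction k with
    | zero => simp
    | succ k ih =>
      have := (hstep k).2
      calc ρ ^ (k + 1) * a 0 = ρ * (ρ ^ k * a 0) := by ring
        _ ≤ ρ * a k := by gcongr
        _ ≤ _ := this
  -- For `r = 0` the bound at index one already gives `a 1 ≤ 0`; otherwise one may divide by `r`.
  rcases hr.eq_or_lt with rfl | hr'
  · have := hb 1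
    simp at this
    linarith
  · have hq : 1 < ρ / r := (one_lt_div hr').2 hρr
    obtain ⟨k, hk⟩ := pow_unbounded_of_one_lt (C / a 0) hq
    have h1 := (hpow k).trans (hb k)
    rw [div_pow, div_lt_div_iff₀ ha0 (pow_pos hr' k)] at hk
    linarith

section Abstract

variable {E : Type*} [NormedAddCommGroup E] [InnerProductSpace ℂ E]

/-- For a symmetric operator a form bound is a norm bound. With `v' = S v` and `v'' = S v'`,
polarization at `v ± t v'` gives `4 t ‖v'‖²`, the parallelogram law bounds it by `2r (‖v‖² + t²
‖v'‖²)`, and `t = ‖v‖ / ‖v'‖` balances the two terms. -/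
theorem norm_le_of_form_le (r : ℝ) (v v' : E) (hr : 0 ≤ r) (hsymm : ⟪v, v'⟫_ℂ = ⟪v', v⟫_ℂ)
    (h : ∀ t : ℝ, ∃ v'' : E, ⟪v, v''⟫_ℂ = ⟪v', v'⟫_ℂ ∧
      |(⟪v + (t : ℂ) • v', v' + (t : ℂ) • v''⟫_ℂ).re| ≤ r * ‖v + (t : ℂ) • v'‖ ^ 2 ∧
      |(⟪v - (t : ℂ) • v', v' - (t : ℂ) • v''⟫_ℂ).re| ≤ r * ‖v - (t : ℂ) • v'‖ ^ 2) :
    ‖v'‖ ≤ r * ‖v‖ := by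
  by_cases hv : v = 0
  · subst hv
    have h1 := (h 0).choose_spec.1
    rw [inner_zero_left] at h1
    simp [inner_self_eq_zero.1 h1.symm]
  by_cases hv' : v' = 0
  · rw [hv', norm_zero]; positivity
  have hvp : 0 < ‖v‖ := norm_pos_iff.2 hv
  have hvp' : 0 < ‖v'‖ := norm_pos_iff.2 hv'
  set t := ‖v‖ / ‖v'‖
  obtain ⟨v'', h1, h2, h3⟩ := h t
  have h4 : (⟪v + (t : ℂ) • v', v' + (t : ℂ) • v''⟫_ℂ).re -
      (⟪v - (t : ℂ) • v', v' - (t : ℂ) • v''⟫_ℂ).re = 4 * t * ‖v'‖ ^ 2 := by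
    have h5 : ⟪v', v'⟫_ℂ = ((‖v'‖ ^ 2 : ℝ) : ℂ) := by
      rw [inner_self_eq_norm_sq_to_K]; norm_cast
    rw [← Complex.sub_re]
    have : ⟪v + (t : ℂ) • v', v' + (t : ℂ) • v''⟫_ℂ - ⟪v - (t : ℂ) • v', v' - (t : ℂ) • v''⟫_ℂ =
        ((4 * t * ‖v'‖ ^ 2 : ℝ) : ℂ) := by
      simp only [inner_add_left, inner_add_right, inner_sub_left, inner_sub_right, inner_smul_left,
        inner_smul_right, Complex.conj_ofReal, h1, h5]
      push_cast
      ring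
    rw [this, Complex.ofReal_re]
  have h5 := parallelogram_law_with_norm ℂ v ((t : ℂ) • v')
  have h6 : ‖(t : ℂ) • v'‖ = ‖v‖ := by
    rw [norm_smul, Complex.norm_real, Real.norm_of_nonneg (by positivity)]
    exact div_mul_cancel₀ _ hvp'.ne'
  rw [h6] at h5
  have h7 : t * ‖v'‖ ^ 2 = ‖v‖ * ‖v'‖ := by simp only [t]; field_simp
  have h8 := (le_abs_self _).trans h2
  have h9 := (neg_abs_le _).trans' (neg_le_neg h3)
  have h10 : ‖v‖ * ‖v'‖ ≤ ‖v‖ * (r * ‖v‖) := by nlinarith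
  exact le_of_mul_le_mul_left h10 hvp

variable {T : E →ₗ.[ℂ] E}

/-- Vectors whose orbit under `T - c` grows at most like `r ^ k`. -/
def boundedOrbit (T : E →ₗ.[ℂ] E) (c r : ℝ) : Submodule ℂ E where
  carrier := {u | ∃ s : ℕ → E, s 0 = u ∧ (∀ k, (s k, s (k + 1) + (c : ℂ) • s k) ∈ T.graph) ∧
    ∃ C : ℝ, ∀ k, ‖s k‖ ≤ C * r ^ k}
  add_mem' := by
    rintro u v ⟨s, rfl, hs, C, hC⟩ ⟨s', rfl, hs', C', hC'⟩
    refine ⟨s + s', rfl, fun k => ?_, C + C', fun k => ?_⟩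
    · convert pair_add_mem _ (hs k) (hs' k) using 2
      · rfl
      change s (k + 1) + s' (k + 1) + (c : ℂ) • (s k + s' k) = _
      rw [smul_add]; abel
    · rw [add_mul]
      exact (norm_add_le _ _).trans (add_le_add (hC k) (hC' k))
  zero_mem' := ⟨0, rfl, fun k => by simp, 0, fun k => by simp⟩
  smul_mem' := by
    rintro a u ⟨s, rfl, hs, C, hC⟩
    refine ⟨a • s, rfl, fun k => ?_, ‖a‖ * C, fun k => ?_⟩
    · convert pair_smul_mem _ a (hs k) using 2
      · rfl
      change a • s (k + 1) + (c : ℂ) • a • s k = _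
      rw [smul_add, smul_comm a]
    · rw [Pi.smul_apply, norm_smul, mul_assoc]
      exact mul_le_mul_of_nonneg_left (hC k) (norm_nonneg _)

/-- Symmetry of an unbounded operator, in terms of its graph. -/
def GraphSymm (T : E →ₗ.[ℂ] E) : Prop :=
  ∀ u z u' z', (u, z) ∈ T.graph → (u', z') ∈ T.graph → ⟪u, z'⟫_ℂ = ⟪z, u'⟫_ℂ

theorem symm_sub (hsymm : GraphSymm T) {c : ℝ} {u z u' z' : E} (h : (u, z + (c : ℂ) • u) ∈ T.graph)
    (h' : (u', z' + (c : ℂ) • u') ∈ T.graph) : ⟪u, z'⟫_ℂ = ⟪z, u'⟫_ℂ := by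
  have := hsymm _ _ _ _ h h'
  rw [inner_add_left, inner_add_right, inner_smul_left, inner_smul_right, Complex.conj_ofReal]
    at this
  exact add_right_cancel this

/-- Symmetry gives `‖s (k+1)‖² = ⟨s k, s (k+2)⟩`, so the norms along the orbit are log-convex and
the growth rate bounds the first step. -/
theorem norm_le_of_boundedOrbit (hsymm : GraphSymm T) {c r : ℝ} (hr : 0 ≤ r) {u : E} (hu : u ∈ boundedOrbit T c r) :
    ∃ z, (u, z) ∈ T.graph ∧ ‖z - (c : ℂ) • u‖ ≤ r * ‖u‖ := by
  obtain ⟨s, rfl, hs, C, hC⟩ := hu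
  refine ⟨_, hs 0, ?_⟩
  rw [add_sub_cancel_right]
  refine le_mul_of_logConvex (a := fun k => ‖s k‖) (fun k => norm_nonneg _) hr (fun k => ?_) hC
  have h1 := symm_sub hsymm (hs k) (hs (k + 1))
  have h2 : ‖s (k + 1)‖ ^ 2 = (⟪s k, s (k + 2)⟫_ℂ).re := by
    rw [h1, inner_self_eq_norm_sq_to_K]; norm_cast
  rw [h2]
  exact (Complex.re_le_norm _).trans (norm_inner_le_norm _ _)

/-- On an invariant subspace the form bounds say that `T - c` has norm at most `r`, with `c` the
midpoint and `r` half the length of `[a, b]`; iterating inside `M` gives the orbit. -/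
theorem le_boundedOrbit (hsymm : GraphSymm T) {a b : ℝ} (hab : a ≤ b) {M : Submodule ℂ E}
    (hM : ∀ u ∈ M, ∃ h : u ∈ T.domain, T ⟨u, h⟩ ∈ M ∧
      a * ‖u‖ ^ 2 ≤ (⟪u, T ⟨u, h⟩⟫_ℂ).re ∧ (⟪u, T ⟨u, h⟩⟫_ℂ).re ≤ b * ‖u‖ ^ 2) :
    M ≤ boundedOrbit T ((a + b) / 2) ((b - a) / 2) := by
  set c := (a + b) / 2 with hc
  set r := (b - a) / 2 with hrdef
  have hr : 0 ≤ r := by simp only [r]; linarith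
  have hex : ∀ u : M, ∃ v : M, ((u : E), (v : E) + (c : ℂ) • (u : E)) ∈ T.graph := by
    rintro ⟨u, hu⟩
    obtain ⟨h, hT, -, -⟩ := hM u hu
    refine ⟨⟨T ⟨u, h⟩ - (c : ℂ) • u, M.sub_mem hT (M.smul_mem _ hu)⟩, ?_⟩
    simp only [sub_add_cancel]
    exact T.mem_graph ⟨u, h⟩
  choose S hS using hex
  have hform : ∀ u ∈ M, ∀ v : E, (u, v + (c : ℂ) • u) ∈ T.graph →
      |(⟪u, v⟫_ℂ).re| ≤ r * ‖u‖ ^ 2 := by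
    intro u hu v hv
    obtain ⟨h, -, h1, h2⟩ := hM u hu
    have h3 : T ⟨u, h⟩ = v + (c : ℂ) • u := T.mem_graph_snd_inj (T.mem_graph ⟨u, h⟩) hv rfl
    rw [h3, inner_add_right, inner_smul_right, inner_self_eq_norm_sq_to_K, Complex.add_re] at h1 h2
    have h4 : ((c : ℂ) * ((‖u‖ : ℂ)) ^ 2).re = c * ‖u‖ ^ 2 := by norm_cast
    simp only [Complex.coe_algebraMap] at h1 h2
    rw [h4] at h1 h2
    rw [abs_le]
    constructor <;> simp only [hc, hrdef] at * <;> linarith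
  have hSn : ∀ u : M, ‖(S u : E)‖ ≤ r * ‖(u : E)‖ := by
    intro u
    refine norm_le_of_form_le r _ _ hr (symm_sub hsymm (hS u) (hS u)) fun t => ?_
    refine ⟨S (S u), symm_sub hsymm (hS u) (hS (S u)), ?_, ?_⟩
    · refine hform _ (M.add_mem u.2 (M.smul_mem _ (S u).2)) _ ?_
      convert pair_add_mem _ (hS u) (pair_smul_mem _ (t : ℂ) (hS (S u))) using 2
      simp only [smul_add, smul_comm (t : ℂ)]; abel
    · refine hform _ (M.sub_mem u.2 (M.smul_mem _ (S u).2)) _ ?_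
      convert pair_sub_mem _ (hS u) (pair_smul_mem _ (t : ℂ) (hS (S u))) using 2
      simp only [smul_add, smul_sub, smul_comm (t : ℂ)]; abel
  intro u hu
  refine ⟨fun k => (S^[k] ⟨u, hu⟩ : M), rfl, fun k => ?_, ‖u‖, fun k => ?_⟩
  · simp only [Function.iterate_succ_apply']
    exact hS _
  · induction k with
    | zero => simp
    | succ k ih =>
      simp only [Function.iterate_succ_apply']
      refine (hSn _).trans ?_
      calc r * ‖(S^[k] ⟨u, hu⟩ : E)‖ ≤ r * (‖u‖ * r ^ k) := by gcongr
        _ = _ := by ring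

/-- The uniform bound on `T - c` makes the images of a convergent sequence Cauchy; closedness of `T`
identifies the limit. -/
theorem norm_le_of_mem_closure [CompleteSpace E] (hsymm : GraphSymm T) (hclosed : T.IsClosed) {c r : ℝ} (hr : 0 ≤ r)
    {M : Submodule ℂ E} (hM : M ≤ boundedOrbit T c r) {u : E} (hu : u ∈ M.topologicalClosure) :
    ∃ z, (u, z) ∈ T.graph ∧ ‖z - (c : ℂ) • u‖ ≤ r * ‖u‖ := by
  obtain ⟨s, hs, hlim⟩ := mem_closure_iff_seq_limit.1
    (show u ∈ closure (M : Set E) by rwa [← Submodule.topologicalClosure_coe])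
  choose z hz hzn using fun k => norm_le_of_boundedOrbit hsymm hr (hM (hs k))
  have hsc : CauchySeq s := hlim.cauchySeq
  have hyc : CauchySeq fun k => z k - (c : ℂ) • s k := by
    rw [Metric.cauchySeq_iff'] at hsc ⊢
    intro ε hε
    obtain ⟨N, hN⟩ := hsc (ε / (r + 1)) (by positivity)
    refine ⟨N, fun n hn => ?_⟩
    obtain ⟨z', hz', hzn'⟩ := norm_le_of_boundedOrbit hsymm hr (hM (M.sub_mem (hs n) (hs N)))
    have h1 : z n - z N = z' := T.mem_graph_snd_inj (pair_sub_mem _ (hz n) (hz N)) hz' rfl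
    have h2 := hN n hn
    rw [dist_eq_norm] at h2 ⊢
    have h3 : z n - (c : ℂ) • s n - (z N - (c : ℂ) • s N) = z' - (c : ℂ) • (s n - s N) := by
      rw [← h1, smul_sub]; abel
    rw [h3]
    refine hzn'.trans_lt ?_
    rw [lt_div_iff₀ (by positivity)] at h2
    nlinarith [norm_nonneg (s n - s N)]
  obtain ⟨y, hy⟩ := cauchySeq_tendsto_of_complete hyc
  have hzl : Filter.Tendsto z Filter.atTop (nhds (y + (c : ℂ) • u)) := by
    have := hy.add (hlim.const_smul (c : ℂ))
    simpa using this
  refine ⟨y + (c : ℂ) • u, ?_, ?_⟩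
  · have hcl : IsClosed (T.graph : Set (E × E)) := hclosed
    exact hcl.mem_of_tendsto (hlim.prodMk_nhds hzl) (Filter.Eventually.of_forall hz)
  · rw [add_sub_cancel_right]
    exact le_of_tendsto_of_tendsto' hy.norm (hlim.norm.const_mul r) hzn

end Abstract

/-- The range of the spectral projection consists of vectors in the domain that satisfy the form
bounds defining it. -/
theorem spectralSubspace_spec {T : Fock →ₗ.[ℂ] Fock}
    (hsymm : GraphSymm T)
    (hclosed : T.IsClosed) {a b : ℝ} (hab : a ≤ b) {u : Fock} (hu : u ∈ spectralSubspace T a b) :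
    ∃ z, (u, z) ∈ T.graph ∧ a * ‖u‖ ^ 2 ≤ (⟪u, z⟫_ℂ).re ∧ (⟪u, z⟫_ℂ).re ≤ b * ‖u‖ ^ 2 := by
  -- `boundedOrbit` is a linear subspace, so it contains the supremum of the subspaces `M`; this
  -- replaces the unavailable additivity of the form bounds.
  obtain ⟨z, hz, hn⟩ := norm_le_of_mem_closure hsymm hclosed (c := (a + b) / 2)
    (r := (b - a) / 2) (by linarith)
    (sSup_le fun M hM => le_boundedOrbit hsymm hab hM) hu
  refine ⟨z, hz, ?_⟩
  have h1 : |(⟪u, z - (((a + b) / 2 : ℝ) : ℂ) • u⟫_ℂ).re| ≤ (b - a) / 2 * ‖u‖ ^ 2 := by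
    refine (Complex.abs_re_le_norm _).trans ((norm_inner_le_norm _ _).trans ?_)
    nlinarith [norm_nonneg u]
  have h2 : (⟪u, z⟫_ℂ).re = (⟪u, z - (((a + b) / 2 : ℝ) : ℂ) • u⟫_ℂ).re +
      (a + b) / 2 * ‖u‖ ^ 2 := by
    have h3 : ((((a + b) / 2 : ℝ) : ℂ) * ((‖u‖ : ℂ)) ^ 2).re = (a + b) / 2 * ‖u‖ ^ 2 := by
      norm_cast
    rw [inner_sub_right, inner_smul_right, inner_self_eq_norm_sq_to_K, Complex.sub_re]
    simp only [Complex.coe_algebraMap]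
    rw [h3]; ring
  rw [abs_le] at h1
  constructor <;> linarith [h1.1, h1.2]

/-! ### The bottom of the spectrum -/

section Abstract

variable {E : Type*} [NormedAddCommGroup E] [InnerProductSpace ℂ E] {T : E →ₗ.[ℂ] E}

/-- Coercivity gives `(m - x) ‖u‖ ≤ ‖(T - x) u‖`. Hence `T - x` is injective with closed range, and
a vector orthogonal to the range lies in `D(T)` by self-adjointness and is annihilated by `T - x`.
-/
theorem exists_resolvent [CompleteSpace E] (hT : IsSelfAdjoint T) {m x : ℝ} (hx : x < m)
    (hm : ∀ u z, (u, z) ∈ T.graph → m * ‖u‖ ^ 2 ≤ (⟪u, z⟫_ℂ).re) :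
    ∃ R : E →L[ℂ] E, ∀ v, (R v, v + (x : ℂ) • R v) ∈ T.graph := by
  have hadj : ∀ y z, (∀ u w, (u, w) ∈ T.graph → ⟪z, u⟫_ℂ = ⟪y, w⟫_ℂ) → (y, z) ∈ T.graph := by
    intro y z h
    have hd := hT.dense_domain
    have h1 : ∀ u : T.domain, ⟪z, (u : E)⟫_ℂ = ⟪y, T u⟫_ℂ := fun u => h _ _ (T.mem_graph u)
    have h2 := LinearPMap.mem_adjoint_domain_of_exists y ⟨z, h1⟩
    rw [← LinearPMap.isSelfAdjoint_def.1 hT, LinearPMap.mem_graph_iff]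
    exact ⟨⟨y, h2⟩, rfl, LinearPMap.adjoint_apply_eq hd _ h1⟩
  have hbound : ∀ u v, (u, v + (x : ℂ) • u) ∈ T.graph → (m - x) * ‖u‖ ≤ ‖v‖ := by
    intro u v h
    have h1 := hm _ _ h
    have h3 : ((x : ℂ) * ((‖u‖ : ℂ)) ^ 2).re = x * ‖u‖ ^ 2 := by norm_cast
    rw [inner_add_right, inner_smul_right, inner_self_eq_norm_sq_to_K, Complex.add_re] at h1
    simp only [Complex.coe_algebraMap] at h1
    rw [h3] at h1
    have h4 := (Complex.re_le_norm _).trans (norm_inner_le_norm (𝕜 := ℂ) u v)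
    rcases (norm_nonneg u).eq_or_lt with h0 | h0
    · rw [← h0, mul_zero]; exact norm_nonneg _
    · nlinarith
  let p : Submodule ℂ (E × E) := T.graph.comap
    ((LinearMap.snd ℂ E E).prod (LinearMap.fst ℂ E E + (x : ℂ) • LinearMap.snd ℂ E E))
  have hp : ∀ v u, (v, u) ∈ p ↔ (u, v + (x : ℂ) • u) ∈ T.graph := fun v u => Iff.rfl
  have hclosed : IsClosed (T.graph : Set (E × E)) := hT.isClosed
  let V : Submodule ℂ E := p.map (LinearMap.fst ℂ E E)
  have hV : ∀ v, v ∈ V ↔ ∃ u, (u, v + (x : ℂ) • u) ∈ T.graph := by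
    intro v
    constructor
    · rintro ⟨⟨v', u⟩, h, rfl⟩
      exact ⟨u, h⟩
    · rintro ⟨u, h⟩
      exact ⟨(v, u), h, rfl⟩
  have hVc : IsClosed (V : Set E) := by
    refine isClosed_of_closure_subset fun v hv => ?_
    obtain ⟨s, hs, hlim⟩ := mem_closure_iff_seq_limit.1 hv
    choose u hu using fun k => (hV _).1 (hs k)
    have huc : CauchySeq u := by
      have hsc := hlim.cauchySeq
      rw [Metric.cauchySeq_iff'] at hsc ⊢
      intro ε hε
      obtain ⟨N, hN⟩ := hsc ((m - x) * ε) (mul_pos (by linarith) hε)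
      refine ⟨N, fun n hn => ?_⟩
      have h1 := hbound (u n - u N) (s n - s N) (by
        convert pair_sub_mem _ (hu n) (hu N) using 2
        rw [smul_sub]; abel)
      have h2 := hN n hn
      rw [dist_eq_norm] at h2 ⊢
      exact lt_of_mul_lt_mul_left (h1.trans_lt h2) (by linarith)
    obtain ⟨y, hy⟩ := cauchySeq_tendsto_of_complete huc
    exact (hV v).2 ⟨y, hclosed.mem_of_tendsto (hy.prodMk_nhds (hlim.add (hy.const_smul (x : ℂ))))
      (Filter.Eventually.of_forall hu)⟩
  have hVtop : V = ⊤ := by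
    rw [← hVc.submodule_topologicalClosure_eq]
    have : CompleteSpace V := hVc.completeSpace_coe
    rw [Submodule.topologicalClosure_eq_top_iff, Submodule.eq_bot_iff]
    intro w hw
    have h1 : (w, (0 : E) + (x : ℂ) • w) ∈ T.graph := by
      refine hadj _ _ fun u z h => ?_
      have h2 : ⟪z - (x : ℂ) • u, w⟫_ℂ = 0 := hw _ ((hV _).2 ⟨u, by simpa using h⟩)
      rw [← inner_conj_symm, map_eq_zero, inner_sub_right, inner_smul_right, sub_eq_zero] at h2
      rw [zero_add, inner_smul_left, Complex.conj_ofReal, h2]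
    have h2 := hbound _ _ h1
    rw [norm_zero] at h2
    have : ‖w‖ ≤ 0 := by
      by_contra! h3
      nlinarith
    exact norm_le_zero_iff.1 this
  refine exists_CLM_of_graph p (fun v u u' h h' => ?_) (fun v => ?_) (C := (m - x)⁻¹)
    fun v u h => ?_
  · have h1 := hbound (u - u') 0 (by
      convert pair_sub_mem _ ((hp _ _).1 h) ((hp _ _).1 h') using 2
      rw [smul_sub]; abel)
    rw [norm_zero] at h1
    have : ‖u - u'‖ ≤ 0 := by
      by_contra! h3
      nlinarith
    exact sub_eq_zero.1 (norm_le_zero_iff.1 this)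
  · have : v ∈ V := by rw [hVtop]; trivial
    exact (hV v).1 this
  · have h1 := hbound u v h
    rw [inv_mul_eq_div, le_div_iff₀ (by linarith)]
    linarith

/-- If `T - m` has a bounded inverse and `T ≥ m`, then `T ≥ m + δ` for some `δ > 0`. -/
theorem exists_gap_of_resolvent
    (hsymm : GraphSymm T)
    {m : ℝ} (hm : ∀ u z, (u, z) ∈ T.graph → m * ‖u‖ ^ 2 ≤ (⟪u, z⟫_ℂ).re) {R : E →L[ℂ] E}
    (h1 : ∀ v, (R v, v + (m : ℂ) • R v) ∈ T.graph)
    (h2 : ∀ u z, (u, z) ∈ T.graph → R (z - (m : ℂ) • u) = u) :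
    ∃ δ > 0, ∀ u z, (u, z) ∈ T.graph → (m + δ) * ‖u‖ ^ 2 ≤ (⟪u, z⟫_ℂ).re := by
  have hre : ∀ u z : E, (⟪u, z⟫_ℂ).re = (⟪u, z - (m : ℂ) • u⟫_ℂ).re + m * ‖u‖ ^ 2 := by
    intro u z
    have h3 : ((m : ℂ) * ((‖u‖ : ℂ)) ^ 2).re = m * ‖u‖ ^ 2 := by norm_cast
    rw [inner_sub_right, inner_smul_right, inner_self_eq_norm_sq_to_K, Complex.sub_re]
    simp only [Complex.coe_algebraMap]
    rw [h3]; ring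
  have hpos : ∀ v, 0 ≤ (⟪R v, v⟫_ℂ).re := by
    intro v
    have h3 := hm _ _ (h1 v)
    rw [hre, add_sub_cancel_right] at h3
    linarith
  have hsy : ∀ v w, ⟪R v, w⟫_ℂ = ⟪v, R w⟫_ℂ := fun v w => symm_sub hsymm (h1 v) (h1 w)
  set K := ‖R‖ + 1
  have hK : 0 < K := by positivity
  refine ⟨K⁻¹, inv_pos.2 hK, fun u z h => ?_⟩
  set v := z - (m : ℂ) • u with hv
  have hu : R v = u := h2 u z h
  -- Positivity of the inverse `R` at `v - u/K`, where `R v = u` and `K` exceeds `‖R‖`: expanding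
  -- gives `⟨u, v⟩ ≥ (2/K - 1/K) ‖u‖²`.
  have h3 := hpos (v - ((K⁻¹ : ℝ) : ℂ) • u)
  have h4 : (⟪R (v - ((K⁻¹ : ℝ) : ℂ) • u), v - ((K⁻¹ : ℝ) : ℂ) • u⟫_ℂ).re =
      (⟪u, v⟫_ℂ).re - 2 * K⁻¹ * ‖u‖ ^ 2 + K⁻¹ ^ 2 * (⟪R u, u⟫_ℂ).re := by
    have h5 : ⟪u, u⟫_ℂ = ((‖u‖ ^ 2 : ℝ) : ℂ) := by
      rw [inner_self_eq_norm_sq_to_K]; norm_cast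
    have h6 : ⟪R u, v⟫_ℂ = ((‖u‖ ^ 2 : ℝ) : ℂ) := by rw [hsy, hu, h5]
    rw [map_sub, map_smul, hu]
    simp only [inner_sub_left, inner_sub_right, inner_smul_left, inner_smul_right,
      Complex.conj_ofReal, h5, h6]
    simp only [Complex.sub_re, Complex.re_ofReal_mul, Complex.ofReal_re]
    ring
  have h7 : (⟪R u, u⟫_ℂ).re ≤ K * ‖u‖ ^ 2 := by
    refine (Complex.re_le_norm _).trans ((norm_inner_le_norm (𝕜 := ℂ) _ _).trans ?_)
    have := R.le_opNorm u
    have h8 : ‖R‖ ≤ K := (lt_add_one _).le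
    nlinarith [norm_nonneg u, mul_le_mul_of_nonneg_right h8 (norm_nonneg u)]
  rw [h4] at h3
  have h8 : K⁻¹ ^ 2 * (⟪R u, u⟫_ℂ).re ≤ K⁻¹ * ‖u‖ ^ 2 := by
    have := mul_le_mul_of_nonneg_left h7 (by positivity : 0 ≤ K⁻¹ ^ 2)
    refine this.trans_eq ?_
    field_simp
  rw [hre]
  linarith

end Abstract

/-- The infimum `m` of the numerical range belongs to the spectrum, and no real number below the
form bound `m₀` does. -/
theorem infSpec_bounds {T : Fock →ₗ.[ℂ] Fock} (hT : IsSelfAdjoint T)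
    (hsymm : GraphSymm T) {m₀ M : ℝ}
    (hm : ∀ u z, (u, z) ∈ T.graph → m₀ * ‖u‖ ^ 2 ≤ (⟪u, z⟫_ℂ).re) {e f : Fock}
    (he : (e, f) ∈ T.graph) (hne : ‖e‖ = 1) (hM : (⟪e, f⟫_ℂ).re ≤ M) :
    m₀ ≤ infSpec T ∧ infSpec T ≤ M := by
  set X : Set ℝ := {t | ∃ u z, (u, z) ∈ T.graph ∧ ‖u‖ = 1 ∧ (⟪u, z⟫_ℂ).re = t}
  have hXb : BddBelow X := ⟨m₀, by
    rintro _ ⟨u, z, h, h1, rfl⟩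
    have := hm u z h
    rwa [h1, one_pow, mul_one] at this⟩
  have heX : (⟪e, f⟫_ℂ).re ∈ X := ⟨e, f, he, hne, rfl⟩
  set m := sInf X
  have hmM : m ≤ M := (csInf_le hXb heX).trans hM
  have hform : ∀ u z, (u, z) ∈ T.graph → m * ‖u‖ ^ 2 ≤ (⟪u, z⟫_ℂ).re := by
    intro u z h
    rcases (norm_nonneg u).eq_or_lt with h0 | h0
    · have : u = 0 := norm_eq_zero.1 h0.symm
      subst this
      simp
    · have h1 : (⟪((‖u‖⁻¹ : ℝ) : ℂ) • u, ((‖u‖⁻¹ : ℝ) : ℂ) • z⟫_ℂ).re ∈ X := by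
        refine ⟨_, _, pair_smul_mem _ ((‖u‖⁻¹ : ℝ) : ℂ) h, ?_, rfl⟩
        rw [norm_smul, Complex.norm_real, norm_inv, norm_norm, inv_mul_cancel₀ h0.ne']
      have h2 := csInf_le hXb h1
      rw [inner_smul_left, inner_smul_right, Complex.conj_ofReal, Complex.re_ofReal_mul,
        Complex.re_ofReal_mul] at h2
      calc m * ‖u‖ ^ 2 ≤ (‖u‖⁻¹ * (‖u‖⁻¹ * (⟪u, z⟫_ℂ).re)) * ‖u‖ ^ 2 := by gcongr
        _ = _ := by field_simp
  -- A bounded inverse of `T - m` would open a gap above `m`, contradicting that `m` is an infimum.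
  have hspec : (m : ℂ) ∈ spec T := by
    rintro ⟨R, h1, h2⟩
    obtain ⟨δ, hδ, h3⟩ := exists_gap_of_resolvent hsymm hform (R := R) (fun v => by
      obtain ⟨h, hv⟩ := h1 v
      rw [LinearPMap.mem_graph_iff]
      exact ⟨⟨R v, h⟩, rfl, sub_eq_iff_eq_add.1 hv⟩) (fun u z h => by
      obtain ⟨y, rfl, rfl⟩ := (LinearPMap.mem_graph_iff _).1 h
      exact h2 y)
    have h4 : m + δ ≤ m := le_csInf ⟨_, heX⟩ (by
      rintro _ ⟨u, z, h, h1, rfl⟩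
      have := h3 u z h
      rwa [h1, one_pow, mul_one] at this)
    linarith
  have hlow : ∀ x : ℝ, (x : ℂ) ∈ spec T → m₀ ≤ x := by
    intro x hx
    by_contra! hlt
    obtain ⟨R, hR⟩ := exists_resolvent hT hlt hm
    refine hx ⟨R, fun v => ⟨LinearPMap.mem_domain_of_mem_graph (hR v), ?_⟩, fun u => ?_⟩
    · have h := T.mem_graph_snd_inj
        (T.mem_graph ⟨R v, LinearPMap.mem_domain_of_mem_graph (hR v)⟩) (hR v) rfl
      rw [h, add_sub_cancel_right]
    · set w := R (T u - (x : ℂ) • (u : Fock)) with hw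
      have h1 := pair_sub_mem _ (hR (T u - (x : ℂ) • (u : Fock))) (T.mem_graph u)
      rw [← hw] at h1
      have h2 : T u - (x : ℂ) • (u : Fock) + (x : ℂ) • w - T u = (x : ℂ) • (w - (u : Fock)) := by
        rw [smul_sub]; abel
      rw [h2] at h1
      have h3 := hm _ _ h1
      have h4 : ((x : ℂ) * ((‖w - (u : Fock)‖ : ℂ)) ^ 2).re = x * ‖w - (u : Fock)‖ ^ 2 := by
        norm_cast
      rw [inner_smul_right, inner_self_eq_norm_sq_to_K] at h3
      simp only [Complex.coe_algebraMap] at h3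
      rw [h4] at h3
      have h5 : ‖w - (u : Fock)‖ ^ 2 ≤ 0 := by nlinarith [sq_nonneg ‖w - (u : Fock)‖]
      exact sub_eq_zero.1 (norm_eq_zero.1 (pow_eq_zero_iff two_ne_zero |>.1
        (le_antisymm h5 (sq_nonneg _))))
  -- The real infimum is meaningful here: the set contains `m` and is bounded below by `m₀`.
  exact ⟨le_csInf ⟨m, hspec⟩ hlow, (csInf_le ⟨m₀, hlow⟩ hspec).trans hmM⟩

/-! ### Scaling of photon configurations -/

/-- Multiplication of all photon momenta by `exp t`. -/
def scale {n : ℕ} (t : ℝ) (x : Conf n) : Conf n := fun i => (Real.exp t • (x i).1, (x i).2)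

theorem scale_scale {n : ℕ} (s t : ℝ) (x : Conf n) : scale s (scale t x) = scale (s + t) x := by
  funext i
  simp only [scale, Real.exp_add, mul_smul]

theorem scale_zero {n : ℕ} (x : Conf n) : scale 0 x = x := by
  funext i
  simp [scale]

theorem measurable_scale {n : ℕ} (t : ℝ) : Measurable (scale t : Conf n → Conf n) := by
  refine measurable_pi_lambda _ fun i => ?_
  exact ((measurable_pi_apply i).fst.const_smul (Real.exp t)).prodMk (measurable_pi_apply i).snd

/-- Scaling as a measurable equivalence. -/
def scaleEquiv (n : ℕ) (t : ℝ) : Conf n ≃ᵐ Conf n where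
  toFun := scale t
  invFun := scale (-t)
  left_inv x := by rw [scale_scale, neg_add_cancel, scale_zero]
  right_inv x := by rw [scale_scale, add_neg_cancel, scale_zero]
  measurable_toFun := measurable_scale t
  measurable_invFun := measurable_scale (-t)

theorem photonMeasure_scale (t : ℝ) :
    photonMeasure.map (fun y : Photon => (Real.exp t • y.1, y.2)) =
      ENNReal.ofReal (Real.exp (-(3 * t))) • photonMeasure := by
  have h := Measure.map_prod_map (volume : Measure R3) (Measure.count : Measure (Fin 2))
    (f := fun k => Real.exp t • k) (g := id) (measurable_const_smul _) measurable_id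
  rw [Measure.map_id, Measure.map_addHaar_smul _ (Real.exp_ne_zero t), Measure.prod_smul_left,
    finrank_euclideanSpace_fin] at h
  rw [photonMeasure]
  refine Eq.trans h.symm ?_
  congr 2
  rw [abs_inv, abs_of_pos (by positivity), ← Real.exp_nat_mul, ← Real.exp_neg]
  norm_num

/-- Each photon contributes the Jacobian `exp (-3t)` of its three momentum coordinates;
polarizations do not scale. -/
theorem confMeasure_scale (n : ℕ) (t : ℝ) :
    (confMeasure n).map (scale t) = ENNReal.ofReal (Real.exp (-(3 * n * t))) • confMeasure n := by
  have h : confMeasure n = ENNReal.ofReal (Real.exp (3 * n * t)) • (confMeasure n).map (scale t) := by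
    refine Measure.pi_eq fun s hs => ?_
    rw [Measure.smul_apply, Measure.map_apply (measurable_scale t)
      (MeasurableSet.univ_pi fun i => hs i)]
    have e : (scale t : Conf n → Conf n) ⁻¹' Set.pi Set.univ s =
        Set.pi Set.univ fun i => (fun y : Photon => (Real.exp t • y.1, y.2)) ⁻¹' s i := by
      ext x; simp [scale]
    have e2 : ∀ i, photonMeasure ((fun y : Photon => (Real.exp t • y.1, y.2)) ⁻¹' s i) =
        ENNReal.ofReal (Real.exp (-(3 * t))) * photonMeasure (s i) := by
      intro i
      rw [← Measure.map_apply (by fun_prop) (hs i), photonMeasure_scale]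
      rfl
    rw [e, confMeasure, Measure.pi_pi]
    simp only [e2]
    rw [Finset.prod_mul_distrib, Finset.prod_const, Finset.card_univ, Fintype.card_fin, smul_eq_mul,
      ← mul_assoc, ← ENNReal.ofReal_pow (Real.exp_nonneg _), ← ENNReal.ofReal_mul
      (Real.exp_nonneg _), ← Real.exp_nat_mul, ← Real.exp_add]
    have : 3 * n * t + n * -(3 * t) = 0 := by ring
    rw [this, Real.exp_zero, ENNReal.ofReal_one, one_mul]
  conv_rhs => rw [h]
  rw [smul_smul, ← ENNReal.ofReal_mul (Real.exp_nonneg _), ← Real.exp_add, neg_add_cancel,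
    Real.exp_zero, ENNReal.ofReal_one, one_smul]

theorem lintegral_scale {n : ℕ} (t : ℝ) (G : Conf n → ENNReal) :
    ∫⁻ x, G (scale t x) ∂confMeasure n =
      ENNReal.ofReal (Real.exp (-(3 * n * t))) * ∫⁻ x, G x ∂confMeasure n := by
  have h := (scaleEquiv n t).measurableEmbedding.lintegral_map (μ := confMeasure n) G
  change ∫⁻ x, G x ∂(confMeasure n).map (scale t) = _ at h
  rw [confMeasure_scale, lintegral_smul_measure] at h
  exact h.symm

theorem quasiMeasurePreserving_scale {n : ℕ} (t : ℝ) :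
    Measure.QuasiMeasurePreserving (scale t) (confMeasure n) (confMeasure n) := by
  refine ⟨measurable_scale t, ?_⟩
  rw [confMeasure_scale]
  exact Measure.smul_absolutelyContinuous

/-! ### The dilation group -/

/-- The density factor of the dilation group in the `n`-photon sector. -/
def dilFactor (n : ℕ) (t : ℝ) : ℝ := Real.exp (-(3 * n * t / 2))

theorem dilFactor_add (n : ℕ) (s t : ℝ) : dilFactor n (s + t) = dilFactor n s * dilFactor n t := by
  rw [dilFactor, dilFactor, dilFactor, ← Real.exp_add]
  congr 1; ring

theorem lintegral_normSq_dil {n : ℕ} (t : ℝ) (F : Conf n → ℂ) :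
    ∫⁻ x, ENNReal.ofReal (‖(dilFactor n t : ℂ) * F (scale (-t) x)‖ ^ 2) ∂confMeasure n =
      ∫⁻ x, ENNReal.ofReal (‖F x‖ ^ 2) ∂confMeasure n := by
  have h : ∀ x, ENNReal.ofReal (‖(dilFactor n t : ℂ) * F (scale (-t) x)‖ ^ 2) =
      ENNReal.ofReal (dilFactor n t ^ 2) * ENNReal.ofReal (‖F (scale (-t) x)‖ ^ 2) := by
    intro x
    rw [norm_mul, Complex.norm_real, Real.norm_eq_abs, mul_pow, sq_abs,
      ENNReal.ofReal_mul (sq_nonneg _)]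
  simp only [h]
  rw [lintegral_const_mul' _ _ ENNReal.ofReal_ne_top,
    lintegral_scale (-t) fun x => ENNReal.ofReal (‖F x‖ ^ 2), ← mul_assoc,
    ← ENNReal.ofReal_mul (sq_nonneg _), dilFactor, ← Real.exp_nat_mul, ← Real.exp_add]
  have : ((2 : ℕ) : ℝ) * -(3 * n * t / 2) + -(3 * n * -t) = 0 := by push_cast; ring
  rw [this, Real.exp_zero, ENNReal.ofReal_one, one_mul]

theorem memLp_dil {n : ℕ} (t : ℝ) (F : SectorL2 n) :
    MemLp (fun x => (dilFactor n t : ℂ) * F (scale (-t) x)) 2 (confMeasure n) := by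
  have hm : AEStronglyMeasurable (fun x => (dilFactor n t : ℂ) * F (scale (-t) x))
      (confMeasure n) := aestronglyMeasurable_const.mul
    ((Lp.aestronglyMeasurable F).comp_quasiMeasurePreserving (quasiMeasurePreserving_scale (-t)))
  rw [memLp_two_iff_integrable_sq_norm hm]
  refine ⟨hm.norm.pow 2, ?_⟩
  rw [hasFiniteIntegral_iff_ofReal (Filter.Eventually.of_forall fun x => by positivity),
    lintegral_normSq_dil, lintegral_normSq_sector]
  exact ENNReal.ofReal_lt_top

/-- The dilation group on `L²((ℝ³ × ℤ₂)ⁿ)`. -/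
def dilSec (n : ℕ) (t : ℝ) : SectorL2 n →ₗᵢ[ℂ] SectorL2 n where
  toFun F := (memLp_dil t F).toLp _
  map_add' F G := by
    apply Lp.ext
    filter_upwards [(memLp_dil t (F + G)).coeFn_toLp, (memLp_dil t F).coeFn_toLp,
      (memLp_dil t G).coeFn_toLp, Lp.coeFn_add ((memLp_dil t F).toLp _) ((memLp_dil t G).toLp _),
      (quasiMeasurePreserving_scale (-t)).ae (Lp.coeFn_add F G)] with x h1 h2 h3 h4 h5
    rw [h1, h4, Pi.add_apply, h2, h3, h5, Pi.add_apply, mul_add]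
  map_smul' c F := by
    apply Lp.ext
    filter_upwards [(memLp_dil t (c • F)).coeFn_toLp, (memLp_dil t F).coeFn_toLp,
      Lp.coeFn_smul c ((memLp_dil t F).toLp _),
      (quasiMeasurePreserving_scale (-t)).ae (Lp.coeFn_smul c F)] with x h1 h2 h4 h5
    rw [RingHom.id_apply, h1, h4, Pi.smul_apply, h2, h5, Pi.smul_apply, smul_eq_mul, smul_eq_mul]
    ring
  norm_map' F := by
    refine (sq_eq_sq₀ (norm_nonneg _) (norm_nonneg _)).1 ?_
    refine (ENNReal.ofReal_eq_ofReal_iff (sq_nonneg _) (sq_nonneg _)).1 ?_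
    rw [← lintegral_normSq_sector, ← lintegral_normSq_sector, ← lintegral_normSq_dil t F]
    refine lintegral_congr_ae ?_
    filter_upwards [(memLp_dil t F).coeFn_toLp] with x h1
    exact congrArg (fun z : ℂ => ENNReal.ofReal (‖z‖ ^ 2)) h1

theorem coeFn_dilSec {n : ℕ} (t : ℝ) (F : SectorL2 n) :
    ∀ᵐ x ∂confMeasure n, dilSec n t F x = (dilFactor n t : ℂ) * F (scale (-t) x) :=
  (memLp_dil t F).coeFn_toLp

theorem dilSec_add {n : ℕ} (s t : ℝ) (F : SectorL2 n) :
    dilSec n s (dilSec n t F) = dilSec n (s + t) F := by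
  apply Lp.ext
  filter_upwards [coeFn_dilSec s (dilSec n t F), coeFn_dilSec (s + t) F,
    (quasiMeasurePreserving_scale (-s)).ae (coeFn_dilSec t F)] with x h1 h2 h3
  rw [h1, h2, h3, scale_scale, dilFactor_add, Complex.ofReal_mul, mul_assoc,
    show -(s + t) = -t + -s by ring]

theorem dilSec_zero {n : ℕ} (F : SectorL2 n) : dilSec n 0 F = F := by
  apply Lp.ext
  filter_upwards [coeFn_dilSec 0 F] with x h1
  rw [h1, neg_zero, scale_zero]
  simp [dilFactor]

theorem inner_dilSec {n : ℕ} (t : ℝ) (F G : SectorL2 n) :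
    ⟪dilSec n t F, G⟫_ℂ = ⟪F, dilSec n (-t) G⟫_ℂ := by
  rw [← (dilSec n t).inner_map_map F (dilSec n (-t) G), dilSec_add, add_neg_cancel, dilSec_zero]

theorem dilSec_mem_symSector {n : ℕ} (t : ℝ) {F : SectorL2 n} (hF : F ∈ symSector n) :
    dilSec n t F ∈ symSector n := by
  intro p
  apply Lp.ext
  have h2 : (permute p (dilSec n t F) : Conf n → ℂ) =ᵐ[confMeasure n]
      fun x => dilSec n t F (fun i => x (p i)) :=
    Lp.coeFn_compMeasurePreserving (dilSec n t F) (measurePreserving_perm p)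
  have h3 : (permute p F : Conf n → ℂ) =ᵐ[confMeasure n] fun x => F (fun i => x (p i)) :=
    Lp.coeFn_compMeasurePreserving F (measurePreserving_perm p)
  rw [hF p] at h3
  filter_upwards [h2, (measurePreserving_perm p).quasiMeasurePreserving.ae (coeFn_dilSec t F),
    coeFn_dilSec t F, (quasiMeasurePreserving_scale (-t)).ae h3] with x a b c d
  rw [a, b, c, d]
  rfl

/-- The dilation group in Fock space. -/
def dil (t : ℝ) : Fock →ₗᵢ[ℂ] Fock where
  toFun u := ⟨fun n => ⟨dilSec n t (wave u n), dilSec_mem_symSector t (u n).2⟩, by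
    refine memℓp_gen ?_
    refine ((lp.memℓp u).summable (by norm_num)).congr fun n => ?_
    have h : ‖(⟨dilSec n t (wave u n), dilSec_mem_symSector t (u n).2⟩ : symSector n)‖ = ‖u n‖ :=
      (dilSec n t).norm_map (wave u n)
    rw [h]⟩
  map_add' u v := wave_ext fun n => map_add (dilSec n t) (wave u n) (wave v n)
  map_smul' c u := wave_ext fun n => map_smul (dilSec n t) c (wave u n)
  norm_map' u := by
    refine (sq_eq_sq₀ (norm_nonneg _) (norm_nonneg _)).1 ?_
    refine (ENNReal.ofReal_eq_ofReal_iff (sq_nonneg _) (sq_nonneg _)).1 ?_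
    rw [← wsq_one, ← wsq_one]
    refine tsum_congr fun n => ?_
    simp only [one_mul]
    rw [lintegral_normSq_sector, lintegral_normSq_sector]
    exact congrArg (fun r : ℝ => ENNReal.ofReal (r ^ 2)) ((dilSec n t).norm_map (wave u n))

theorem wave_dil (t : ℝ) (u : Fock) (n : ℕ) : wave (dil t u) n = dilSec n t (wave u n) := rfl

theorem dil_add (s t : ℝ) (u : Fock) : dil s (dil t u) = dil (s + t) u :=
  wave_ext fun n => dilSec_add s t (wave u n)

theorem dil_zero (u : Fock) : dil 0 u = u := wave_ext fun n => dilSec_zero (wave u n)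

theorem inner_dil (t : ℝ) (u v : Fock) : ⟪dil t u, v⟫_ℂ = ⟪u, dil (-t) v⟫_ℂ := by
  rw [← (dil t).inner_map_map u (dil (-t) v), dil_add, add_neg_cancel, dil_zero]

/-! ### Dilations of multiplication, creation and annihilation operators -/

/-- Weights that are homogeneous of degree `d` in the photon momenta. -/
def Homogeneous (d : ℝ) (m : ∀ n, Conf n → ℝ) : Prop :=
  ∀ n (t : ℝ) (x : Conf n), m n (scale t x) = Real.exp (d * t) * m n x

theorem mulGraph_dil {d : ℝ} {m : ∀ n, Conf n → ℝ} (hm : Homogeneous d m) {u v : Fock}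
    (h : (u, v) ∈ mulGraph m) (t : ℝ) :
    (dil t u, (Real.exp (d * t) : ℂ) • dil t v) ∈ mulGraph m := by
  intro n
  have e := (quasiMeasurePreserving_scale (n := n) (-t)).ae (h n)
  filter_upwards [coeFn_dilSec t (wave u n), coeFn_dilSec t (wave v n), e,
    Lp.coeFn_smul (Real.exp (d * t) : ℂ) (dilSec n t (wave v n))] with x h1 h2 h3 h4
  rw [wave_smul, wave_dil, wave_dil, h4, Pi.smul_apply, h2, h3, h1, hm n (-t) x, smul_eq_mul,
    mul_neg, Real.exp_neg]
  push_cast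
  have : Complex.exp (d * t) ≠ 0 := Complex.exp_ne_zero _
  field_simp

theorem homogeneous_omega : Homogeneous 1 omega := by
  intro n t x
  unfold omega
  rw [Finset.mul_sum]
  refine Finset.sum_congr rfl fun i _ => ?_
  rw [scale, norm_smul, Real.norm_of_nonneg (Real.exp_nonneg _), one_mul]

theorem momentum_scale (n : ℕ) (t : ℝ) (x : Conf n) :
    momentum n (scale t x) = Real.exp t • momentum n x := by
  unfold momentum
  rw [Finset.smul_sum]
  rfl

/-- Dilation of a one-photon function. -/
def dilPhoton (t : ℝ) (f : Photon → ℂ) (y : Photon) : ℂ :=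
  (Real.exp (-(3 * t / 2)) : ℂ) * f (Real.exp (-t) • y.1, y.2)

theorem dilPhoton_neg_dilPhoton (t : ℝ) (f : Photon → ℂ) : dilPhoton t (dilPhoton (-t) f) = f := by
  funext y
  simp only [dilPhoton, neg_neg, smul_smul, ← Real.exp_add, add_neg_cancel, Real.exp_zero, one_smul]
  rw [← mul_assoc, ← Complex.ofReal_mul, ← Real.exp_add]
  have : -(3 * t / 2) + -(3 * -t / 2) = 0 := by ring
  rw [this]; simp

/-- Covariance: the additional photon's share of the density factor is exactly the one in
`dilPhoton`. -/
theorem creationGraph_dil {f : Photon → ℂ} {u v : Fock} (h : (u, v) ∈ creationGraph f) (t : ℝ) :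
    (dil t u, dil t v) ∈ creationGraph (dilPhoton t f) := by
  refine ⟨by rw [wave_dil, h.1, map_zero], fun n => ?_⟩
  have e := (quasiMeasurePreserving_scale (n := n + 1) (-t)).ae (h.2 n)
  have e2 : ∀ i : Fin (n + 1), ∀ᵐ x ∂confMeasure (n + 1), dilSec n t (wave u n) (i.removeNth x) =
      (dilFactor n t : ℂ) * wave u n (scale (-t) (i.removeNth x)) := fun i =>
    (quasiMeasurePreserving_removeNth i).ae (coeFn_dilSec t (wave u n))
  filter_upwards [coeFn_dilSec t (wave v (n + 1)), e, ae_all_iff.2 e2] with x h1 h2 h3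
  rw [wave_dil, h1, h2]
  simp only [wave_dil, h3, dilPhoton]
  rw [mul_left_comm, Finset.mul_sum]
  congr 1
  refine Finset.sum_congr rfl fun i _ => ?_
  have hd : dilFactor (n + 1) t = Real.exp (-(3 * t / 2)) * dilFactor n t := by
    rw [dilFactor, dilFactor, ← Real.exp_add]
    congr 1; push_cast; ring
  rw [hd, Complex.ofReal_mul]
  change _ * (f (Real.exp (-t) • (x i).1, (x i).2) * wave u n (scale (-t) (i.removeNth x))) = _
  ring

theorem photonNormSq_dil_ne_top {f : Photon → ℂ} (h : photonNormSq f ≠ ⊤) (t : ℝ) :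
    photonNormSq (dilPhoton t f) ≠ ⊤ := by
  set K := Real.exp (-(3 * t)) * (1 + Real.exp (-t)) with hK
  have hemb : MeasurableEmbedding (fun y : Photon => (Real.exp (-t) • y.1, y.2)) :=
    ((Homeomorph.smulOfNeZero (Real.exp (-t)) (Real.exp_ne_zero _)).toMeasurableEquiv.prodCongr
      (MeasurableEquiv.refl (Fin 2))).measurableEmbedding
  have h1 : photonNormSq (dilPhoton t f) ≤
      ENNReal.ofReal K * ∫⁻ y, ENNReal.ofReal (‖f (Real.exp (-t) • y.1, y.2)‖ ^ 2 *
        (1 + ‖Real.exp (-t) • y.1‖⁻¹)) ∂photonMeasure := by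
    rw [← lintegral_const_mul' _ _ ENNReal.ofReal_ne_top]
    refine lintegral_mono fun y => ?_
    rw [← ENNReal.ofReal_mul (by positivity)]
    refine ENNReal.ofReal_le_ofReal ?_
    rw [dilPhoton, norm_mul, mul_pow, Complex.norm_real, Real.norm_of_nonneg (Real.exp_nonneg _),
      ← Real.exp_nat_mul, norm_smul, Real.norm_of_nonneg (Real.exp_nonneg _), mul_inv]
    have e : ((2 : ℕ) : ℝ) * -(3 * t / 2) = -(3 * t) := by push_cast; ring
    rw [e, hK]
    set a := Real.exp (-t)
    have ha : 0 < a := Real.exp_pos _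
    set b := ‖y.1‖⁻¹
    have hb : 0 ≤ b := by positivity
    have h2 : 1 + b ≤ (1 + a) * (1 + a⁻¹ * b) := by
      have : (1 + a) * (1 + a⁻¹ * b) = 1 + a + a⁻¹ * b + b := by field_simp; ring
      rw [this]
      have : 0 ≤ a⁻¹ * b := by positivity
      linarith
    set c := ‖f (a • y.1, y.2)‖ ^ 2
    have hc : 0 ≤ c := by positivity
    set d := Real.exp (-(3 * t))
    have hd : 0 ≤ d := Real.exp_nonneg _
    calc d * c * (1 + b) ≤ d * c * ((1 + a) * (1 + a⁻¹ * b)) := by gcongr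
      _ = _ := by ring
  refine ne_top_of_le_ne_top (ENNReal.mul_ne_top ENNReal.ofReal_ne_top ?_) h1
  have h2 := hemb.lintegral_map (μ := photonMeasure)
    (fun y => ENNReal.ofReal (‖f y‖ ^ 2 * (1 + ‖y.1‖⁻¹)))
  rw [← h2, photonMeasure_scale, lintegral_smul_measure]
  exact ENNReal.mul_ne_top ENNReal.ofReal_ne_top h

theorem aestronglyMeasurable_dilPhoton {f : Photon → ℂ}
    (hf : AEStronglyMeasurable f photonMeasure) (t : ℝ) :
    AEStronglyMeasurable (dilPhoton t f) photonMeasure := by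
  refine aestronglyMeasurable_const.mul (hf.comp_quasiMeasurePreserving ⟨by fun_prop, ?_⟩)
  rw [photonMeasure_scale]
  exact Measure.smul_absolutelyContinuous

/-- Follows from covariance of creation operators by taking adjoints, since dilations are unitary.
-/
theorem annihilation_dil {f : Photon → ℂ} (hf : AEStronglyMeasurable f photonMeasure)
    (hfin : photonNormSq f ≠ ⊤) {u d : Fock} (h : (u, d) ∈ (annihilation f).graph) (t : ℝ) :
    (dil t u, dil t d) ∈ (annihilation (dilPhoton t f)).graph := by
  rw [mem_annihilation_graph (aestronglyMeasurable_dilPhoton hf t) (photonNormSq_dil_ne_top hfin t)]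
  intro w w' hw
  have h1 := creationGraph_dil hw (-t)
  have h2 := dilPhoton_neg_dilPhoton (-t) f
  rw [neg_neg] at h2
  rw [h2] at h1
  rw [inner_dil, inner_dil]
  exact (mem_annihilation_graph hf hfin).1 h _ _ h1

theorem fieldOp_dil {f : Photon → ℂ} (hf : AEStronglyMeasurable f photonMeasure)
    (hfin : photonNormSq f ≠ ⊤) {u a : Fock} (h : (u, a) ∈ (fieldOp f).graph) (t : ℝ) :
    (dil t u, dil t a) ∈ (fieldOp (dilPhoton t f)).graph := by
  obtain ⟨c, d, hc, hd, rfl⟩ := mem_fieldOp_graph.1 h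
  refine mem_fieldOp_graph.2 ⟨_, _, creationGraph_dil hc t, annihilation_dil hf hfin hd t, ?_⟩
  rw [map_smul, map_add]

/-! ### Test functions for the generator of dilatations -/

/-- `∇ · k = k · ∇ + 3` in dimension three. -/
theorem dilExpr_eq {g : R3 → ℂ} {k : R3} (hg : DifferentiableAt ℝ g k) :
    dilExpr g k = Complex.I * (fderiv ℝ g k k + 3 / 2 * g k) := by
  have h1 : ∀ m : Fin 3, fderiv ℝ (fun q : R3 => (q m : ℂ) * g q) k (EuclideanSpace.single m 1) =
      (k m : ℂ) * fderiv ℝ g k (EuclideanSpace.single m 1) + g k := by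
    intro m
    have hc : HasFDerivAt (fun q : R3 => (q m : ℂ))
        (Complex.ofRealCLM.comp (EuclideanSpace.proj m : R3 →L[ℝ] ℝ)) k :=
      (Complex.ofRealCLM.comp (EuclideanSpace.proj m : R3 →L[ℝ] ℝ)).hasFDerivAt
    have e := (hc.mul hg.hasFDerivAt).fderiv
    change fderiv ℝ (fun q : R3 => (q m : ℂ) * g q) k = _ at e
    rw [e]
    simp
  have h2 : fderiv ℝ g k k = ∑ m : Fin 3, (k m : ℂ) * fderiv ℝ g k (EuclideanSpace.single m 1) := by
    have e : k = ∑ m : Fin 3, k m • (EuclideanSpace.single m 1 : R3) := by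
      ext j; fin_cases j <;> simp [Fin.sum_univ_three]
    conv_lhs => rw [show fderiv ℝ g k k = fderiv ℝ g k (∑ m : Fin 3, k m •
      (EuclideanSpace.single m 1 : R3)) from congrArg _ e]
    rw [map_sum]
    refine Finset.sum_congr rfl fun m _ => ?_
    rw [map_smul, Complex.real_smul]
  rw [dilExpr, h2]
  simp only [h1, Fin.sum_univ_three]
  ring

theorem dilExprN_eq {n : ℕ} {g : (Fin n → R3) → ℂ} (hg : Differentiable ℝ g) (k : Fin n → R3) :
    dilExprN g k = Complex.I * (fderiv ℝ g k k + 3 * n / 2 * g k) := by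
  have h : ∀ i, HasFDerivAt (fun q => g (Function.update k i q))
      ((fderiv ℝ g k).comp (.pi (Pi.single i (.id ℝ R3)))) (k i) := by
    intro i
    have h1 := hasFDerivAt_update (𝕜 := ℝ) k (i := i) (k i)
    have h2 : HasFDerivAt g (fderiv ℝ g k) (Function.update k i (k i)) := by
      rw [Function.update_eq_self]; exact (hg k).hasFDerivAt
    exact h2.comp (k i) h1
  have e : ∑ i, (ContinuousLinearMap.pi (Pi.single i (.id ℝ R3)) : R3 →L[ℝ] (Fin n → R3)) (k i) =
      k := by
    funext j
    rw [Finset.sum_apply, Finset.sum_eq_single j]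
    · simp
    · intro i _ hij
      simp [Pi.single_eq_of_ne hij.symm]
    · simp
  have h3 : ∑ i, fderiv ℝ g k ((ContinuousLinearMap.pi (Pi.single i (.id ℝ R3)) :
      R3 →L[ℝ] (Fin n → R3)) (k i)) = fderiv ℝ g k k := by
    rw [← map_sum, e]
  rw [dilExprN, ← h3]
  have h4 : ∀ i, dilExpr (fun q => g (Function.update k i q)) (k i) = Complex.I *
      (fderiv ℝ g k ((ContinuousLinearMap.pi (Pi.single i (.id ℝ R3)) :
      R3 →L[ℝ] (Fin n → R3)) (k i)) + 3 / 2 * g k) := by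
    intro i
    rw [dilExpr_eq (h i).differentiableAt, (h i).fderiv, Function.update_eq_self]
    rfl
  simp only [h4]
  rw [← Finset.mul_sum, Finset.sum_add_distrib, Finset.sum_const, Finset.card_univ,
    Fintype.card_fin, nsmul_eq_mul]
  ring

/-- The function of photon configurations given by one function of the momenta for each value of
the polarizations. -/
def ofMomenta {n : ℕ} (g : (Fin n → Fin 2) → (Fin n → R3) → ℂ) (x : Conf n) : ℂ :=
  g (fun i => (x i).2) (fun i => (x i).1)

theorem continuous_ofMomenta {n : ℕ} {g : (Fin n → Fin 2) → (Fin n → R3) → ℂ}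
    (hg : ∀ p, Continuous (g p)) : Continuous (ofMomenta g) := by
  have h : Continuous (fun z : (Fin n → Fin 2) × (Fin n → R3) => g z.1 z.2) :=
    continuous_prod_of_discrete_left.2 hg
  exact h.comp (f := fun x : Conf n => ((fun i => (x i).2, fun i => (x i).1) :
    (Fin n → Fin 2) × (Fin n → R3))) (by fun_prop)

theorem hasCompactSupport_ofMomenta {n : ℕ} {g : (Fin n → Fin 2) → (Fin n → R3) → ℂ}
    (hg : ∀ p, HasCompactSupport (g p)) : HasCompactSupport (ofMomenta g) := by
  have hK : IsCompact ((Set.univ : Set (Fin n → Fin 2)) ×ˢ ⋃ p, tsupport (g p)) :=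
    isCompact_univ.prod (isCompact_iUnion fun p => hg p)
  have hc : Continuous (fun (z : (Fin n → Fin 2) × (Fin n → R3)) (i : Fin n) => (z.2 i, z.1 i)) := by
    fun_prop
  refine HasCompactSupport.intro (hK.image hc) fun x hx => ?_
  by_contra h
  refine hx ⟨(fun i => (x i).2, fun i => (x i).1), ⟨trivial, ?_⟩, rfl⟩
  exact Set.mem_iUnion.2 ⟨_, subset_tsupport _ h⟩

instance (n : ℕ) : IsLocallyFiniteMeasure (confMeasure n) := by
  have : IsLocallyFiniteMeasure photonMeasure := by unfold photonMeasure; infer_instance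
  unfold confMeasure
  infer_instance

theorem contDiff_dilExprN {n : ℕ} {g : (Fin n → R3) → ℂ} (hg : ContDiff ℝ ∞ g) :
    Continuous (dilExprN g) := by
  have h : dilExprN g = fun k => Complex.I * (fderiv ℝ g k k + 3 * n / 2 * g k) := by
    funext k; exact dilExprN_eq (hg.differentiable (by simp)) k
  rw [h]
  have h1 : Continuous (fderiv ℝ g) := hg.continuous_fderiv (by simp)
  have h2 := hg.continuous
  fun_prop

theorem hasCompactSupport_dilExprN {n : ℕ} {g : (Fin n → R3) → ℂ} (hg : ContDiff ℝ ∞ g)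
    (hs : HasCompactSupport g) : HasCompactSupport (dilExprN g) := by
  refine HasCompactSupport.intro hs fun k hk => ?_
  rw [dilExprN_eq (hg.differentiable (by simp)), image_eq_zero_of_notMem_tsupport hk]
  have : fderiv ℝ g k = 0 := by
    by_contra h
    exact hk (tsupport_fderiv_subset ℝ (subset_tsupport _ h))
  simp [this]

theorem memLp_ofMomenta {n : ℕ} {g : (Fin n → Fin 2) → (Fin n → R3) → ℂ}
    (hg : ∀ p, Continuous (g p)) (hs : ∀ p, HasCompactSupport (g p)) :
    MemLp (ofMomenta g) 2 (confMeasure n) :=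
  (continuous_ofMomenta hg).memLp_of_hasCompactSupport (hasCompactSupport_ofMomenta hs)

theorem exists_dilTest {n : ℕ} {g : (Fin n → Fin 2) → (Fin n → R3) → ℂ}
    (hg : ∀ p, ContDiff ℝ ∞ (g p) ∧ HasCompactSupport (g p)) :
    ∃ F F' : SectorL2 n, DilTest n F F' ∧ ∀ᵐ x ∂confMeasure n, F x = ofMomenta g x := by
  have h1 := memLp_ofMomenta (fun p => (hg p).1.continuous) (fun p => (hg p).2)
  have h2 := memLp_ofMomenta (g := fun p => dilExprN (g p)) (fun p => contDiff_dilExprN (hg p).1)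
    (fun p => hasCompactSupport_dilExprN (hg p).1 (hg p).2)
  exact ⟨h1.toLp _, h2.toLp _, ⟨g, hg, h1.coeFn_toLp, h2.coeFn_toLp⟩, h1.coeFn_toLp⟩

theorem fderiv_const_mul_comp_smul {n : ℕ} {g : (Fin n → R3) → ℂ} (hg : Differentiable ℝ g) (c : ℂ)
    (a : ℝ) (k : Fin n → R3) :
    fderiv ℝ (fun k => c * g (a • k)) k k = c * fderiv ℝ g (a • k) (a • k) := by
  have h2 : HasFDerivAt (fun k : Fin n → R3 => a • k)
      (a • ContinuousLinearMap.id ℝ (Fin n → R3)) k :=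
    (a • ContinuousLinearMap.id ℝ (Fin n → R3)).hasFDerivAt
  have h3 := (((hg (a • k)).hasFDerivAt).comp k h2).const_mul c
  rw [show (fun k => c * g (a • k)) = fun k => c * (g ∘ fun k => a • k) k from rfl, h3.fderiv]
  simp

theorem dilTest_dilSec {n : ℕ} {F F' : SectorL2 n} (h : DilTest n F F') (t : ℝ) :
    DilTest n (dilSec n t F) (dilSec n t F') := by
  obtain ⟨g, hg, h1, h2⟩ := h
  have hd : ∀ p, Differentiable ℝ (g p) := fun p => (hg p).1.differentiable (by simp)
  refine ⟨fun p k => (dilFactor n t : ℂ) * g p (Real.exp (-t) • k), fun p => ⟨?_, ?_⟩, ?_, ?_⟩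
  · exact contDiff_const.mul ((hg p).1.comp (contDiff_const_smul _))
  · exact ((hg p).2.comp_homeomorph (Homeomorph.smulOfNeZero (Real.exp (-t))
      (Real.exp_ne_zero _))).mul_left
  · filter_upwards [coeFn_dilSec t F, (quasiMeasurePreserving_scale (-t)).ae h1] with x a b
    rw [a, b]; rfl
  · filter_upwards [coeFn_dilSec t F', (quasiMeasurePreserving_scale (-t)).ae h2] with x a b
    have hd2 : Differentiable ℝ (fun k => (dilFactor n t : ℂ) *
        g (fun i => (x i).2) (Real.exp (-t) • k)) :=
      (differentiable_const _).mul ((hd _).comp (differentiable_id.const_smul (Real.exp (-t)) :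
        Differentiable ℝ (fun k : Fin n → R3 => Real.exp (-t) • k)))
    rw [a, b, dilExprN_eq hd2, dilExprN_eq (hd _), fderiv_const_mul_comp_smul (hd _)]
    change _ * (Complex.I * (fderiv ℝ (g fun i => (x i).2) (Real.exp (-t) • fun i => (x i).1)
      (Real.exp (-t) • fun i => (x i).1) + _ * g (fun i => (x i).2)
      (Real.exp (-t) • fun i => (x i).1))) = _
    ring

/-- Vectors orthogonal to all test functions vanish. -/
theorem eq_zero_of_inner_dilTest {n : ℕ} {u : SectorL2 n}
    (h : ∀ F F' : SectorL2 n, DilTest n F F' → ⟪F, u⟫_ℂ = 0) : u = 0 := by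
  classical
  have key : ∀ p : Fin n → Fin 2, ∀ᵐ x ∂confMeasure n, (fun i => (x i).2) = p → u x = 0 := by
    intro p
    set A : Set (Conf n) := {x | (fun i => (x i).2) = p} with hA
    have hmp : Measurable (fun x : Conf n => fun i => (x i).2) :=
      measurable_pi_lambda _ fun i => (measurable_pi_apply i).snd
    have hmA : MeasurableSet A := hmp (measurableSet_singleton p)
    set mom : Conf n → Fin n → R3 := fun x i => (x i).1 with hmom
    have hmm : Measurable mom := measurable_pi_lambda _ fun i => (measurable_pi_apply i).fst
    -- For fixed polarizations `p` the problem moves to momentum space, where a locally integrable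
    -- function orthogonal to all smooth compactly supported functions vanishes.
    set ν := ((confMeasure n).restrict A).map mom with hν
    set ι : (Fin n → R3) → Conf n := fun k i => (k i, p i) with hι
    have hmι : Measurable ι := measurable_pi_lambda _ fun i =>
      (measurable_pi_apply i).prodMk measurable_const
    have hιm : ∀ x ∈ A, ι (mom x) = x := by
      intro x hx
      funext i
      exact Prod.ext rfl (congrFun hx i).symm
    have hνι : ν.map ι = (confMeasure n).restrict A := by
      rw [hν, Measure.map_map hmι hmm]
      conv_rhs => rw [← Measure.map_id (μ := (confMeasure n).restrict A)]
      refine Measure.map_congr ?_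
      filter_upwards [ae_restrict_mem hmA] with x hx
      exact hιm x hx
    have hql : MemLp (u ∘ ι) 2 ν := by
      refine (memLp_map_measure_iff ?_ hmι.aemeasurable).1 ?_
      · rw [hνι]; exact (Lp.aestronglyMeasurable u).restrict
      · rw [hνι]; exact (Lp.memLp u).restrict A
    have hfin : IsLocallyFiniteMeasure ν := by
      refine ⟨fun k => ⟨Metric.closedBall k 1, Metric.closedBall_mem_nhds _ one_pos, ?_⟩⟩
      rw [hν, Measure.map_apply hmm Metric.isClosed_closedBall.measurableSet]
      refine (Measure.restrict_apply_le A _).trans_lt ?_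
      have hK : IsCompact ((fun (z : (Fin n → Fin 2) × (Fin n → R3)) (i : Fin n) =>
          ((z.2 i, z.1 i) : Photon)) '' (Set.univ ×ˢ Metric.closedBall k 1)) :=
        (isCompact_univ.prod (isCompact_closedBall k 1)).image (by fun_prop)
      refine (measure_mono ?_).trans_lt hK.measure_lt_top
      intro x hx
      exact ⟨(fun i => (x i).2, mom x), ⟨trivial, hx⟩, rfl⟩
    have h0 := ae_eq_zero_of_integral_contDiff_smul_eq_zero (μ := ν) (f := u ∘ ι)
      (hql.locallyIntegrable (by norm_num)) (by
        intro φ hφ hφs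
        obtain ⟨F, F', hF, hFe⟩ := exists_dilTest (n := n)
          (g := fun q k => if q = p then (φ k : ℂ) else 0) (by
            intro q
            by_cases hq : q = p
            · simp only [hq, if_true]
              exact ⟨Complex.ofRealCLM.contDiff.comp hφ, hφs.comp_left Complex.ofReal_zero⟩
            · simp only [hq, if_false]
              exact ⟨contDiff_const, HasCompactSupport.zero⟩)
        have h3 := h F F' hF
        rw [inner_wave] at h3
        rw [hν, integral_map hmm.aemeasurable]
        · rw [← h3, ← integral_indicator hmA]
          refine integral_congr_ae ?_
          filter_upwards [hFe] with x hx
          rw [hx, ofMomenta]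
          by_cases hxA : x ∈ A
          · rw [Set.indicator_of_mem hxA, if_pos (show (fun i => (x i).2) = p from hxA), Function.comp, hιm x hxA, Complex.conj_ofReal,
              Complex.real_smul, mul_comm]
          · rw [Set.indicator_of_notMem hxA, if_neg (show ¬ (fun i => (x i).2) = p from hxA), map_zero, mul_zero]
        · rw [← hν]
          exact hφ.continuous.aestronglyMeasurable.smul hql.1)
    rw [hν] at h0
    have h4 := ae_of_ae_map hmm.aemeasurable h0
    rw [ae_restrict_iff' hmA] at h4
    filter_upwards [h4] with x hx hxp
    have := hx hxp
    rwa [Function.comp, hιm x hxp] at this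
  apply Lp.ext
  filter_upwards [ae_all_iff.2 key, Lp.coeFn_zero ℂ 2 (confMeasure n)] with x hx h0
  rw [h0, hx _ rfl]; rfl

/-- Fixes the sign convention: the dilation group is `exp (itB)`. -/
theorem hasDerivAt_dil_ofMomenta {n : ℕ} {g : (Fin n → Fin 2) → (Fin n → R3) → ℂ}
    (hg : ∀ p, ContDiff ℝ ∞ (g p)) (x : Conf n) (t : ℝ) :
    HasDerivAt (fun t : ℝ => (dilFactor n t : ℂ) * ofMomenta g (scale (-t) x))
      (Complex.I * ((dilFactor n t : ℂ) * ofMomenta (fun p => dilExprN (g p)) (scale (-t) x))) t := by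
  set p := fun i => (x i).2
  set k := fun i => (x i).1
  have hd : Differentiable ℝ (g p) := (hg p).differentiable (by simp)
  have h1 : HasDerivAt (fun t : ℝ => Real.exp (-t) • k) (-(Real.exp (-t) • k)) t := by
    have := ((hasDerivAt_neg t).exp).smul_const k
    simpa using this
  have h2 : HasDerivAt (fun t : ℝ => g p (Real.exp (-t) • k))
      (fderiv ℝ (g p) (Real.exp (-t) • k) (-(Real.exp (-t) • k))) t :=
    ((hd (Real.exp (-t) • k)).hasFDerivAt).comp_hasDerivAt t h1
  have h3 : HasDerivAt (fun t : ℝ => (dilFactor n t : ℂ)) ((-(3 * n / 2) * dilFactor n t : ℝ) : ℂ) t := by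
    have h4 : HasDerivAt (fun t : ℝ => -(3 * n * t / 2)) (-(3 * n / 2) : ℝ) t := by
      have := (((hasDerivAt_id t).const_mul (3 * n : ℝ)).div_const 2).neg
      rw [mul_one] at this
      exact this
    have h5 := h4.exp.ofReal_comp
    refine h5.congr_deriv ?_
    rw [mul_comm]
    rfl
  have h6 := h3.mul h2
  refine h6.congr_deriv ?_
  change _ = Complex.I * (_ * dilExprN (g p) (Real.exp (-t) • k))
  rw [dilExprN_eq hd, map_neg]
  push_cast
  linear_combination (-(dilFactor n t : ℂ) * (fderiv ℝ (g p) (Real.exp (-t) • k)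
    (Real.exp (-t) • k) + 3 * n / 2 * g p (Real.exp (-t) • k))) * Complex.I_mul_I

theorem continuous_scale_uncurry (n : ℕ) :
    Continuous (fun z : ℝ × Conf n => scale z.1 z.2) := by
  unfold scale
  fun_prop

/-- The derivative of the dilation group on test functions. -/
theorem hasDerivAt_inner_dilTest {n : ℕ} {F F' : SectorL2 n} (h : DilTest n F F') (u : SectorL2 n) :
    HasDerivAt (fun t : ℝ => ⟪dilSec n t F, u⟫_ℂ) ⟪Complex.I • F', u⟫_ℂ 0 := by
  obtain ⟨g, hg, h1, h2⟩ := h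
  set G := ofMomenta g with hG
  set G' := ofMomenta (fun p => dilExprN (g p)) with hG'
  have cG : Continuous G := continuous_ofMomenta fun p => (hg p).1.continuous
  have cG' : Continuous G' := continuous_ofMomenta fun p => contDiff_dilExprN (hg p).1
  have sG' : HasCompactSupport G' :=
    hasCompactSupport_ofMomenta fun p => hasCompactSupport_dilExprN (hg p).1 (hg p).2
  obtain ⟨C, hC⟩ := sG'.exists_bound_of_continuous cG'
  have hC0 : 0 ≤ C := (norm_nonneg _).trans (hC (fun _ => 0))
  -- A compact set containing the supports of the dilated functions for `|t| ≤ 1`; `u` is integrable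
  -- on it, which gives the dominating function.
  set S : Set (Conf n) := (fun z : ℝ × Conf n => scale z.1 z.2) ''
    (Set.Icc (-1) 1 ×ˢ tsupport G') with hS
  have hSc : IsCompact S := (isCompact_Icc.prod sG').image (continuous_scale_uncurry n)
  have hbound : ∀ x, ∀ t ∈ Set.Icc (-1 : ℝ) 1,
      ‖u x * (starRingEnd ℂ) (Complex.I * ((dilFactor n t : ℂ) * G' (scale (-t) x)))‖ ≤
        S.indicator (fun x => ‖u x‖ * (Real.exp (3 * n / 2) * C)) x := by
    intro x t ht
    by_cases hx : x ∈ S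
    · rw [Set.indicator_of_mem hx, norm_mul, RCLike.norm_conj, norm_mul, Complex.norm_I, one_mul,
        norm_mul, Complex.norm_real, dilFactor, Real.norm_of_nonneg (Real.exp_nonneg _)]
      have : Real.exp (-(3 * n * t / 2)) ≤ Real.exp (3 * n / 2) := by
        refine Real.exp_le_exp.2 ?_
        have : 0 ≤ (n : ℝ) * (t + 1) := mul_nonneg (by positivity) (by linarith [ht.1])
        linarith
      gcongr
      exact hC _
    · have : G' (scale (-t) x) = 0 := by
        by_contra h0
        refine hx ⟨(t, scale (-t) x), ⟨ht, subset_tsupport _ h0⟩, ?_⟩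
        change scale t (scale (-t) x) = x
        rw [scale_scale, add_neg_cancel, scale_zero]
      rw [this, Set.indicator_of_notMem hx]
      simp
  have hcs : ∀ t : ℝ, Continuous (scale t : Conf n → Conf n) := fun t =>
    (continuous_scale_uncurry n).comp (by fun_prop : Continuous fun x : Conf n => (t, x))
  have hum := Lp.aestronglyMeasurable u
  have hm : ∀ t : ℝ, AEStronglyMeasurable (fun x => u x * (starRingEnd ℂ)
      ((dilFactor n t : ℂ) * G (scale (-t) x))) (confMeasure n) := by
    intro t
    refine hum.mul (Continuous.aestronglyMeasurable ?_)
    exact Complex.continuous_conj.comp (continuous_const.mul (cG.comp (hcs _)))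
  have hd : ∀ x, ∀ t : ℝ, HasDerivAt (fun t : ℝ => u x * (starRingEnd ℂ)
      ((dilFactor n t : ℂ) * G (scale (-t) x)))
      (u x * (starRingEnd ℂ) (Complex.I * ((dilFactor n t : ℂ) * G' (scale (-t) x)))) t := by
    intro x t
    have h3 := hasDerivAt_dil_ofMomenta (fun p => (hg p).1) x t
    exact (((Complex.conjCLE : ℂ →L[ℝ] ℂ).hasFDerivAt.comp_hasDerivAt t h3)).const_mul (u x)
  have hmain := hasDerivAt_integral_of_dominated_loc_of_deriv_le (μ := confMeasure n)
    (F := fun t x => u x * (starRingEnd ℂ) ((dilFactor n t : ℂ) * G (scale (-t) x)))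
    (F' := fun t x => u x * (starRingEnd ℂ) (Complex.I * ((dilFactor n t : ℂ) * G' (scale (-t) x))))
    (x₀ := (0 : ℝ)) (s := Set.Icc (-1) 1) (bound := S.indicator
      (fun x => ‖u x‖ * (Real.exp (3 * n / 2) * C))) (Icc_mem_nhds (by norm_num) (by norm_num))
    (Filter.Eventually.of_forall hm) (by
      have hG2 : MemLp G 2 (confMeasure n) :=
        memLp_ofMomenta (fun p => (hg p).1.continuous) fun p => (hg p).2
      refine (L2.integrable_inner (𝕜 := ℂ) (hG2.toLp G) u).congr ?_
      filter_upwards [hG2.coeFn_toLp] with x hx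
      rw [hx]
      simp only [neg_zero, scale_zero, dilFactor, mul_zero, zero_div, Real.exp_zero,
        Complex.ofReal_one, one_mul]
      rfl) (by
      refine hum.mul (Continuous.aestronglyMeasurable ?_)
      exact Complex.continuous_conj.comp (continuous_const.mul
        (continuous_const.mul (cG'.comp (hcs _)))))
    (Filter.Eventually.of_forall hbound) (by
      rw [integrable_indicator_iff hSc.isClosed.measurableSet]
      have := ((Lp.memLp u).locallyIntegrable (by norm_num)).integrableOn_isCompact hSc
      exact this.norm.mul_const _)
    (Filter.Eventually.of_forall fun x t _ => hd x t)
  have e1 : (fun t : ℝ => ⟪dilSec n t F, u⟫_ℂ) = fun t => ∫ x, u x * (starRingEnd ℂ)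
      ((dilFactor n t : ℂ) * G (scale (-t) x)) ∂confMeasure n := by
    funext t
    rw [inner_wave]
    refine integral_congr_ae ?_
    filter_upwards [coeFn_dilSec t F, (quasiMeasurePreserving_scale (-t)).ae h1] with x a b
    rw [a, b]; rfl
  have e2 : ⟪Complex.I • F', u⟫_ℂ = ∫ x, u x * (starRingEnd ℂ)
      (Complex.I * ((dilFactor n 0 : ℂ) * G' (scale (-0) x))) ∂confMeasure n := by
    rw [inner_wave]
    refine integral_congr_ae ?_
    filter_upwards [Lp.coeFn_smul Complex.I F', h2] with x a b
    rw [a, Pi.smul_apply, b, neg_zero, scale_zero, smul_eq_mul]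
    simp only [dilFactor, mul_zero, zero_div, neg_zero, Real.exp_zero, Complex.ofReal_one, one_mul]
    rfl
  rw [e1, e2]
  exact hmain.2

/-! ### Strong continuity of the dilation group and its generator -/

theorem norm_isometry_sub_sq {E : Type*} [NormedAddCommGroup E] [InnerProductSpace ℂ E]
    (U : E →ₗᵢ[ℂ] E) (u : E) : ‖U u - u‖ ^ 2 = 2 * ‖u‖ ^ 2 - 2 * (⟪U u, u⟫_ℂ).re := by
  rw [@norm_sub_sq ℂ, U.norm_map]
  change _ - 2 * (⟪U u, u⟫_ℂ).re + _ = _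
  ring

/-- For isometries `‖U u - u‖² = 2‖u‖² - 2 Re ⟨U u, u⟩`, so convergence of one matrix element is
strong convergence. -/
theorem tendsto_isometry_of_inner {E : Type*} [NormedAddCommGroup E] [InnerProductSpace ℂ E]
    {U : ℝ → E →ₗᵢ[ℂ] E} {u : E}
    (h : Filter.Tendsto (fun t => ⟪U t u, u⟫_ℂ) (nhds 0) (nhds ⟪u, u⟫_ℂ)) :
    Filter.Tendsto (fun t => U t u) (nhds 0) (nhds u) := by
  rw [tendsto_iff_norm_sub_tendsto_zero]
  have h1 : Filter.Tendsto (fun t => ‖U t u - u‖ ^ 2) (nhds 0) (nhds 0) := by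
    simp only [norm_isometry_sub_sq]
    have h2 := (Complex.continuous_re.tendsto _).comp h
    have h3 := (h2.const_mul 2).const_sub (2 * ‖u‖ ^ 2)
    rw [inner_self_eq_norm_sq_to_K] at h3
    have e : 2 * ‖u‖ ^ 2 - 2 * ((‖u‖ : ℂ) ^ 2).re = 0 := by
      rw [← Complex.ofReal_pow, Complex.ofReal_re]; ring
    have h4 : Filter.Tendsto (fun t => 2 * ‖u‖ ^ 2 - 2 * (⟪U t u, u⟫_ℂ).re) (nhds 0)
      (nhds (2 * ‖u‖ ^ 2 - 2 * ((‖u‖ : ℂ) ^ 2).re)) := h3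
    rwa [e] at h4
  have h5 := h1.sqrt
  simpa [Real.sqrt_sq (norm_nonneg _)] using h5

/-! #### Strongly continuous one-parameter groups -/

section Group

variable {E : Type*} [NormedAddCommGroup E] [NormedSpace ℂ E]

theorem continuous_group_of_tendsto {U : ℝ → E →L[ℂ] E} (hadd : ∀ s t u, U s (U t u) = U (s + t) u)
    {u : E} (h : Filter.Tendsto (fun t => U t u) (nhds 0) (nhds u)) : Continuous fun t => U t u := by
  rw [continuous_iff_continuousAt]
  intro t
  have h1 : Filter.Tendsto (fun s => U (s - t) u) (nhds t) (nhds u) := by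
    refine h.comp ?_
    have : Filter.Tendsto (fun s : ℝ => s - t) (nhds t) (nhds (t - t)) :=
      (continuous_sub_right t).tendsto t
    rwa [sub_self] at this
  have h2 := ((U t).continuous.tendsto u).comp h1
  have e : (fun s => U t (U (s - t) u)) = fun s => U s u := by
    funext s; rw [hadd, add_sub_cancel]
  change Filter.Tendsto (fun s => U t (U (s - t) u)) _ _ at h2
  rw [e] at h2
  exact h2

theorem tendsto_average [CompleteSpace E] {f : ℝ → E} (hf : Continuous f) :
    Filter.Tendsto (fun r : ℝ => r⁻¹ • ∫ s in (0 : ℝ)..r, f s) (nhdsWithin 0 {0}ᶜ) (nhds (f 0)) := by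
  have h := intervalIntegral.integral_hasDerivAt_right (a := 0) (b := 0)
    (hf.intervalIntegrable _ _) (hf.stronglyMeasurableAtFilter _ _) hf.continuousAt
  rw [hasDerivAt_iff_tendsto_slope] at h
  refine h.congr fun r => ?_
  rw [slope_def_module]
  simp

theorem hasDerivAt_of_sub_eq_integral [CompleteSpace E] {f g : ℝ → E} (hf : Continuous f) {x : E}
    (h : ∀ t, g t - x = Complex.I • ∫ s in (0 : ℝ)..t, f s) :
    HasDerivAt g (Complex.I • f 0) 0 := by
  have h1 := intervalIntegral.integral_hasDerivAt_right (a := 0) (b := 0)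
    (hf.intervalIntegrable _ _) (hf.stronglyMeasurableAtFilter _ _) hf.continuousAt
  have h2 := (h1.const_smul Complex.I).const_add x
  refine h2.congr_of_eventuallyEq (Filter.Eventually.of_forall fun t => ?_)
  change g t = x + Complex.I • ∫ s in (0 : ℝ)..t, f s
  rw [← h t]
  abel

theorem hasDerivAt_comp_neg {f : ℝ → E} {f' : E} (h : HasDerivAt f f' 0) :
    HasDerivAt (fun t => f (-t)) (-f') 0 := by
  have := HasDerivAt.scomp (0 : ℝ) (g₁ := f) (h := fun s : ℝ => -s) (by rw [neg_zero]; exact h)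
    (hasDerivAt_neg 0)
  rw [neg_smul, one_smul] at this
  exact this

/-- Translating the average by `t` only moves the endpoints of the integral, so averages lie in the
domain of the generator. -/
theorem hasDerivAt_group_average [CompleteSpace E] {U : ℝ → E →L[ℂ] E}
    (hadd : ∀ s t u, U s (U t u) = U (s + t) u) (h0 : ∀ u, U 0 u = u)
    (hc : ∀ u, Continuous fun t => U t u) (r : ℝ) (u : E) :
    HasDerivAt (fun t => U t (r⁻¹ • ∫ s in (0 : ℝ)..r, U s u)) (r⁻¹ • (U r u - u)) 0 := by
  have hii : ∀ a b, IntervalIntegrable (fun s => U s u) volume a b := fun a b =>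
    (hc u).intervalIntegrable _ _
  have e : ∀ t, U t (r⁻¹ • ∫ s in (0 : ℝ)..r, U s u) =
      r⁻¹ • ((∫ s in (0 : ℝ)..(t + r), U s u) - ∫ s in (0 : ℝ)..t, U s u) := by
    intro t
    have h1 : U t (r⁻¹ • ∫ s in (0 : ℝ)..r, U s u) = r⁻¹ • U t (∫ s in (0 : ℝ)..r, U s u) :=
      ((U t).restrictScalars ℝ).map_smul r⁻¹ _
    rw [h1, ← (U t).intervalIntegral_comp_comm (hii 0 r),
      intervalIntegral.integral_interval_sub_left (hii _ _) (hii _ _)]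
    simp only [hadd]
    rw [intervalIntegral.integral_comp_add_left (fun s => U s u) t, add_zero]
  have hd : ∀ t, HasDerivAt (fun t => ∫ s in (0 : ℝ)..t, U s u) (U t u) t := fun t =>
    intervalIntegral.integral_hasDerivAt_right (hii 0 t)
      ((hc u).stronglyMeasurableAtFilter _ _) (hc u).continuousAt
  have hd1 : HasDerivAt (fun t => ∫ s in (0 : ℝ)..(t + r), U s u) (U r u) 0 := by
    have h3 := HasDerivAt.scomp (0 : ℝ) (g₁ := fun t => ∫ s in (0 : ℝ)..t, U s u)
      (h := fun t : ℝ => t + r) (by rw [zero_add]; exact hd r) ((hasDerivAt_id (0 : ℝ)).add_const r)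
    rw [one_smul] at h3
    exact h3
  have hd0 := hd 0
  rw [h0] at hd0
  exact ((hd1.sub hd0).const_smul r⁻¹).congr_of_eventuallyEq (Filter.Eventually.of_forall e)

end Group

/-- On test functions the weak derivative gives continuity; density of their span and isometry
extend it to all vectors. -/
theorem tendsto_dilSec {n : ℕ} (u : SectorL2 n) :
    Filter.Tendsto (fun t => dilSec n t u) (nhds 0) (nhds u) := by
  set K := Submodule.span ℂ {F : SectorL2 n | ∃ F', DilTest n F F'} with hK
  have hd : K.topologicalClosure = ⊤ := by
    rw [Submodule.topologicalClosure_eq_top_iff, Submodule.eq_bot_iff]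
    intro v hv
    exact eq_zero_of_inner_dilTest fun F F' hF => hv F (Submodule.subset_span ⟨F', hF⟩)
  have hk : ∀ v ∈ K, Filter.Tendsto (fun t => dilSec n t v) (nhds 0) (nhds v) := by
    intro v hv
    induction hv using Submodule.span_induction with
    | mem F hF =>
      obtain ⟨F', hF'⟩ := hF
      refine tendsto_isometry_of_inner ?_
      have := (hasDerivAt_inner_dilTest hF' F).continuousAt.tendsto
      rwa [dilSec_zero] at this
    | zero => simpa only [map_zero] using tendsto_const_nhds
    | add x y _ _ hx hy => simpa only [map_add] using hx.add hy
    | smul c x _ hx => simpa only [map_smul] using hx.const_smul c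
  rw [Metric.tendsto_nhds]
  intro ε hε
  have hu : u ∈ closure (K : Set (SectorL2 n)) := by
    rw [← Submodule.topologicalClosure_coe, hd]; trivial
  obtain ⟨v, hv, hvu⟩ := Metric.mem_closure_iff.1 hu (ε / 3) (by positivity)
  filter_upwards [Metric.tendsto_nhds.1 (hk v hv) (ε / 3) (by positivity)] with t ht
  calc dist (dilSec n t u) u ≤ dist (dilSec n t u) (dilSec n t v) + dist (dilSec n t v) v + dist v u :=
        dist_triangle4 _ _ _ _
    _ < ε / 3 + ε / 3 + ε / 3 := by
        rw [(dilSec n t).dist_map, dist_comm v u]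
        linarith
    _ = ε := by ring

theorem continuous_dilSec {n : ℕ} (u : SectorL2 n) : Continuous fun t => dilSec n t u :=
  continuous_group_of_tendsto (U := fun t => (dilSec n t).toContinuousLinearMap) dilSec_add
    (tendsto_dilSec u)

theorem continuous_dil (u : Fock) : Continuous fun t => dil t u := by
  have h0 : Filter.Tendsto (fun t => dil t u) (nhds 0) (nhds u) := by
    refine tendsto_isometry_of_inner ?_
    have hc : Continuous fun t => ⟪dil t u, u⟫_ℂ := by
      simp only [inner_eq_tsum_wave, wave_dil]
      refine continuous_tsum (u := fun n => ‖u n‖ ^ 2)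
        (fun n => (continuous_dilSec _).inner continuous_const) ?_ fun n t => ?_
      · have := (lp.memℓp u).summable (by norm_num)
        simpa using this
      · refine (norm_inner_le_norm (𝕜 := ℂ) _ _).trans_eq ?_
        rw [(dilSec n t).norm_map, sq]
        rfl
    have := hc.tendsto 0
    rwa [dil_zero] at this
  exact continuous_group_of_tendsto (U := fun t => (dil t).toContinuousLinearMap) dil_add h0

/-- Pairing of the `n`-photon wave function with a fixed function. -/
def waveInner {n : ℕ} (F : SectorL2 n) : Fock →L[ℂ] ℂ :=
  LinearMap.mkContinuous
    { toFun := fun v => ⟪F, wave v n⟫_ℂ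
      map_add' := fun u v => by rw [wave_add, inner_add_right]
      map_smul' := fun c v => by rw [wave_smul, inner_smul_right]; rfl } ‖F‖ fun v =>
    (norm_inner_le_norm (𝕜 := ℂ) F (wave v n)).trans
      (mul_le_mul_of_nonneg_left (lp.norm_apply_le_norm (by norm_num) v n) (norm_nonneg F))

theorem waveInner_apply {n : ℕ} (F : SectorL2 n) (v : Fock) : waveInner F v = ⟪F, wave v n⟫_ℂ := rfl

theorem fock_ext_dilTest {u v : Fock}
    (h : ∀ n (F F' : SectorL2 n), DilTest n F F' → waveInner F u = waveInner F v) : u = v := by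
  refine wave_ext fun n => sub_eq_zero.1 (eq_zero_of_inner_dilTest fun F F' hF => ?_)
  rw [inner_sub_right, sub_eq_zero]
  exact h n F F' hF

theorem hasDerivAt_waveInner_dil {u w : Fock} (h : (u, w) ∈ dilGraph) {n : ℕ} {F F' : SectorL2 n}
    (hF : DilTest n F F') (t : ℝ) :
    HasDerivAt (fun s => waveInner F (dil s u)) (Complex.I * waveInner F (dil t w)) t := by
  have h1 := hasDerivAt_inner_dilTest (dilTest_dilSec hF (-t)) (wave u n)
  have h2 : HasDerivAt (fun s : ℝ => -(s - t)) (-1 : ℝ) t :=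
    ((hasDerivAt_id t).sub_const t).neg
  have h3 := HasDerivAt.scomp t (g₁ := fun s => ⟪dilSec n s (dilSec n (-t) F), wave u n⟫_ℂ)
    (h := fun s => -(s - t)) (by rw [sub_self, neg_zero]; exact h1) h2
  have e : (fun s => waveInner F (dil s u)) =
      (fun s => ⟪dilSec n s (dilSec n (-t) F), wave u n⟫_ℂ) ∘ fun s => -(s - t) := by
    funext s
    rw [Function.comp, dilSec_add, inner_dilSec, waveInner_apply, wave_dil]
    congr 3; ring
  rw [e]
  refine h3.congr_deriv ?_
  rw [inner_smul_left, h n _ _ (dilTest_dilSec hF (-t)), inner_dilSec, neg_neg, waveInner_apply,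
    wave_dil, Complex.conj_I]
  simp

/-- Dilations preserve test functions, so the weak relation `B u = w` differentiates each pairing at
every `t`. Integration and separation by test functions turn this into a strong identity. -/
theorem dil_sub_eq_integral {u w : Fock} (h : (u, w) ∈ dilGraph) (t : ℝ) :
    dil t u - u = Complex.I • ∫ s in (0 : ℝ)..t, dil s w := by
  refine fock_ext_dilTest fun n F F' hF => ?_
  have hc : Continuous fun s => waveInner F (dil s w) := (waveInner F).continuous.comp (continuous_dil w)
  have h1 := intervalIntegral.integral_eq_sub_of_hasDerivAt (a := 0) (b := t)
    (fun s _ => hasDerivAt_waveInner_dil h hF s) ((hc.const_mul Complex.I).intervalIntegrable _ _)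
  rw [map_smul, ← ContinuousLinearMap.intervalIntegral_comp_comm _
    ((continuous_dil w).intervalIntegrable _ _), map_sub, smul_eq_mul,
    ← intervalIntegral.integral_const_mul, h1, dil_zero]

theorem hasDerivAt_dil {u w : Fock} (h : (u, w) ∈ dilGraph) :
    HasDerivAt (fun t => dil t u) (Complex.I • w) 0 := by
  have h1 := hasDerivAt_of_sub_eq_integral (continuous_dil w) (dil_sub_eq_integral h)
  rwa [dil_zero] at h1

theorem mem_dilGraph_of_hasDerivAt {u w : Fock}
    (h : HasDerivAt (fun t => dil t u) (Complex.I • w) 0) : (u, w) ∈ dilGraph := by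
  intro n F F' hF
  have h1 := hasDerivAt_inner_dilTest hF (wave u n)
  have h2 := hasDerivAt_comp_neg h
  have h3 : HasDerivAt (fun t => waveInner F (dil (-t) u)) (waveInner F (-(Complex.I • w))) 0 :=
    (((waveInner F).restrictScalars ℝ).hasFDerivAt).comp_hasDerivAt 0 h2
  have e : (fun t => waveInner F (dil (-t) u)) = fun t => ⟪dilSec n t F, wave u n⟫_ℂ := by
    funext t
    rw [inner_dilSec]; rfl
  rw [e] at h3
  have h4 := h1.unique h3
  rw [map_neg, map_smul, waveInner_apply, inner_smul_left, Complex.conj_I, smul_eq_mul] at h4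
  have h5 : Complex.I * (⟪F', wave u n⟫_ℂ - ⟪F, wave w n⟫_ℂ) = 0 := by linear_combination -h4
  exact sub_eq_zero.1 ((mul_eq_zero.1 h5).resolve_left Complex.I_ne_zero)

/-- The weak relation is single-valued because `w` is determined by the derivative of the dilation
group at `u`. -/
theorem dilationGen_graph : dilationGen.graph = dilGraph := by
  apply Submodule.toLinearPMap_graph_eq
  rintro ⟨u, v⟩ h (rfl : u = 0)
  have h1 := hasDerivAt_dil h
  simp only [map_zero] at h1
  have h2 := h1.unique (hasDerivAt_const (0 : ℝ) (0 : Fock))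
  exact (smul_eq_zero.1 h2).resolve_left Complex.I_ne_zero

/-- The average of a vector over dilations by `s ∈ [0, r]`. -/
def dilAverage (r : ℝ) (u : Fock) : Fock := (r⁻¹ : ℝ) • ∫ s in (0 : ℝ)..r, dil s u

theorem dilAverage_mem (r : ℝ) (u : Fock) : dilAverage r u ∈ dilationGen.domain := by
  set w := (-Complex.I) • ((r⁻¹ : ℝ) • (dil r u - u)) with hw
  suffices h : (dilAverage r u, w) ∈ dilationGen.graph from
    LinearPMap.mem_domain_iff.2 ⟨w, h⟩
  rw [dilationGen_graph]
  apply mem_dilGraph_of_hasDerivAt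
  have h := hasDerivAt_group_average (U := fun t => (dil t).toContinuousLinearMap) dil_add dil_zero
    continuous_dil r u
  refine h.congr_deriv ?_
  rw [hw, smul_smul, mul_neg, Complex.I_mul_I, neg_neg, one_smul]
  rfl

/-! ### One-photon vectors -/

theorem measurePreserving_one : MeasurePreserving (MeasurableEquiv.funUnique (Fin 1) Photon)
    (confMeasure 1) photonMeasure :=
  measurePreserving_funUnique photonMeasure (Fin 1)

theorem ae_one {p : Photon → Prop} (h : ∀ᵐ y ∂photonMeasure, p y) :
    ∀ᵐ x ∂confMeasure 1, p (x 0) :=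
  measurePreserving_one.quasiMeasurePreserving.ae h

/-- `u` is the vector of the one-photon sector with wave function `f`. -/
structure IsSingle (f : Photon → ℂ) (u : Fock) : Prop where
  zero : ∀ n, n ≠ 1 → wave u n = 0
  one : ∀ᵐ x ∂confMeasure 1, wave u 1 x = f (x 0)

theorem IsSingle.unique {f g : Photon → ℂ} {u v : Fock} (hu : IsSingle f u) (hv : IsSingle g v)
    (h : ∀ᵐ y ∂photonMeasure, f y = g y) : u = v := by
  refine wave_ext fun n => ?_
  by_cases hn : n = 1
  · subst hn
    apply Lp.ext
    filter_upwards [hu.one, hv.one, ae_one h] with x h1 h2 h3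
    rw [h1, h2, h3]
  · rw [hu.zero n hn, hv.zero n hn]

theorem exists_single {f : Photon → ℂ} (hf : MemLp f 2 photonMeasure) : ∃ u, IsSingle f u := by
  obtain ⟨u, hu⟩ := exists_fock (fun n x => if h : n = 1 then f (x ⟨0, by omega⟩) else 0) (by
      intro n
      by_cases hn : n = 1
      · subst hn
        exact hf.1.comp_quasiMeasurePreserving measurePreserving_one.quasiMeasurePreserving
      · simp only [hn, dif_neg, not_false_iff]
        exact aestronglyMeasurable_const) (by
      intro n p
      by_cases hn : n = 1
      · subst hn
        refine Filter.Eventually.of_forall fun x => ?_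
        simp only [dif_pos]
        rw [Subsingleton.elim (p _) _]
      · simp [hn]) (by
      rw [tsum_eq_single 1]
      · have h2 := (memLp_two_iff_integrable_sq_norm hf.1).1 hf
        have h3 := h2.2
        rw [hasFiniteIntegral_iff_ofReal (Filter.Eventually.of_forall fun y => by positivity)] at h3
        have h4 := measurePreserving_one.lintegral_comp_emb
          (MeasurableEquiv.measurableEmbedding _) fun y => ENNReal.ofReal (‖f y‖ ^ 2)
        rw [← h4] at h3
        exact h3.ne
      · intro n hn
        simp [hn])
  refine ⟨u, fun n hn => ?_, ?_⟩
  · apply Lp.ext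
    filter_upwards [hu n, Lp.coeFn_zero ℂ 2 (confMeasure n)] with x h1 h2
    rw [h1, h2, dif_neg hn]; rfl
  · filter_upwards [hu 1] with x h1
    rw [h1, dif_pos rfl]; rfl

theorem IsSingle.sub {f g : Photon → ℂ} {u v : Fock} (hu : IsSingle f u) (hv : IsSingle g v) :
    IsSingle (f - g) (u - v) := by
  have hw : ∀ n, wave (u - v) n = wave u n - wave v n := fun _ => rfl
  refine ⟨fun n hn => by rw [hw, hu.zero n hn, hv.zero n hn, sub_zero], ?_⟩
  filter_upwards [hu.one, hv.one, Lp.coeFn_sub (wave u 1) (wave v 1)] with x h1 h2 h3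
  rw [hw, h3, Pi.sub_apply, h1, h2, Pi.sub_apply]

theorem IsSingle.smul {f : Photon → ℂ} {u : Fock} (hu : IsSingle f u) (c : ℂ) :
    IsSingle (c • f) (c • u) := by
  refine ⟨fun n hn => by rw [wave_smul, hu.zero n hn, smul_zero], ?_⟩
  filter_upwards [hu.one, Lp.coeFn_smul c (wave u 1)] with x h1 h3
  rw [wave_smul, h3, Pi.smul_apply, h1, Pi.smul_apply]

theorem IsSingle.dil {f : Photon → ℂ} {u : Fock} (hu : IsSingle f u) (t : ℝ) :
    IsSingle (dilPhoton t f) (dil t u) := by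
  refine ⟨fun n hn => by rw [wave_dil, hu.zero n hn, map_zero], ?_⟩
  filter_upwards [coeFn_dilSec t (wave u 1), (quasiMeasurePreserving_scale (-t)).ae hu.one]
    with x h1 h2
  rw [wave_dil, h1, h2, dilPhoton, dilFactor, Nat.cast_one, mul_one]
  rfl

theorem IsSingle.mul {f : Photon → ℂ} {u v : Fock} (hu : IsSingle f u) {r : ∀ n, Conf n → ℝ}
    (h : (u, v) ∈ mulGraph r) : IsSingle (fun y => (r 1 (fun _ => y) : ℂ) * f y) v := by
  refine ⟨fun n hn => ?_, ?_⟩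
  · apply Lp.ext
    filter_upwards [h n, Lp.coeFn_zero ℂ 2 (confMeasure n)] with x h1 h2
    rw [h1, hu.zero n hn, h2]
    simp
  · filter_upwards [h 1, hu.one] with x h1 h2
    rw [h1, h2]
    have : x = fun _ => x 0 := by funext i; rw [Subsingleton.elim i 0]
    conv_lhs => rw [this]

theorem IsSingle.lintegral {f : Photon → ℂ} {u : Fock} (hu : IsSingle f u) :
    ENNReal.ofReal (‖u‖ ^ 2) = ∫⁻ y, ENNReal.ofReal (‖f y‖ ^ 2) ∂photonMeasure := by
  rw [← wsq_one, wsq, tsum_eq_single 1]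
  · rw [← measurePreserving_one.lintegral_comp_emb (MeasurableEquiv.measurableEmbedding _)]
    refine lintegral_congr_ae ?_
    filter_upwards [hu.one] with x h1
    rw [h1, one_mul]; rfl
  · intro n hn
    rw [lintegral_eq_zero_iff' (by
      exact (((aemeasurable_wave u n).norm.aemeasurable.pow_const 2).const_mul 1).ennreal_ofReal)]
    filter_upwards [Lp.coeFn_zero ℂ 2 (confMeasure n)] with x h2
    rw [hu.zero n hn, h2]
    simp

/-- The coupling of one photon to the weight `1 + |k|⁻¹` through two one-photon vectors. -/
theorem photonNormSq_eq {f : Photon → ℂ} (hf : AEStronglyMeasurable f photonMeasure) {u v : Fock}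
    (hu : IsSingle f u) (hv : IsSingle (fun y => ((Real.sqrt ‖y.1‖)⁻¹ : ℂ) * f y) v) :
    photonNormSq f = ENNReal.ofReal (‖u‖ ^ 2) + ENNReal.ofReal (‖v‖ ^ 2) := by
  rw [hu.lintegral, hv.lintegral, photonNormSq, ← lintegral_add_left' (by
    exact (hf.norm.aemeasurable.pow_const 2).ennreal_ofReal)]
  refine lintegral_congr fun y => ?_
  rw [← ENNReal.ofReal_add (by positivity) (by positivity), norm_mul, mul_pow, norm_inv, inv_pow,
    Complex.norm_real, Real.norm_of_nonneg (Real.sqrt_nonneg _), Real.sq_sqrt (norm_nonneg _)]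
  congr 1; ring

/-- The weak derivative of a one-photon function, as a relation in Fock space. -/
theorem dilGraph_of_weakDil {f g : Photon → ℂ} (h : WeakDil f g) {u w : Fock} (hu : IsSingle f u)
    (hw : IsSingle g w) : (u, w) ∈ dilGraph := by
  intro n F F' hF
  by_cases hn : n = 1
  swap
  · change ⟪F', wave u n⟫_ℂ = ⟪F, wave w n⟫_ℂ
    rw [hu.zero n hn, hw.zero n hn, inner_zero_right, inner_zero_right]
  subst hn
  obtain ⟨G, hG, h1, h2⟩ := hF
  have hx : ∀ x : Conf 1, x = fun _ => x 0 := fun x => by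
    funext i; rw [Subsingleton.elim i 0]
  let T : Fin 2 → R3 → ℂ := fun lam q => G (fun _ => lam) (fun _ => q)
  have hT : ∀ lam, ContDiff ℝ ∞ (T lam) ∧ HasCompactSupport (T lam) := fun lam =>
    ⟨(hG _).1.comp (ContinuousLinearEquiv.funUnique (Fin 1) ℝ R3).symm.contDiff,
      (hG _).2.comp_homeomorph (ContinuousLinearEquiv.funUnique (Fin 1) ℝ R3).symm.toHomeomorph⟩
  have key : ∀ (f' : Photon → ℂ) (S : Fin 2 → R3 → ℂ) (u' : Fock) (F₀ : SectorL2 1),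
      IsSingle f' u' → (∀ᵐ x ∂confMeasure 1, F₀ x = S (x 0).2 (x 0).1) →
      ⟪F₀, wave u' 1⟫_ℂ = ∫ lam, (∫ k, starRingEnd ℂ (S lam k) * f' (k, lam)) ∂Measure.count := by
    intro f' S u' F₀ hu' hF₀
    have hi := L2.integrable_inner (𝕜 := ℂ) F₀ (wave u' 1)
    have e : (fun x => ⟪F₀ x, wave u' 1 x⟫_ℂ) =ᵐ[confMeasure 1]
        (fun y : Photon => starRingEnd ℂ (S y.2 y.1) * f' y) ∘
          MeasurableEquiv.funUnique (Fin 1) Photon := by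
      filter_upwards [hu'.one, hF₀] with x a b
      rw [a, b]
      exact mul_comm _ _
    rw [L2.inner_def, integral_congr_ae e]
    have hi2 := (measurePreserving_one.integrable_comp_emb
      (MeasurableEquiv.measurableEmbedding _)).1 (hi.congr e)
    have e3 := measurePreserving_one.integral_comp (MeasurableEquiv.measurableEmbedding _)
      (fun y : Photon => starRingEnd ℂ (S y.2 y.1) * f' y)
    rw [photonMeasure] at e3 hi2
    exact e3.trans (integral_prod_symm _ hi2)
  change ⟪F', wave u 1⟫_ℂ = ⟪F, wave w 1⟫_ℂ
  rw [key f (fun lam => dilExpr (T lam)) u F' hu ?_, key g T w F hw ?_]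
  · exact integral_congr_ae (Filter.Eventually.of_forall fun lam => h lam (T lam) (hT lam).1 (hT lam).2)
  · filter_upwards [h1] with x a
    rw [a]
    conv_lhs => rw [hx x]
  · filter_upwards [h2] with x a
    rw [a, dilExprN, Fin.sum_univ_one]
    have e : (fun q => G (fun i => (x i).2) (Function.update (fun i => (x i).1) 0 q)) =
        T (x 0).2 := by
      funext q
      have e1 : (fun i => (x i).2) = fun _ : Fin 1 => (x 0).2 := by
        funext i; rw [Subsingleton.elim i 0]
      have e2 : Function.update (fun i => (x i).1) 0 q = fun _ : Fin 1 => q := by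
        funext i; rw [Subsingleton.elim i 0, Function.update_self]
      rw [e1, e2]
    rw [e]

/-- The weight `|k|^{1/2} / (1 + |k|)`, with value one in the vacuum sector. -/
def sqrtWeight (n : ℕ) (x : Conf n) : ℝ :=
  -- `ω` vanishes identically in the vacuum sector; the value one there keeps the multiplication
  -- injective.
  if n = 0 then 1 else Real.sqrt (omega n x) / (1 + omega n x)

theorem symWeight_sqrtWeight : SymWeight sqrtWeight := by
  have h : SymWeight fun n x => Real.sqrt (omega n x) / (1 + omega n x) :=
    symWeight_comp symWeight_omega (φ := fun s => Real.sqrt s / (1 + s)) (by fun_prop)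
  refine ⟨fun n => ?_, fun n p x => ?_⟩
  · by_cases hn : n = 0
    · have : sqrtWeight n = fun _ => 1 := by funext x; simp [sqrtWeight, hn]
      rw [this]; exact measurable_const
    · have : sqrtWeight n = fun x => Real.sqrt (omega n x) / (1 + omega n x) := by
        funext x; simp [sqrtWeight, hn]
      rw [this]
      exact h.1 n
  · unfold sqrtWeight
    split_ifs
    · rfl
    · exact h.2 n p x

theorem abs_sqrtWeight_le (n : ℕ) (x : Conf n) : |sqrtWeight n x| ≤ 1 := by
  unfold sqrtWeight
  split_ifs
  · simp
  · have h := omega_nonneg n x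
    rw [abs_of_nonneg (by positivity), div_le_one (by positivity)]
    nlinarith [Real.sq_sqrt h, Real.sqrt_nonneg (omega n x), sq_nonneg (Real.sqrt (omega n x) - 1)]

theorem eq_zero_of_mulGraph_sqrtWeight {u : Fock} (h : (u, 0) ∈ mulGraph sqrtWeight) : u = 0 := by
  refine wave_ext fun n => ?_
  apply Lp.ext
  filter_upwards [h n, ae_conf_ne_zero n, Lp.coeFn_zero ℂ 2 (confMeasure n)] with x h1 h2 h3
  rw [wave_zero, h3] at h1 ⊢
  refine (mul_eq_zero.1 h1.symm).resolve_left ?_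
  refine Complex.ofReal_ne_zero.2 ?_
  unfold sqrtWeight
  split_ifs with hn
  · exact one_ne_zero
  · have h0 : 0 < omega n x :=
      Finset.sum_pos (fun i _ => norm_pos_iff.2 (h2 i)) ⟨⟨0, Nat.pos_of_ne_zero hn⟩, Finset.mem_univ _⟩
    positivity

theorem omega_one (y : Photon) : omega 1 (fun _ => y) = ‖y.1‖ := by simp [omega]

/-- The function `|k|^{-1/2} f`. -/
def infraredWeighted (f : Photon → ℂ) (y : Photon) : ℂ := ((Real.sqrt ‖y.1‖)⁻¹ : ℂ) * f y

theorem infraredWeighted_dilPhoton (t : ℝ) (f : Photon → ℂ) :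
    infraredWeighted (dilPhoton t f) =
      (Real.exp (-(t / 2)) : ℂ) • dilPhoton t (infraredWeighted f) := by
  funext y
  simp only [infraredWeighted, dilPhoton, Pi.smul_apply, smul_eq_mul, norm_smul]
  rw [Real.norm_of_nonneg (Real.exp_nonneg _), Real.sqrt_mul (Real.exp_nonneg _),
    ← Real.exp_half, Complex.ofReal_mul, mul_inv]
  have h : (Real.exp (-t / 2) : ℂ) ≠ 0 := Complex.ofReal_ne_zero.2 (Real.exp_ne_zero _)
  have e : -(t / 2) = -t / 2 := by ring
  rw [e]
  field_simp

/-- `|k|^{-1/2}` intertwines the dilation group with its rescaling by `exp (-t/2)`, but is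
unbounded. The integral identity is therefore checked after multiplication by the injective bounded
weight `|k|^{1/2} / (1 + |k|)`, where it becomes the known identity for `f` multiplied by `(1 +
|k|)⁻¹`. -/
theorem hasDerivAt_infraredWeighted {f g : Photon → ℂ} (h : WeakDil f g)
    {u w u' w' : Fock} (hu : IsSingle f u) (hw : IsSingle g w)
    (hu' : IsSingle (infraredWeighted f) u') (hw' : IsSingle (infraredWeighted g) w') :
    HasDerivAt (fun t => (Real.exp (-(t / 2)) : ℂ) • dil t u') (Complex.I • w') 0 := by
  obtain ⟨M, hM⟩ := exists_mulCLM symWeight_sqrtWeight abs_sqrtWeight_le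
  obtain ⟨X, hX⟩ := exists_mulCLM (r := fun n x => (1 + omega n x)⁻¹)
    (symWeight_comp symWeight_omega (φ := fun s => (1 + s)⁻¹) (by fun_prop)) (by
      intro n x
      have := omega_nonneg n x
      rw [abs_of_nonneg (by positivity)]
      exact inv_le_one_of_one_le₀ (by linarith))
  have key : ∀ (F : Photon → ℂ) (a a' : Fock), IsSingle F a → IsSingle (infraredWeighted F) a' →
      ∀ t, M ((Real.exp (-(t / 2)) : ℂ) • dil t a') = X (dil t a) := by
    intro F a a' ha ha' t
    have h1 := ((ha'.dil t).smul (Real.exp (-(t / 2)) : ℂ)).mul (hM _)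
    rw [← infraredWeighted_dilPhoton] at h1
    refine h1.unique ((ha.dil t).mul (hX _)) ?_
    filter_upwards [ae_photon_ne_zero] with y hy
    have hp : 0 < ‖y.1‖ := norm_pos_iff.2 hy
    have hs : (Real.sqrt ‖y.1‖ : ℂ) ≠ 0 := Complex.ofReal_ne_zero.2 (Real.sqrt_pos.2 hp).ne'
    simp only [infraredWeighted, sqrtWeight, one_ne_zero, if_false, omega_one]
    rw [div_eq_mul_inv]
    push_cast
    field_simp
  have hc : Continuous fun s : ℝ => (Real.exp (-(s / 2)) : ℂ) • dil s w' :=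
    (Complex.continuous_ofReal.comp (by fun_prop : Continuous fun s : ℝ => Real.exp (-(s / 2)))).smul
      (continuous_dil w')
  have hmain := hasDerivAt_of_sub_eq_integral (g := fun t => (Real.exp (-(t / 2)) : ℂ) • dil t u')
    (x := u') hc (by
      intro t
      rw [← sub_eq_zero]
      apply eq_zero_of_mulGraph_sqrtWeight
      set J := ∫ s in (0 : ℝ)..t, (Real.exp (-(s / 2)) : ℂ) • dil s w' with hJ
      have hMJ : M J = X (∫ s in (0 : ℝ)..t, dil s w) := by
        rw [hJ, ← M.intervalIntegral_comp_comm (hc.intervalIntegrable _ _),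
          ← X.intervalIntegral_comp_comm ((continuous_dil w).intervalIntegrable _ _)]
        simp only [key g w w' hw hw']
      have h4 := key f u u' hu hu' 0
      rw [zero_div, neg_zero, Real.exp_zero, Complex.ofReal_one, one_smul, dil_zero, dil_zero] at h4
      have h3 := hM ((Real.exp (-(t / 2)) : ℂ) • dil t u' - u' - Complex.I • J)
      have h5 : M ((Real.exp (-(t / 2)) : ℂ) • dil t u' - u' - Complex.I • J) = 0 := by
        rw [M.map_sub, M.map_sub, key f u u' hu hu', h4, M.map_smul, hMJ, ← X.map_sub,
          dil_sub_eq_integral (dilGraph_of_weakDil h hu hw), X.map_smul, sub_self]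
      rwa [h5] at h3)
  have e : (Real.exp (-((0 : ℝ) / 2)) : ℂ) • dil 0 w' = w' := by
    rw [dil_zero, zero_div, neg_zero, Real.exp_zero, Complex.ofReal_one, one_smul]
  rwa [e] at hmain

theorem infraredWeighted_sub (f g : Photon → ℂ) :
    infraredWeighted (f - g) = infraredWeighted f - infraredWeighted g := by
  funext y; simp [infraredWeighted, mul_sub]

theorem infraredWeighted_smul (c : ℂ) (f : Photon → ℂ) :
    infraredWeighted (c • f) = c • infraredWeighted f := by
  funext y; simp only [infraredWeighted, Pi.smul_apply, smul_eq_mul]; ring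

/-- Differentiability of dilations of a form factor in the norm that controls field operators. -/
theorem tendsto_photonNormSq_dil {f g : Photon → ℂ} (h : WeakDil f g)
    (hf : MemLp f 2 photonMeasure) (hg : MemLp g 2 photonMeasure)
    (hf' : MemLp (infraredWeighted f) 2 photonMeasure)
    (hg' : MemLp (infraredWeighted g) 2 photonMeasure) :
    Filter.Tendsto (fun t : ℝ => photonNormSq (((t⁻¹ : ℝ) : ℂ) • (dilPhoton t f - f) -
      Complex.I • g)) (nhdsWithin 0 {0}ᶜ) (nhds 0) := by
  obtain ⟨u, hu⟩ := exists_single hf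
  obtain ⟨w, hw⟩ := exists_single hg
  obtain ⟨u', hu'⟩ := exists_single hf'
  obtain ⟨w', hw'⟩ := exists_single hg'
  have h1 := hasDerivAt_dil (dilGraph_of_weakDil h hu hw)
  have h2 := hasDerivAt_infraredWeighted h hu hw hu' hw'
  rw [hasDerivAt_iff_tendsto_slope] at h1 h2
  have h3 := ((h1.sub_const (Complex.I • w)).norm.pow 2)
  have h4 := ((h2.sub_const (Complex.I • w')).norm.pow 2)
  have h5 := (ENNReal.tendsto_ofReal h3).add (ENNReal.tendsto_ofReal h4)
  rw [sub_self, sub_self, norm_zero, zero_pow two_ne_zero, ENNReal.ofReal_zero, add_zero] at h5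
  refine h5.congr fun t => ?_
  have hm : AEStronglyMeasurable (((t⁻¹ : ℝ) : ℂ) • (dilPhoton t f - f) - Complex.I • g)
      photonMeasure :=
    (((aestronglyMeasurable_dilPhoton hf.1 t).sub hf.1).const_smul _).sub (hg.1.const_smul _)
  have s1 := (((hu.dil t).sub hu).smul ((t⁻¹ : ℝ) : ℂ)).sub (hw.smul Complex.I)
  have s2 := ((((hu'.dil t).smul (Real.exp (-(t / 2)) : ℂ)).sub hu').smul ((t⁻¹ : ℝ) : ℂ)).sub
    (hw'.smul Complex.I)
  rw [← infraredWeighted_dilPhoton, ← infraredWeighted_sub, ← infraredWeighted_smul,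
    ← infraredWeighted_smul, ← infraredWeighted_sub] at s2
  rw [photonNormSq_eq hm s1 s2, slope_def_module, slope_def_module, dil_zero, dil_zero, zero_div,
    neg_zero, Real.exp_zero, Complex.ofReal_one, one_smul, sub_zero]
  rfl

/-! ### Dependence of field operators on the form factor -/

/-- `u` is already known to lie in the domain of `a(f)`, so the adjoint identity need only hold on a
dense set to identify the image. For a linear combination of form factors the individual creation
operators are available on this core. -/
theorem mem_annihilation_graph_of_core {f : Photon → ℂ} (hf : AEStronglyMeasurable f photonMeasure)
    (hfin : photonNormSq f ≠ ⊤) {u d : Fock} (hu : wsq omega u ≠ ⊤)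
    (h : ∀ w w', wsq (fun n x => 1 + omega n x) w ≠ ⊤ → (w, w') ∈ creationGraph f →
      ⟪d, w⟫_ℂ = ⟪u, w'⟫_ℂ) : (u, d) ∈ (annihilation f).graph := by
  obtain ⟨d', hd'⟩ := exists_annihilation hf hfin hu
  suffices e : d = d' by rwa [e]
  have h1 : ∀ n x, |(1 + omega n x)⁻¹| ≤ (1 : ℝ) := by
    intro n x
    have := omega_nonneg n x
    rw [abs_of_nonneg (by positivity)]
    exact inv_le_one_of_one_le₀ (by linarith)
  obtain ⟨R, hR⟩ := exists_mulCLM (r := fun n x => (1 + omega n x)⁻¹)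
    (symWeight_comp symWeight_omega (φ := fun s => (1 + s)⁻¹) (by fun_prop)) h1
  have hD : Dense ((LinearMap.range (R : Fock →ₗ[ℂ] Fock) : Submodule ℂ Fock) : Set Fock) :=
    dense_of_mulGraph (r := fun n x => (1 + omega n x)⁻¹)
      (symWeight_comp symWeight_omega (φ := fun s => (1 + s)⁻¹) (by fun_prop)) h1
      (fun n x => by have := omega_nonneg n x; positivity)
      (fun u v huv => ⟨u, mulGraph_unique (hR u) huv⟩)
  refine hD.eq_of_inner_left (𝕜 := ℂ) ?_
  rintro _ ⟨y, rfl⟩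
  have hw : wsq (fun n x => 1 + omega n x) (R y) ≠ ⊤ := by
    rw [wsq_of_mulGraph (hR y)]
    refine ne_top_of_le_ne_top (wsq_one_ne_top y) (wsq_mono (fun n x => ?_) _)
    have := omega_nonneg n x
    rw [sq, ← mul_assoc, mul_inv_cancel₀ (by positivity), one_mul]
    exact inv_le_one_of_one_le₀ (by linarith)
  obtain ⟨w', hw'⟩ := exists_creation hf hfin hw
  exact (h _ _ hw hw').trans ((mem_annihilation_graph hf hfin).1 hd' _ _ hw').symm

theorem fieldOp_linearCombination {f g : Photon → ℂ} (hf : AEStronglyMeasurable f photonMeasure)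
    (hff : photonNormSq f ≠ ⊤) (hg : AEStronglyMeasurable g photonMeasure)
    (hgf : photonNormSq g ≠ ⊤) (c d : ℝ) (hq : photonNormSq ((c : ℂ) • f + (d : ℂ) • g) ≠ ⊤)
    {u a b : Fock} (hu : wsq omega u ≠ ⊤)
    (ha : (u, a) ∈ (fieldOp f).graph) (hb : (u, b) ∈ (fieldOp g).graph) :
    (u, (c : ℂ) • a + (d : ℂ) • b) ∈ (fieldOp ((c : ℂ) • f + (d : ℂ) • g)).graph := by
  obtain ⟨c1, d1, hc1, hd1, rfl⟩ := mem_fieldOp_graph.1 ha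
  obtain ⟨c2, d2, hc2, hd2, rfl⟩ := mem_fieldOp_graph.1 hb
  refine mem_fieldOp_graph.2 ⟨(c : ℂ) • c1 + (d : ℂ) • c2, (c : ℂ) • d1 + (d : ℂ) • d2,
    creationGraph_add (creationGraph_smul hc1 _) (creationGraph_smul hc2 _), ?_, ?_⟩
  · refine mem_annihilation_graph_of_core ((hf.const_smul _).add (hg.const_smul _)) hq hu ?_
    intro w w' hw hw'
    obtain ⟨w1, h1⟩ := exists_creation hf hff hw
    obtain ⟨w2, h2⟩ := exists_creation hg hgf hw
    rw [creationGraph_unique hw' (creationGraph_add (creationGraph_smul h1 _)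
      (creationGraph_smul h2 _)), inner_add_left, inner_add_right, inner_smul_left, inner_smul_left,
      inner_smul_right, inner_smul_right, (mem_annihilation_graph hf hff).1 hd1 _ _ h1,
      (mem_annihilation_graph hg hgf).1 hd2 _ _ h2, Complex.conj_ofReal, Complex.conj_ofReal]
  · module

theorem smul_sub_eq_linearCombination {E : Type*} [AddCommGroup E] [Module ℂ E] (x y b : E) (t : ℝ) :
    (t : ℂ) • (((1 : ℝ) : ℂ) • x + ((-1 : ℝ) : ℂ) • y) + ((-1 : ℝ) : ℂ) • b =
      (t : ℂ) • (x - y) - b := by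
  push_cast
  module

/-- A family of form factors that is differentiable in the norm controlling field operators gives
differentiable field operators. -/
theorem hasDerivAt_fieldOp {f : ℝ → Photon → ℂ} {g : Photon → ℂ}
    (hf : ∀ t, AEStronglyMeasurable (f t) photonMeasure) (hff : ∀ t, photonNormSq (f t) ≠ ⊤)
    (hg : AEStronglyMeasurable g photonMeasure) (hgf : photonNormSq g ≠ ⊤)
    (h : Filter.Tendsto (fun t : ℝ => photonNormSq (((t⁻¹ : ℝ) : ℂ) • (f t - f 0) - g))
      (nhdsWithin 0 {0}ᶜ) (nhds 0)) {u b : Fock} {A : ℝ → Fock}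
    (hu : wsq (fun n x => 1 + omega n x) u ≠ ⊤) (hA : ∀ t, (u, A t) ∈ (fieldOp (f t)).graph)
    (hb : (u, b) ∈ (fieldOp g).graph) : HasDerivAt A b 0 := by
  rw [hasDerivAt_iff_tendsto_slope, Metric.tendsto_nhds]
  intro ε hε
  set W := (wsq (fun n x => 1 + omega n x) u).toReal with hW
  have hW0 : 0 ≤ W := ENNReal.toReal_nonneg
  have hWe : wsq (fun n x => 1 + omega n x) u = ENNReal.ofReal W := (ENNReal.ofReal_toReal hu).symm
  -- Chosen so that the field operator bound `2 F W` falls below `ε²`.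
  set F := ε ^ 2 / (2 * (W + 1)) with hF
  have hF0 : 0 < F := by positivity
  have hu' : wsq omega u ≠ ⊤ := ne_top_of_le_ne_top hu (wsq_omega_le u)
  filter_upwards [h.eventually (ge_mem_nhds (ENNReal.ofReal_pos.2 hF0)), self_mem_nhdsWithin]
    with t ht ht0
  have ht0' : (t : ℂ) ≠ 0 := Complex.ofReal_ne_zero.2 ht0
  have hm1 := ((hf t).const_smul ((1 : ℝ) : ℂ)).add ((hf 0).const_smul ((-1 : ℝ) : ℂ))
  have e1 : ((t⁻¹ : ℝ) : ℂ) • (((1 : ℝ) : ℂ) • f t + ((-1 : ℝ) : ℂ) • f 0) + ((-1 : ℝ) : ℂ) • g =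
      ((t⁻¹ : ℝ) : ℂ) • (f t - f 0) - g := by
    push_cast
    module
  have hfin1 : photonNormSq (((1 : ℝ) : ℂ) • f t + ((-1 : ℝ) : ℂ) • f 0) ≠ ⊤ := by
    have hle : photonNormSq (((1 : ℝ) : ℂ) • f t + ((-1 : ℝ) : ℂ) • f 0) ≤
        2 * (photonNormSq (f t) + photonNormSq (f 0)) := by
      rw [photonNormSq, photonNormSq, photonNormSq, ← lintegral_add_left' (by
        have := (hf t).norm.aemeasurable
        have hk : Measurable fun y : Photon => 1 + ‖y.1‖⁻¹ := by fun_prop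
        exact ((this.pow_const 2).mul hk.aemeasurable).ennreal_ofReal),
        ← lintegral_const_mul' _ _ (by norm_num)]
      refine lintegral_mono fun y => ?_
      rw [← ENNReal.ofReal_add (by positivity) (by positivity), two_mul_ofReal]
      refine ENNReal.ofReal_le_ofReal ?_
      rw [← add_mul, ← mul_assoc]
      refine mul_le_mul_of_nonneg_right ?_ (by positivity)
      have : ‖(((1 : ℝ) : ℂ) • f t + ((-1 : ℝ) : ℂ) • f 0) y‖ ≤ ‖f t y‖ + ‖f 0 y‖ := by
        have e : (((1 : ℝ) : ℂ) • f t + ((-1 : ℝ) : ℂ) • f 0) y = f t y - f 0 y := by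
          simp [sub_eq_add_neg]
        rw [e]; exact norm_sub_le _ _
      calc _ ≤ (‖f t y‖ + ‖f 0 y‖) ^ 2 := by gcongr
        _ ≤ _ := by nlinarith [sq_nonneg (‖f t y‖ - ‖f 0 y‖)]
    exact ne_top_of_le_ne_top (ENNReal.mul_ne_top (by norm_num)
      (ENNReal.add_ne_top.2 ⟨hff t, hff 0⟩)) hle
  have ha1 := fieldOp_linearCombination (hf t) (hff t) (hf 0) (hff 0) 1 (-1) hfin1 hu' (hA t) (hA 0)
  have ha2 := fieldOp_linearCombination hm1 hfin1 hg hgf t⁻¹ (-1)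
    (by rw [e1]; exact ne_top_of_le_ne_top ENNReal.ofReal_ne_top ht) hu' ha1 hb
  have e2 : ((t⁻¹ : ℝ) : ℂ) • (((1 : ℝ) : ℂ) • A t + ((-1 : ℝ) : ℂ) • A 0) + ((-1 : ℝ) : ℂ) • b =
      slope A 0 t - b := by
    rw [slope_def_module, sub_zero]
    exact smul_sub_eq_linearCombination _ _ _ _
  rw [e1, e2] at ha2
  have hb2 := wsq_one_fieldOp_le (F := F) ⟨((((hf t).sub (hf 0)).const_smul _).sub hg), hF0, ht⟩ ha2
  rw [hWe, ← ENNReal.ofReal_mul (by positivity)] at hb2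
  have hb3 := norm_sq_le_of_wsq_le (by positivity) hb2
  rw [dist_eq_norm]
  refine lt_of_pow_lt_pow_left₀ 2 hε.le (hb3.trans_lt ?_)
  have e3 : 2 * F * W = ε ^ 2 * (W / (W + 1)) := by
    rw [hF]; field_simp
  rw [e3]
  have : W / (W + 1) < 1 := (div_lt_one (by positivity)).2 (by linarith)
  have hε2 : 0 < ε ^ 2 := by positivity
  nlinarith

/-! ### The commutator with the generator of dilatations -/

section Curves

variable {E : Type*} [NormedAddCommGroup E] [InnerProductSpace ℂ E]

/-- As `a` vanishes at zero, continuity of `Z` suffices. This is what allows differentiation of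
`⟨D_t u - u, H D_t v⟩` although `H D_t v` is only known to be continuous at zero. -/
theorem hasDerivAt_inner_of_zero {a Z : ℝ → E} {a' : E} (ha : HasDerivAt a a' 0) (h0 : a 0 = 0)
    (hZ : ContinuousAt Z 0) : HasDerivAt (fun t => ⟪a t, Z t⟫_ℂ) ⟪a', Z 0⟫_ℂ 0 := by
  rw [hasDerivAt_iff_tendsto_slope] at ha ⊢
  have h1 := ha.inner (𝕜 := ℂ) (hZ.tendsto.mono_left nhdsWithin_le_nhds)
  refine h1.congr fun t => ?_
  rw [slope_def_module, slope_def_module, h0, inner_zero_left, sub_zero, sub_zero, sub_zero,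
    ← Complex.coe_smul, ← Complex.coe_smul, inner_smul_left, Complex.conj_ofReal, smul_eq_mul]

theorem hasDerivAt_affine {A : ℝ → E} {b u k : E} (hA : HasDerivAt A b 0) (c s : ℝ) :
    HasDerivAt (fun t : ℝ => (c : ℂ) • u - (Real.exp t : ℂ) • k - (s : ℂ) • A t)
      (-k - (s : ℂ) • b) 0 := by
  have h1 : HasDerivAt (fun t : ℝ => (Real.exp t : ℂ)) ((Real.exp 0 : ℝ) : ℂ) 0 :=
    (Real.hasDerivAt_exp 0).ofReal_comp
  have h2 := ((h1.smul_const k).const_sub ((c : ℂ) • u)).sub (hA.const_smul (s : ℂ))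
  refine h2.congr_deriv ?_
  rw [Real.exp_zero, Complex.ofReal_one, one_smul]

theorem continuous_expCombination {a b c : ℝ → E} (ha : Continuous a) (hb : Continuous b)
    (hc : Continuous c) (r : ℝ) : Continuous fun t => (r : ℂ) • a t + ((Real.exp t : ℂ) • b t +
      ((1 / 2 : ℝ) : ℂ) • (Real.exp (2 * t) : ℂ) • c t) := by
  have h1 : Continuous fun t : ℝ => (Real.exp t : ℂ) := by fun_prop
  have h2 : Continuous fun t : ℝ => (Real.exp (2 * t) : ℂ) := by fun_prop
  exact (ha.const_smul _).add ((h1.smul hb).add ((h2.smul hc).const_smul _))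

end Curves

/-- A coupling that is small enough for the Hamiltonian to be controlled by the free one. -/
structure SmallCoupling (kap : R3 → ℝ) (eps : Fin 2 → R3 → R3) (alpha : ℝ) (P : R3) (F L : ℝ) :
    Prop where
  nonneg : 0 ≤ L
  bound : ∀ j, PhotonBound (coupling kap eps j) F
  support : ∀ j y, coupling kap eps j y ≠ 0 → ‖y.1‖ ≤ L
  le_one : alpha ≤ 1
  small : Real.sqrt alpha * katoConst F L ≤ 1 / 2
  momentum_le : ‖P‖ ≤ 1 / 40

/-- `G j` is the derivative of the `j`-th component of the coupling function under dilations, in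
the norm that controls field operators. -/
structure DilatedCoupling (kap : R3 → ℝ) (eps : Fin 2 → R3 → R3) (G : Fin 3 → Photon → ℂ) (F : ℝ) :
    Prop where
  bound : ∀ j, PhotonBound (G j) F
  tendsto : ∀ j, Filter.Tendsto (fun t : ℝ => photonNormSq (((t⁻¹ : ℝ) : ℂ) •
    (dilPhoton t (coupling kap eps j) - coupling kap eps j) - G j)) (nhdsWithin 0 {0}ᶜ) (nhds 0)

variable {kap : R3 → ℝ} {eps : Fin 2 → R3 → R3} {alpha : ℝ} {P : R3} {F L : ℝ}
  {G : Fin 3 → Photon → ℂ}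

theorem homogeneous_momentum (j : Fin 3) : Homogeneous 1 fun n x => momentum n x j := by
  intro n t x
  simp only [momentum_scale, one_mul]
  rfl

theorem dil_mulGraph_one {m : ∀ n, Conf n → ℝ} (hm : Homogeneous 1 m) {u v : Fock}
    (h : (u, v) ∈ mulGraph m) (t : ℝ) : (dil t u, (Real.exp t : ℂ) • dil t v) ∈ mulGraph m := by
  have := mulGraph_dil hm h t
  rwa [one_mul] at this

theorem mulGraph_const (c : ℝ) (u : Fock) : (u, (c : ℂ) • u) ∈ mulGraph fun _ _ => c := by
  intro n
  filter_upwards [Lp.coeFn_smul (c : ℂ) (wave u n)] with x h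
  rw [wave_smul, h]; rfl

theorem mulGraph_const_sub {m : ∀ n, Conf n → ℝ} (c : ℝ) {u v : Fock} (h : (u, v) ∈ mulGraph m) :
    (u, (c : ℂ) • u - v) ∈ mulGraph fun n x => c - m n x := by
  have h1 := mulGraph_add_weight (mulGraph_const c u) (mulGraph_smul_weight h (-1))
  convert! h1 using 2
  · ext n x; ring
  · push_cast; module

/-- The velocity operator conjugated by dilations. -/
theorem dil_velocity {j : Fin 3} (hb : PhotonBound (coupling kap eps j) F) {u k a : Fock} {t : ℝ}
    (hk : (u, k) ∈ mulGraph fun n x => momentum n x j)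
    (ha : (u, a) ∈ (fieldOp (dilPhoton (-t) (coupling kap eps j))).graph) :
    (dil t u, dil t ((P j : ℂ) • u - (Real.exp t : ℂ) • k - (Real.sqrt alpha : ℂ) • a)) ∈
      (velocity kap eps alpha P j).graph := by
  have h1 := fieldOp_dil (aestronglyMeasurable_dilPhoton hb.meas (-t))
    (photonNormSq_dil_ne_top hb.ne_top (-t)) ha t
  rw [dilPhoton_neg_dilPhoton] at h1
  refine mem_velocity_graph.2 ⟨_, _, mulGraph_const_sub (P j)
    (dil_mulGraph_one (homogeneous_momentum j) hk t), h1, ?_⟩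
  simp only [map_sub, map_smul]

theorem exists_momentum {u y : Fock} (h : (u, y) ∈ mulGraph (freeWeight P)) (j : Fin 3) :
    ∃ k, (u, k) ∈ mulGraph fun n x => momentum n x j := by
  obtain ⟨p, hp, -⟩ := exists_component h j
  have h1 := mulGraph_const_sub (P j) hp
  simp only [sub_sub_cancel] at h1
  exact ⟨_, h1⟩

theorem exists_mulGraph_of_freeWeight {m : ∀ n, Conf n → ℝ} (hm : SymWeight m) {C : ℝ}
    (hle : ∀ n x, |m n x| ≤ C * freeWeight P n x) {u y : Fock}
    (h : (u, y) ∈ mulGraph (freeWeight P)) : ∃ v, (u, v) ∈ mulGraph m := by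
  refine exists_mulGraph hm (ne_top_of_le_ne_top ENNReal.ofReal_ne_top
    (wsq_le_of_freeWeight h (C := C ^ 2) (sq_nonneg C) fun n x => ?_))
  rw [← sq_abs, ← mul_pow]
  exact pow_le_pow_left₀ (abs_nonneg _) (hle n x) 2

theorem inner_momentum_le (P : R3) (n : ℕ) (x : Conf n) :
    |⟪P, momentum n x⟫_ℝ| ≤ ‖P‖ * omega n x :=
  (abs_real_inner_le_norm _ _).trans (mul_le_mul_of_nonneg_left (norm_momentum_le n x) (norm_nonneg _))

/-- Along the dilation group, vectors in the domain of the free Hamiltonian stay in this domain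
continuously. -/
theorem exists_freeWeight_dil (hP : ‖P‖ ≤ 1 / 40) {u y : Fock}
    (h : (u, y) ∈ mulGraph (freeWeight P)) :
    ∃ Y : ℝ → Fock, Continuous Y ∧ Y 0 = y ∧ ∀ t, (dil t u, Y t) ∈ mulGraph (freeWeight P) := by
  -- The free weight splits into parts of degree zero, one and two: `1 + |P|²/2`, `ω - P · k` and
  -- `|k|²/2`. Each is multiplied by an explicit exponential under dilation.
  obtain ⟨c, hc⟩ := exists_mulGraph_of_freeWeight (m := fun n x => omega n x - ⟪P, momentum n x⟫_ℝ)
    ⟨fun n => (symWeight_omega.1 n).sub ((symWeight_of_momentum (φ := fun q => ⟪P, q⟫_ℝ)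
      (by fun_prop)).1 n), fun n p x => by
        beta_reduce; rw [symWeight_omega.2, momentum_perm]⟩
    (C := 2) (fun n x => by
      have h1 := inner_momentum_le P n x
      have h2 := omega_nonneg n x
      have h3 := one_add_omega_le_freeWeight P n x
      have h4 : ‖P‖ * omega n x ≤ 1 / 40 * omega n x := by gcongr
      rw [abs_le] at h1 ⊢
      constructor <;> linarith [h1.1, h1.2]) h
  obtain ⟨b, hb⟩ := exists_mulGraph_of_freeWeight (m := fun n x => ‖momentum n x‖ ^ 2)
    (symWeight_of_momentum (φ := fun q => ‖q‖ ^ 2) (by fun_prop))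
    (C := 5) (fun n x => by
      have h1 := one_add_sq_momentum_le hP n x
      rw [abs_of_nonneg (by positivity)]
      linarith) h
  have hcH : Homogeneous 1 fun n x => omega n x - ⟪P, momentum n x⟫_ℝ := by
    intro n t x
    beta_reduce
    rw [homogeneous_omega, momentum_scale, inner_smul_right]
    ring_nf
  have hbH : Homogeneous 2 fun n x => ‖momentum n x‖ ^ 2 := by
    intro n t x
    beta_reduce
    rw [momentum_scale, norm_smul, mul_pow, Real.norm_of_nonneg (Real.exp_nonneg _),
      ← Real.exp_nat_mul]
    norm_num
  have key : ∀ t, (dil t u, ((1 + ‖P‖ ^ 2 / 2 : ℝ) : ℂ) • dil t u + ((Real.exp t : ℂ) • dil t c +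
      ((1 / 2 : ℝ) : ℂ) • (Real.exp (2 * t) : ℂ) • dil t b)) ∈ mulGraph (freeWeight P) := by
    intro t
    have h1 := mulGraph_add_weight (mulGraph_const (1 + ‖P‖ ^ 2 / 2) (dil t u))
      (mulGraph_add_weight (dil_mulGraph_one hcH hc t)
        (mulGraph_smul_weight (mulGraph_dil hbH hb t) (1 / 2)))
    convert! h1 using 2
    ext n x
    rw [freeWeight, @norm_sub_sq_real]
    ring
  obtain ⟨Y, hYc, hY⟩ : ∃ Y : ℝ → Fock, Continuous Y ∧
      ∀ t, (dil t u, Y t) ∈ mulGraph (freeWeight P) :=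
    ⟨fun t => ((1 + ‖P‖ ^ 2 / 2 : ℝ) : ℂ) • dil t u + ((Real.exp t : ℂ) • dil t c +
      ((1 / 2 : ℝ) : ℂ) • (Real.exp (2 * t) : ℂ) • dil t b),
      continuous_expCombination (continuous_dil u) (continuous_dil c) (continuous_dil b) _, key⟩
  have h0 := hY 0
  rw [dil_zero u] at h0
  exact ⟨Y, hYc, mulGraph_unique h0 h, hY⟩

/-- The graph norms of `H` and of the free operator are equivalent, so continuity along dilations
transfers from the latter. -/
theorem exists_hamiltonian_dil (hS : SmallCoupling kap eps alpha P F L) {u z : Fock}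
    (h : (u, z) ∈ (hamiltonian kap eps alpha P).graph) :
    ∃ Z : ℝ → Fock, ContinuousAt Z 0 ∧ Z 0 = z ∧
      ∀ t, (dil t u, Z t) ∈ (hamiltonian kap eps alpha P).graph := by
  obtain ⟨y, hy, -⟩ := freeWeight_of_hamiltonian hS.nonneg hS.bound hS.support hS.le_one hS.small
    hS.momentum_le h
  obtain ⟨Y, hYc, hY0, hY⟩ := exists_freeWeight_dil hS.momentum_le hy
  choose D hD hDn using fun t => hamiltonian_of_freeWeight hS.nonneg hS.bound hS.support hS.le_one
    hS.small hS.momentum_le (pair_sub_mem _ (hY t) hy)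
  have hb : ∀ t, ‖D t‖ ≤ 2 * ‖Y t - y‖ + ‖dil t u - u‖ := fun t => by
    have := norm_sub_le (D t + (dil t u - u)) (dil t u - u)
    rw [add_sub_cancel_right] at this
    linarith [hDn t]
  have hlim : Filter.Tendsto (fun t => 2 * ‖Y t - y‖ + ‖dil t u - u‖) (nhds 0) (nhds 0) := by
    have h1 := (((hYc.tendsto 0).sub_const y).norm.const_mul 2).add
      (((continuous_dil u).tendsto 0).sub_const u).norm
    rwa [hY0, dil_zero, sub_self, sub_self, norm_zero, mul_zero, add_zero] at h1
  have hD0 : D 0 = 0 := by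
    have := hb 0
    rw [hY0, dil_zero, sub_self, sub_self, norm_zero, mul_zero, add_zero] at this
    exact norm_le_zero_iff.1 this
  refine ⟨fun t => z + D t, ?_, by simp only [hD0, add_zero], fun t => ?_⟩
  · have h2 : Filter.Tendsto D (nhds 0) (nhds 0) := squeeze_zero_norm hb hlim
    have h3 := h2.const_add z
    rw [add_zero] at h3
    have e : z = z + D 0 := by rw [hD0, add_zero]
    change Filter.Tendsto _ _ (nhds (z + D 0))
    rwa [← e]
  · have := pair_add_mem _ h (hD t)
    rwa [add_sub_cancel] at this

/-- The commutator of the Hamiltonian with the generator of dilatations. -/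
theorem inner_commutator (hS : SmallCoupling kap eps alpha P F L)
    (hG : DilatedCoupling kap eps G F) {u v zu zv bu bv ev : Fock} {vu vv ku kv gu gv : Fin 3 → Fock}
    (hzu : (u, zu) ∈ (hamiltonian kap eps alpha P).graph)
    (hzv : (v, zv) ∈ (hamiltonian kap eps alpha P).graph)
    (hbu : (u, bu) ∈ dilGraph) (hbv : (v, bv) ∈ dilGraph)
    (hev : (v, ev) ∈ mulGraph omega)
    (hvu : ∀ j, (u, vu j) ∈ (velocity kap eps alpha P j).graph)
    (hvv : ∀ j, (v, vv j) ∈ (velocity kap eps alpha P j).graph)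
    (hku : ∀ j, (u, ku j) ∈ mulGraph fun n x => momentum n x j)
    (hkv : ∀ j, (v, kv j) ∈ mulGraph fun n x => momentum n x j)
    (hgu : ∀ j, (u, gu j) ∈ (fieldOp (G j)).graph) (hgv : ∀ j, (v, gv j) ∈ (fieldOp (G j)).graph) :
    Complex.I * (⟪zu, bv⟫_ℂ - ⟪bu, zv⟫_ℂ) = ⟪u, ev⟫_ℂ + (1 / 2 : ℂ) *
      ∑ j, (⟪vu j, (Real.sqrt alpha : ℂ) • gv j - kv j⟫_ℂ +
        ⟪(Real.sqrt alpha : ℂ) • gu j - ku j, vv j⟫_ℂ) := by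
  have fin : ∀ {u z : Fock}, (u, z) ∈ (hamiltonian kap eps alpha P).graph →
      wsq (fun n x => 1 + omega n x) u ≠ ⊤ := fun h => by
    obtain ⟨y, hy, -⟩ := freeWeight_of_hamiltonian hS.nonneg hS.bound hS.support hS.le_one hS.small
      hS.momentum_le h
    exact ne_top_of_le_ne_top ENNReal.ofReal_ne_top (wsq_one_add_omega_le hy)
  -- `V j t` is the velocity conjugated back by the dilation: momentum scales by `exp t` and the
  -- form factor is dilated by `-t`, whence the signs in the derivative.
  have curve : ∀ {u z : Fock} {vu ku gu : Fin 3 → Fock},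
      (u, z) ∈ (hamiltonian kap eps alpha P).graph →
      (∀ j, (u, vu j) ∈ (velocity kap eps alpha P j).graph) →
      (∀ j, (u, ku j) ∈ mulGraph fun n x => momentum n x j) →
      (∀ j, (u, gu j) ∈ (fieldOp (G j)).graph) →
      ∃ V : Fin 3 → ℝ → Fock, (∀ j, HasDerivAt (V j) ((Real.sqrt alpha : ℂ) • gu j - ku j) 0) ∧
        (∀ j, V j 0 = vu j) ∧ ∀ j t, (dil t u, dil t (V j t)) ∈ (velocity kap eps alpha P j).graph := by
    intro u z vu ku gu hz hv hk hg
    have hAe : ∀ j t, ∃ a, (u, a) ∈ (fieldOp (dilPhoton t (coupling kap eps j))).graph := fun j t => by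
      have hne := photonNormSq_dil_ne_top (hS.bound j).ne_top t
      refine exists_fieldOp (F := (photonNormSq (dilPhoton t (coupling kap eps j))).toReal + 1)
        ⟨aestronglyMeasurable_dilPhoton (hS.bound j).meas t, by positivity, ?_⟩ (fin hz)
      conv_lhs => rw [← ENNReal.ofReal_toReal hne]
      exact ENNReal.ofReal_le_ofReal (by linarith)
    choose A hA using hAe
    have h0 : ∀ j, dilPhoton 0 (coupling kap eps j) = coupling kap eps j := fun j => by
      funext y; simp [dilPhoton]
    have hd : ∀ j, HasDerivAt (A j) (gu j) 0 := fun j =>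
      hasDerivAt_fieldOp (f := fun t => dilPhoton t (coupling kap eps j)) (g := G j)
        (fun t => aestronglyMeasurable_dilPhoton (hS.bound j).meas t)
        (fun t => photonNormSq_dil_ne_top (hS.bound j).ne_top t) (hG.bound j).meas
        (hG.bound j).ne_top (by simp only [h0]; exact hG.tendsto j) (fin hz) (hA j) (hg j)
    refine ⟨fun j t => (P j : ℂ) • u - (Real.exp t : ℂ) • ku j - (Real.sqrt alpha : ℂ) • A j (-t),
      fun j => ?_, fun j => ?_, fun j t => dil_velocity (hS.bound j) (hk j) (hA j (-t))⟩
    · refine (hasDerivAt_affine (hasDerivAt_comp_neg (hd j)) (P j) (Real.sqrt alpha)).congr_deriv ?_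
      rw [smul_neg, sub_neg_eq_add, neg_add_eq_sub]
    · have h1 := dil_velocity (alpha := alpha) (P := P) (t := 0) (hS.bound j) (hk j) (hA j (-0))
      rw [dil_zero, dil_zero] at h1
      exact LinearPMap.mem_graph_snd_inj _ h1 (hv j) rfl
  obtain ⟨Vu, dVu, Vu0, hVu⟩ := curve hzu hvu hku hgu
  obtain ⟨Vv, dVv, Vv0, hVv⟩ := curve hzv hvv hkv hgv
  obtain ⟨Z, hZc, hZ0, hZ⟩ := exists_hamiltonian_dil hS hzv
  -- As a form the kinetic energy involves each velocity once on each side, so unitarity removes the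
  -- dilations and only first-order curves remain to be differentiated.
  have e1 : ∀ t, ⟪dil t u, Z t⟫_ℂ = (1 / 2 : ℂ) * ∑ j, ⟪Vu j t, Vv j t⟫_ℂ +
      (Real.exp t : ℂ) * ⟪u, ev⟫_ℂ := by
    intro t
    obtain ⟨v', w', e', h1, h2, h3, h4⟩ := mem_hamiltonian_graph.1 (hZ t)
    rw [inner_hamiltonian hS.bound (fun j => hVu j t) h2 h4]
    have e2 : ∀ j, v' j = dil t (Vv j t) := fun j =>
      LinearPMap.mem_graph_snd_inj _ (h1 j) (hVv j t) rfl
    have e3 : e' = (Real.exp t : ℂ) • dil t ev :=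
      mulGraph_unique h3 (dil_mulGraph_one homogeneous_omega hev t)
    rw [e3, inner_smul_right, (dil t).inner_map_map]
    simp only [e2, (dil _).inner_map_map]
  have d1 : HasDerivAt (fun t => ⟪dil t u, Z t⟫_ℂ) ((1 / 2 : ℂ) *
      ∑ j, (⟪vu j, (Real.sqrt alpha : ℂ) • gv j - kv j⟫_ℂ +
        ⟪(Real.sqrt alpha : ℂ) • gu j - ku j, vv j⟫_ℂ) + ⟪u, ev⟫_ℂ) 0 := by
    have h1 : HasDerivAt (fun t : ℝ => (Real.exp t : ℂ)) ((Real.exp 0 : ℝ) : ℂ) 0 :=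
      (Real.hasDerivAt_exp 0).ofReal_comp
    have h2 := ((HasDerivAt.fun_sum (u := Finset.univ) fun j _ =>
      (dVu j).inner ℂ (dVv j)).const_mul (1 / 2 : ℂ)).add (h1.mul_const ⟪u, ev⟫_ℂ)
    rw [Real.exp_zero, Complex.ofReal_one, one_mul] at h2
    simp only [Vu0, Vv0] at h2
    exact h2.congr_of_eventuallyEq (Filter.Eventually.of_forall e1)
  -- The second evaluation uses symmetry of `H` in the form `⟨u, H D_t v - H v⟩ = ⟨H u, D_t v - v⟩`.
  have d2 : HasDerivAt (fun t => ⟪dil t u, Z t⟫_ℂ)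
      (⟪Complex.I • bu, zv⟫_ℂ + ⟪zu, Complex.I • bv⟫_ℂ) 0 := by
    have h1 := hasDerivAt_inner_of_zero ((hasDerivAt_dil hbu).sub_const u)
      (by rw [dil_zero, sub_self]) hZc
    rw [hZ0] at h1
    have h2 := (hasDerivAt_const (0 : ℝ) zu).inner ℂ ((hasDerivAt_dil hbv).sub_const v)
    have h3 := (h1.add h2).add_const ⟪u, zv⟫_ℂ
    rw [inner_zero_left, add_zero] at h3
    refine h3.congr_of_eventuallyEq (Filter.Eventually.of_forall fun t => ?_)
    have h4 := hamiltonian_symm hS.bound hzu (pair_sub_mem _ (hZ t) hzv)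
    change _ = ⟪dil t u - u, Z t⟫_ℂ + ⟪zu, dil t v - v⟫_ℂ + ⟪u, zv⟫_ℂ
    rw [← h4, inner_sub_left, inner_sub_right]
    ring
  have h := d2.unique d1
  rw [inner_smul_left, inner_smul_right, Complex.conj_I] at h
  linear_combination h

/-! ### The commutator as a bounded form -/

section Forms

variable {E : Type*} [NormedAddCommGroup E] [InnerProductSpace ℂ E] {D : Submodule ℂ E}

/-- Restriction of an unbounded operator to a subspace of its domain. -/
def restrictMap (T : E →ₗ.[ℂ] E) (h : D ≤ T.domain) : D →ₗ[ℂ] E :=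
  T.toFun ∘ₗ Submodule.inclusion h

theorem restrictMap_mem (T : E →ₗ.[ℂ] E) (h : D ≤ T.domain) (u : D) :
    ((u : E), restrictMap T h u) ∈ T.graph :=
  T.mem_graph (Submodule.inclusion h u)

/-- The sesquilinear form `⟨A u, B v⟩`. -/
def sesqForm (A B : D →ₗ[ℂ] E) : D →ₗ⋆[ℂ] D →ₗ[ℂ] ℂ :=
  LinearMap.mk₂'ₛₗ (starRingEnd ℂ) (RingHom.id ℂ) (fun u v => ⟪A u, B v⟫_ℂ)
    (fun u u' v => by rw [map_add, inner_add_left])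
    (fun c u _ => by rw [map_smul, inner_smul_left, smul_eq_mul])
    (fun u v v' => by rw [map_add, inner_add_right])
    (fun c u v => by rw [map_smul, inner_smul_right, RingHom.id_apply, smul_eq_mul])

theorem sesqForm_apply (A B : D →ₗ[ℂ] E) (u v : D) : sesqForm A B u v = ⟪A u, B v⟫_ℂ := rfl

theorem exists_form (E₀ : D →ₗ[ℂ] E) (V W : Fin 3 → D →ₗ[ℂ] E) :
    ∃ Q : D →ₗ⋆[ℂ] D →ₗ[ℂ] ℂ, ∀ u v : D, Q u v = ⟪(u : E), E₀ v⟫_ℂ +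
      (1 / 2 : ℂ) * ∑ j, (⟪V j u, W j v⟫_ℂ + ⟪W j u, V j v⟫_ℂ) := by
  refine ⟨sesqForm D.subtype E₀ + (1 / 2 : ℂ) • ∑ j, (sesqForm (V j) (W j) + sesqForm (W j) (V j)),
    fun u v => ?_⟩
  simp only [LinearMap.add_apply, LinearMap.smul_apply, LinearMap.sum_apply, sesqForm_apply,
    smul_eq_mul, Submodule.subtype_apply]

theorem norm_form_le {u e : E} {a b c d : Fin 3 → E} {M N x y : ℝ} (hN : 0 ≤ N) (hM : 0 ≤ M)
    (hx : 0 ≤ x)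
    (hu : ‖u‖ ≤ x) (he : ‖e‖ ≤ N * y) (ha : ∀ j, ‖a j‖ ≤ N * x) (hb : ∀ j, ‖b j‖ ≤ M * y)
    (hc : ∀ j, ‖c j‖ ≤ M * x) (hd : ∀ j, ‖d j‖ ≤ N * y) :
    ‖⟪u, e⟫_ℂ + (1 / 2 : ℂ) * ∑ j, (⟪a j, b j⟫_ℂ + ⟪c j, d j⟫_ℂ)‖ ≤ (N + 3 * (N * M)) * x * y := by
  have h1 : ‖⟪u, e⟫_ℂ‖ ≤ x * (N * y) :=
    (norm_inner_le_norm (𝕜 := ℂ) u e).trans (mul_le_mul hu he (norm_nonneg _) hx)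
  have h2 : ∀ j, ‖⟪a j, b j⟫_ℂ + ⟪c j, d j⟫_ℂ‖ ≤ 2 * (N * M * x * y) := fun j => by
    have h3 := (norm_inner_le_norm (𝕜 := ℂ) (a j) (b j)).trans
      (mul_le_mul (ha j) (hb j) (norm_nonneg _) (by positivity))
    have h4 := (norm_inner_le_norm (𝕜 := ℂ) (c j) (d j)).trans
      (mul_le_mul (hc j) (hd j) (norm_nonneg _) (by positivity))
    refine (norm_add_le _ _).trans ?_
    linarith
  have h3 : ‖∑ j, (⟪a j, b j⟫_ℂ + ⟪c j, d j⟫_ℂ)‖ ≤ 3 * (2 * (N * M * x * y)) := by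
    refine (norm_sum_le_of_le _ fun j _ => h2 j).trans_eq ?_
    simp
  refine (norm_add_le _ _).trans ?_
  rw [norm_mul]
  have h4 : ‖(1 / 2 : ℂ)‖ = 1 / 2 := by norm_num
  rw [h4]
  linarith

theorem two_mul_re_inner_le (x y : E) : 2 * |(⟪x, y⟫_ℂ).re| ≤ ‖x‖ ^ 2 + ‖y‖ ^ 2 := by
  have h1 : |(⟪x, y⟫_ℂ).re| ≤ ‖x‖ * ‖y‖ :=
    (Complex.abs_re_le_norm _).trans (norm_inner_le_norm (𝕜 := ℂ) x y)
  nlinarith [sq_nonneg (‖x‖ - ‖y‖)]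

theorem re_inner_self (x : E) : (⟪x, x⟫_ℂ).re = ‖x‖ ^ 2 := by
  rw [inner_self_eq_norm_sq_to_K]
  norm_cast

/-- Completing the square. -/
theorem mul_re_inner_sub_le (c : ℝ) (u v : E) :
    c * (⟪u, v⟫_ℂ).re - c ^ 2 / 2 * ‖u‖ ^ 2 ≤ ‖v‖ ^ 2 / 2 := by
  have h := sq_nonneg ‖v - (c : ℂ) • u‖
  rw [@norm_sub_sq ℂ, inner_smul_right, norm_smul, Complex.norm_real, mul_pow, Real.norm_eq_abs,
    sq_abs, RCLike.re_to_complex, Complex.re_ofReal_mul, ← inner_conj_symm, Complex.conj_re] at h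
  linarith

/-- The lower bound on the commutator form, for one component. -/
theorem re_inner_commutator_ge {s : ℝ} (hs : 0 ≤ s) (c : ℝ) {u v k a g : E}
    (hv : v = (c : ℂ) • u - k - (s : ℂ) • a) :
    ‖v‖ ^ 2 / 2 - c ^ 2 / 2 * ‖u‖ ^ 2 - s * (‖v‖ ^ 2 / 2 + ‖a‖ ^ 2 + ‖g‖ ^ 2) ≤
      (1 / 2 * (⟪v, (s : ℂ) • g - k⟫_ℂ + ⟪(s : ℂ) • g - k, v⟫_ℂ)).re := by
  -- Up to fields of order `s`, the derivative of the velocity is the velocity minus the constant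
  -- `c`; pairing with `v` leaves `‖v‖²/2 - c²‖u‖²/2`.
  have e : (s : ℂ) • g - k = v - (c : ℂ) • u + (s : ℂ) • (a + g) := by rw [hv]; module
  have h1 : (1 / 2 * (⟪v, (s : ℂ) • g - k⟫_ℂ + ⟪(s : ℂ) • g - k, v⟫_ℂ)).re =
      (⟪v, (s : ℂ) • g - k⟫_ℂ).re := by
    rw [← inner_conj_symm ((s : ℂ) • g - k) v, Complex.add_conj, ← Complex.ofReal_one,
      ← Complex.ofReal_ofNat, ← Complex.ofReal_div, ← Complex.ofReal_mul, Complex.ofReal_re]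
    ring
  rw [h1, e, inner_add_right, inner_sub_right, inner_smul_right, inner_smul_right, Complex.add_re,
    Complex.sub_re, Complex.re_ofReal_mul, Complex.re_ofReal_mul, re_inner_self]
  have h2 := mul_re_inner_sub_le c u v
  rw [← inner_conj_symm, Complex.conj_re] at h2
  have h3 := (two_mul_re_inner_le v (a + g))
  have h4 : ‖a + g‖ ^ 2 ≤ 2 * (‖a‖ ^ 2 + ‖g‖ ^ 2) := by
    have := norm_add_le a g
    nlinarith [sq_nonneg (‖a‖ - ‖g‖), norm_nonneg (a + g)]
  have h5 := neg_abs_le (⟪v, a + g⟫_ℂ).re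
  have h6 : -(‖v‖ ^ 2 / 2 + ‖a‖ ^ 2 + ‖g‖ ^ 2) ≤ (⟪v, a + g⟫_ℂ).re := by linarith
  have h7 := mul_le_mul_of_nonneg_left h6 hs
  linarith

end Forms

/-! ### Lower bounds for the energy form and the commutator form -/

theorem re_inner_mulGraph_nonneg {r : ∀ n, Conf n → ℝ} (hr : SymWeight r) (h0 : ∀ n x, 0 ≤ r n x)
    {u v : Fock} (h : (u, v) ∈ mulGraph r) : 0 ≤ (⟪u, v⟫_ℂ).re := by
  have hs : SymWeight fun n x => Real.sqrt (r n x) := symWeight_comp hr (by fun_prop)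
  obtain ⟨s, hs'⟩ := exists_mulGraph hs (u := u) (by
    simp only [Real.sq_sqrt (h0 _ _)]
    have := inner_mulGraph h0 h
    rw [← this]
    exact ENNReal.ofReal_ne_top)
  have h2 : (s, v) ∈ mulGraph fun n x => Real.sqrt (r n x) := by
    intro n
    filter_upwards [h n, hs' n] with x h3 h4
    rw [h3, h4, ← mul_assoc, ← Complex.ofReal_mul, Real.mul_self_sqrt (h0 n x)]
  rw [mulGraph_symm hs' h2, re_inner_self]
  positivity

theorem norm_sq_fieldOp_le {f : Photon → ℂ} {F : ℝ} (hf : PhotonBound f F) {u a e : Fock}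
    (h : (u, a) ∈ (fieldOp f).graph) (he : (u, e) ∈ mulGraph omega) :
    ‖a‖ ^ 2 ≤ 2 * F * (‖u‖ ^ 2 + (⟪u, e⟫_ℂ).re) := by
  have h1 := wsq_one_fieldOp_le hf h
  have h2 := re_inner_mulGraph_nonneg symWeight_omega omega_nonneg he
  have hF := hf.pos
  rw [wsq_add (fun n => measurable_const) (fun _ _ => zero_le_one) omega_nonneg, wsq_one, wsq_one,
    ← inner_mulGraph omega_nonneg he, ← ENNReal.ofReal_add (by positivity) h2,
    ← ENNReal.ofReal_mul (by positivity)] at h1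
  exact (ENNReal.ofReal_le_ofReal_iff (by positivity)).1 h1

variable {kap : R3 → ℝ} {eps : Fin 2 → R3 → R3} {alpha : ℝ} {P : R3} {F L : ℝ}
  {G : Fin 3 → Photon → ℂ}

theorem re_inner_hamiltonian (hb : ∀ j, PhotonBound (coupling kap eps j) F) {u z e : Fock}
    {v : Fin 3 → Fock} (hz : (u, z) ∈ (hamiltonian kap eps alpha P).graph)
    (hv : ∀ j, (u, v j) ∈ (velocity kap eps alpha P j).graph) (he : (u, e) ∈ mulGraph omega) :
    (⟪u, z⟫_ℂ).re = ∑ j, ‖v j‖ ^ 2 / 2 + (⟪u, e⟫_ℂ).re := by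
  obtain ⟨v', w', e', h1, h2, h3, h4⟩ := mem_hamiltonian_graph.1 hz
  have e1 : ∀ j, v' j = v j := fun j => LinearPMap.mem_graph_snd_inj _ (h1 j) (hv j) rfl
  rw [inner_hamiltonian hb hv h2 h4, mulGraph_unique h3 he, Complex.add_re, Finset.mul_sum,
    Complex.re_sum]
  congr 1
  refine Finset.sum_congr rfl fun j _ => ?_
  rw [e1, inner_self_eq_norm_sq_to_K]
  have : (1 / 2 : ℂ) * ((‖v j‖ : ℝ) : ℂ) ^ 2 = ((‖v j‖ ^ 2 / 2 : ℝ) : ℂ) := by push_cast; ring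
  exact (congrArg Complex.re this).trans (Complex.ofReal_re _)

/-- Lower bound of the Hamiltonian in terms of the total momentum. -/
theorem hamiltonian_lower_bound (hS : SmallCoupling kap eps alpha P F L)
    (hC : (1 + 12 * F) * Real.sqrt alpha ≤ 1 / 4) {u z : Fock}
    (hz : (u, z) ∈ (hamiltonian kap eps alpha P).graph) :
    (‖P‖ ^ 2 / 2 - (1 + 12 * F) * Real.sqrt alpha) * ‖u‖ ^ 2 ≤ (⟪u, z⟫_ℂ).re := by
  obtain ⟨v, w, e, hv, -, he, -⟩ := mem_hamiltonian_graph.1 hz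
  rw [re_inner_hamiltonian hS.bound hz hv he]
  choose p a hp ha hvpa using fun j => mem_velocity_graph.1 (hv j)
  set s := Real.sqrt alpha with hs
  have hs0 : 0 ≤ s := Real.sqrt_nonneg _
  have hF : 0 < F := (hS.bound 0).pos
  have he0 := re_inner_mulGraph_nonneg symWeight_omega omega_nonneg he
  set q := (⟪u, e⟫_ℂ).re with hq
  have hP2 : ‖P‖ ^ 2 = P 0 ^ 2 + P 1 ^ 2 + P 2 ^ 2 := by
    rw [EuclideanSpace.real_norm_sq_eq, Fin.sum_univ_three]
  -- Positivity of `ω/40 - P · k`, which holds because `|k| ≤ ω` and `|P| ≤ 1/40`.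
  have h1 : ‖P‖ ^ 2 * ‖u‖ ^ 2 - q / 40 ≤ ∑ j, P j * (⟪u, p j⟫_ℂ).re := by
    have hm := mulGraph_add_weight (mulGraph_smul_weight he (1 / 40))
      (mulGraph_add_weight (mulGraph_const (-‖P‖ ^ 2) u)
        (mulGraph_add_weight (mulGraph_smul_weight (hp 0) (P 0))
          (mulGraph_add_weight (mulGraph_smul_weight (hp 1) (P 1))
            (mulGraph_smul_weight (hp 2) (P 2)))))
    have hw : (fun n x => 1 / 40 * omega n x + (-‖P‖ ^ 2 + (P 0 * (P 0 - momentum n x 0) +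
        (P 1 * (P 1 - momentum n x 1) + P 2 * (P 2 - momentum n x 2))))) =
        fun n x => 1 / 40 * omega n x - ⟪P, momentum n x⟫_ℝ := by
      funext n x
      rw [hP2, PiLp.inner_apply, Fin.sum_univ_three]
      simp only [RCLike.inner_apply, conj_trivial]
      ring
    have hs : SymWeight fun n x => 1 / 40 * omega n x - ⟪P, momentum n x⟫_ℝ :=
      ⟨fun n => ((symWeight_omega.1 n).const_mul _).sub ((symWeight_of_momentum
        (φ := fun q => ⟪P, q⟫_ℝ) (by fun_prop)).1 n), fun n p x => by
          beta_reduce; rw [symWeight_omega.2, momentum_perm]⟩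
    rw [hw] at hm
    have h2 := re_inner_mulGraph_nonneg hs (fun n x => by
      have h3 := (abs_le.1 (inner_momentum_le P n x)).2
      have h4 : ‖P‖ * omega n x ≤ 1 / 40 * omega n x :=
        mul_le_mul_of_nonneg_right hS.momentum_le (omega_nonneg n x)
      linarith) hm
    simp only [inner_add_right, inner_smul_right, Complex.add_re, Complex.re_ofReal_mul,
      re_inner_self] at h2
    rw [Fin.sum_univ_three]
    linarith
  -- The square `‖v j - P j u‖² ≥ 0` makes the kinetic energy linear in `p j` and the field.
  have h2 : ∀ j, P j * (⟪u, p j⟫_ℂ).re - s * ((1 / 80) * (‖u‖ ^ 2 + 2 * F * (‖u‖ ^ 2 + q))) -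
      P j ^ 2 / 2 * ‖u‖ ^ 2 ≤ ‖v j‖ ^ 2 / 2 := by
    intro j
    have h3 := mul_re_inner_sub_le (P j) u (v j)
    have h4 : (⟪u, v j⟫_ℂ).re = (⟪u, p j⟫_ℂ).re - s * (⟪u, a j⟫_ℂ).re := by
      rw [hvpa j, inner_sub_right, inner_smul_right, Complex.sub_re, Complex.re_ofReal_mul]
    have h5 := two_mul_re_inner_le u (a j)
    have h6 := norm_sq_fieldOp_le (hS.bound j) (ha j) he
    have h7 : |P j * (⟪u, a j⟫_ℂ).re| ≤ 1 / 80 * (‖u‖ ^ 2 + 2 * F * (‖u‖ ^ 2 + q)) := by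
      rw [abs_mul]
      have h8 : |P j| ≤ 1 / 40 := (PiLp.norm_apply_le P j).trans hS.momentum_le
      calc |P j| * |(⟪u, a j⟫_ℂ).re| ≤ 1 / 40 * ((‖u‖ ^ 2 + 2 * F * (‖u‖ ^ 2 + q)) / 2) := by
            gcongr
            linarith
        _ = _ := by ring
    have h9 := mul_le_mul_of_nonneg_left ((le_abs_self _).trans h7) hs0
    rw [h4] at h3
    nlinarith
  have c0 := h2 0
  have c1 := h2 1
  have c2 := h2 2
  rw [hP2] at h1 ⊢
  rw [Fin.sum_univ_three] at h1 ⊢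
  -- The field energy left over from `|P| < 1` absorbs the coupling terms proportional to `q`.
  have hsq : s * (1 + 12 * F) * q ≤ 1 / 4 * q := by
    rw [mul_comm s]; exact mul_le_mul_of_nonneg_right hC he0
  have hu0 : 0 ≤ s * F * ‖u‖ ^ 2 := by positivity
  have hu1 : 0 ≤ s * ‖u‖ ^ 2 := by positivity
  have hu2 : 0 ≤ s * q := by positivity
  have hu3 : 0 ≤ s * F * q := by positivity
  linarith

/-- Lower bound of the commutator form. -/
theorem commutator_lower_bound (hS : SmallCoupling kap eps alpha P F L)
    (hG : DilatedCoupling kap eps G F) {u z e : Fock} {v k g : Fin 3 → Fock}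
    (hz : (u, z) ∈ (hamiltonian kap eps alpha P).graph) (he : (u, e) ∈ mulGraph omega)
    (hv : ∀ j, (u, v j) ∈ (velocity kap eps alpha P j).graph)
    (hk : ∀ j, (u, k j) ∈ mulGraph fun n x => momentum n x j)
    (hg : ∀ j, (u, g j) ∈ (fieldOp (G j)).graph) :
    (⟪u, z⟫_ℂ).re - ‖P‖ ^ 2 / 2 * ‖u‖ ^ 2 -
      (1 + 12 * F) * Real.sqrt alpha * (‖u‖ ^ 2 + (⟪u, z⟫_ℂ).re) ≤
    (⟪u, e⟫_ℂ + (1 / 2 : ℂ) * ∑ j, (⟪v j, (Real.sqrt alpha : ℂ) • g j - k j⟫_ℂ +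
        ⟪(Real.sqrt alpha : ℂ) • g j - k j, v j⟫_ℂ)).re := by
  have hre := re_inner_hamiltonian hS.bound hz hv he
  set s := Real.sqrt alpha with hs
  have hs0 : 0 ≤ s := Real.sqrt_nonneg _
  have hF : 0 < F := (hS.bound 0).pos
  have he0 := re_inner_mulGraph_nonneg symWeight_omega omega_nonneg he
  set q := (⟪u, e⟫_ℂ).re with hq
  choose p a hp ha hvpa using fun j => mem_velocity_graph.1 (hv j)
  have h1 : ∀ j, ‖v j‖ ^ 2 / 2 - P j ^ 2 / 2 * ‖u‖ ^ 2 - s * (‖v j‖ ^ 2 / 2 +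
      4 * F * (‖u‖ ^ 2 + q)) ≤ (1 / 2 * (⟪v j, (s : ℂ) • g j - k j⟫_ℂ +
        ⟪(s : ℂ) • g j - k j, v j⟫_ℂ)).re := by
    intro j
    have h2 : v j = (P j : ℂ) • u - k j - (s : ℂ) • a j := by
      rw [hvpa j, mulGraph_unique (hp j) (mulGraph_const_sub (P j) (hk j))]
    have h3 := re_inner_commutator_ge hs0 (P j) (g := g j) h2
    have h4 := norm_sq_fieldOp_le (hS.bound j) (ha j) he
    have h5 := norm_sq_fieldOp_le (hG.bound j) (hg j) he
    have h6 : s * (‖v j‖ ^ 2 / 2 + ‖a j‖ ^ 2 + ‖g j‖ ^ 2) ≤ s * (‖v j‖ ^ 2 / 2 +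
        4 * F * (‖u‖ ^ 2 + q)) := mul_le_mul_of_nonneg_left (by linarith) hs0
    linarith
  have hP2 : ‖P‖ ^ 2 = P 0 ^ 2 + P 1 ^ 2 + P 2 ^ 2 := by
    rw [EuclideanSpace.real_norm_sq_eq, Fin.sum_univ_three]
  have c0 := h1 0
  have c1 := h1 1
  have c2 := h1 2
  rw [Complex.add_re, Finset.mul_sum, Complex.re_sum, hre, hP2, Fin.sum_univ_three,
    Fin.sum_univ_three]
  have hn : ∀ j, 0 ≤ s * F * ‖v j‖ ^ 2 := fun j => by positivity
  have n0 := hn 0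
  have n1 := hn 1
  have n2 := hn 2
  have hu1 : 0 ≤ s * ‖u‖ ^ 2 := by positivity
  have hu2 : 0 ≤ s * q := by positivity
  linarith

/-! ### Graph-norm bounds, density and existence of the commutator form -/

variable {kap : R3 → ℝ} {eps : Fin 2 → R3 → R3} {alpha : ℝ} {P : R3} {F L : ℝ}
  {G : Fin 3 → Photon → ℂ}

theorem norm_le_of_mulGraph_le {m : ∀ n, Conf n → ℝ} (hle : ∀ n x, |m n x| ≤ freeWeight P n x)
    {u v y : Fock} (h : (u, y) ∈ mulGraph (freeWeight P)) (hv : (u, v) ∈ mulGraph m) :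
    ‖v‖ ≤ ‖y‖ := by
  have h1 := wsq_le_of_freeWeight h (C := 1) zero_le_one (m := fun n x => m n x ^ 2) fun n x => by
    rw [one_mul, ← sq_abs]
    exact pow_le_pow_left₀ (abs_nonneg _) (hle n x) 2
  rw [← wsq_one_of_mulGraph hv] at h1
  have := norm_le_of_wsq_le zero_le_one h1
  rwa [Real.sqrt_one, one_mul] at this

theorem abs_momentum_le (P : R3) (j : Fin 3) (n : ℕ) (x : Conf n) :
    |momentum n x j| ≤ freeWeight P n x := by
  have h1 : |momentum n x j| ≤ ‖momentum n x‖ := PiLp.norm_apply_le (momentum n x) j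
  have h2 := norm_momentum_le n x
  have h3 := one_add_omega_le_freeWeight P n x
  linarith

theorem abs_omega_le (P : R3) (n : ℕ) (x : Conf n) : |omega n x| ≤ freeWeight P n x := by
  rw [abs_of_nonneg (omega_nonneg n x)]
  linarith [one_add_omega_le_freeWeight P n x]

/-- Bounds on the constituents of the commutator form in the graph norm. -/
theorem norm_commutator_terms_le (hS : SmallCoupling kap eps alpha P F L)
    (hG : DilatedCoupling kap eps G F) {u z e : Fock} {v k g : Fin 3 → Fock}
    (hz : (u, z) ∈ (hamiltonian kap eps alpha P).graph) (he : (u, e) ∈ mulGraph omega)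
    (hv : ∀ j, (u, v j) ∈ (velocity kap eps alpha P j).graph)
    (hk : ∀ j, (u, k j) ∈ mulGraph fun n x => momentum n x j)
    (hg : ∀ j, (u, g j) ∈ (fieldOp (G j)).graph) :
    ‖e‖ ≤ 2 * (‖u‖ + ‖z‖) ∧ (∀ j, ‖v j‖ ≤ 2 * (‖u‖ + ‖z‖)) ∧
      ∀ j, ‖(Real.sqrt alpha : ℂ) • g j - k j‖ ≤ 2 * (Real.sqrt (2 * F) + 1) * (‖u‖ + ‖z‖) := by
  obtain ⟨y, hy, hyn⟩ := freeWeight_of_hamiltonian hS.nonneg hS.bound hS.support hS.le_one hS.small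
    hS.momentum_le hz
  have hyN : ‖y‖ ≤ 2 * (‖u‖ + ‖z‖) := by linarith [norm_add_le z u]
  have hF : 0 < F := (hS.bound 0).pos
  have he0 := re_inner_mulGraph_nonneg symWeight_omega omega_nonneg he
  have hre := re_inner_hamiltonian hS.bound hz hv he
  have hzu : (⟪u, z⟫_ℂ).re ≤ ‖u‖ * ‖z‖ :=
    (Complex.re_le_norm _).trans (norm_inner_le_norm (𝕜 := ℂ) u z)
  refine ⟨(norm_le_of_mulGraph_le (abs_omega_le P) hy he).trans hyN, fun j => ?_, fun j => ?_⟩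
  -- The velocities are controlled by the expectation of `H` itself, as the field energy is
  -- nonnegative.
  · have h1 : ‖v j‖ ^ 2 / 2 ≤ ∑ j, ‖v j‖ ^ 2 / 2 :=
      Finset.single_le_sum (f := fun j => ‖v j‖ ^ 2 / 2) (fun i _ => by positivity)
        (Finset.mem_univ j)
    refine le_of_sq_le_sq ?_ (by positivity)
    nlinarith [sq_nonneg ‖u‖, sq_nonneg ‖z‖, norm_nonneg u, norm_nonneg z,
      mul_nonneg (norm_nonneg u) (norm_nonneg z)]
  · have h1 := norm_le_of_mulGraph_le (abs_momentum_le P j) hy (hk j)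
    have h2 : ‖g j‖ ≤ Real.sqrt (2 * F) * ‖y‖ := by
      refine norm_le_of_wsq_le (by positivity) ?_
      refine (wsq_one_fieldOp_le (hG.bound j) (hg j)).trans ?_
      rw [ENNReal.ofReal_mul (p := 2 * F) (q := ‖y‖ ^ 2) (by positivity)]
      exact mul_le_mul_right ((wsq_one_add_omega_le hy).trans_eq (by rw [one_mul])) _
    have h3 : ‖(Real.sqrt alpha : ℂ) • g j‖ ≤ ‖g j‖ := by
      rw [norm_smul, Complex.norm_real, Real.norm_of_nonneg (Real.sqrt_nonneg _)]
      have : Real.sqrt alpha ≤ 1 := Real.sqrt_le_one.2 hS.le_one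
      exact mul_le_of_le_one_left (norm_nonneg _) this
    have h4 := norm_sub_le ((Real.sqrt alpha : ℂ) • g j) (k j)
    have h5 : Real.sqrt (2 * F) * ‖y‖ ≤ Real.sqrt (2 * F) * (2 * (‖u‖ + ‖z‖)) :=
      mul_le_mul_of_nonneg_left hyN (Real.sqrt_nonneg _)
    linarith

/-- Vectors in the domain of the Hamiltonian are approximated in the graph norm by their averages
over dilations. -/
theorem exists_approx_dilationGen (hS : SmallCoupling kap eps alpha P F L) {u z : Fock}
    (hz : (u, z) ∈ (hamiltonian kap eps alpha P).graph) {r : ℝ} (hr : 0 < r) :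
    ∃ u' z', (u', z') ∈ (hamiltonian kap eps alpha P).graph ∧ u' ∈ dilationGen.domain ∧
      ‖u - u'‖ < r ∧ ‖z - z'‖ < r := by
  obtain ⟨y, hy, -⟩ := freeWeight_of_hamiltonian hS.nonneg hS.bound hS.support hS.le_one hS.small
    hS.momentum_le hz
  obtain ⟨Y, hYc, hY0, hY⟩ := exists_freeWeight_dil hS.momentum_le hy
  have hk : ∀ n (x : Conf n), freeWeight P n x ≠ 0 := fun n x =>
    (zero_lt_one.trans_le (one_le_freeWeight P n x)).ne'
  obtain ⟨R, hR⟩ := exists_mulCLM (r := fun n x => (freeWeight P n x)⁻¹)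
    (symWeight_comp (symWeight_freeWeight P) (φ := fun s => s⁻¹) measurable_inv) fun n x => by
      have := one_le_freeWeight P n x
      rw [abs_of_nonneg (by positivity)]
      exact inv_le_one_of_one_le₀ this
  have hRinv : ∀ w, (R w, w) ∈ mulGraph (freeWeight P) := by
    intro w n
    filter_upwards [hR w n] with x h1
    rw [h1, ← mul_assoc, ← Complex.ofReal_mul, mul_inv_cancel₀ (hk n x), Complex.ofReal_one, one_mul]
  have hRY : ∀ t, R (Y t) = dil t u := fun t => by
    refine wave_ext fun n => Lp.ext ?_
    filter_upwards [hR (Y t) n, hY t n] with x h1 h2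
    rw [h1, h2, ← mul_assoc, ← Complex.ofReal_mul, inv_mul_cancel₀ (hk n x), Complex.ofReal_one,
      one_mul]
  -- Averaging is done on the free images `Y t`; the bounded inverse `R` commutes with the integral,
  -- so the average of `D_t u` converges in the free graph norm and hence in that of `H`.
  obtain ⟨ε, hε⟩ := ((Metric.tendsto_nhds.1 (tendsto_average hYc)) (r / 3) (by positivity)).exists
  rw [hY0, dist_eq_norm] at hε
  set y' := ε⁻¹ • ∫ s in (0 : ℝ)..ε, Y s with hy'
  have hRy : R y' = dilAverage ε u := by
    have h1 : R y' = ε⁻¹ • R (∫ s in (0 : ℝ)..ε, Y s) := (R.restrictScalars ℝ).map_smul ε⁻¹ _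
    rw [h1, ← R.intervalIntegral_comp_comm (hYc.intervalIntegrable _ _)]
    simp only [hRY]
    rfl
  have hdiff : (dilAverage ε u - u, y' - y) ∈ mulGraph (freeWeight P) := by
    have h1 := hRinv y'
    rw [hRy] at h1
    exact pair_sub_mem _ h1 hy
  obtain ⟨d, hd, hdn⟩ := hamiltonian_of_freeWeight hS.nonneg hS.bound hS.support hS.le_one
    hS.small hS.momentum_le hdiff
  have hu : ‖dilAverage ε u - u‖ ≤ ‖y' - y‖ := by
    refine norm_le_of_mulGraph (r := fun n x => (freeWeight P n x)⁻¹) (fun n x => ?_) ?_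
    · have := one_le_freeWeight P n x
      rw [abs_of_nonneg (by positivity)]
      exact inv_le_one_of_one_le₀ this
    · intro n
      filter_upwards [hdiff n] with x h1
      rw [h1, ← mul_assoc, ← Complex.ofReal_mul, inv_mul_cancel₀ (hk n x), Complex.ofReal_one,
        one_mul]
  have hε' : ‖y' - y‖ < r / 3 := hε
  refine ⟨dilAverage ε u, z + d, ?_, dilAverage_mem ε u, ?_, ?_⟩
  · have := pair_add_mem _ hz hd
    rwa [add_sub_cancel] at this
  · rw [norm_sub_rev]
    linarith
  · rw [sub_add_cancel_left, norm_neg]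
    have h1 := norm_sub_le (d + (dilAverage ε u - u)) (dilAverage ε u - u)
    rw [add_sub_cancel_right] at h1
    linarith

/-- The commutator form, with its lower bound. -/
theorem exists_commutatorForm (hS : SmallCoupling kap eps alpha P F L)
    (hG : DilatedCoupling kap eps G F) :
    ∃ Q, IsCommutatorForm (hamiltonian kap eps alpha P) dilationGen Q ∧
      ∀ u : (hamiltonian kap eps alpha P).domain, ∀ z, ((u : Fock), z) ∈ (hamiltonian kap eps alpha P).graph →
        (⟪(u : Fock), z⟫_ℂ).re - ‖P‖ ^ 2 / 2 * ‖(u : Fock)‖ ^ 2 - (1 + 12 * F) * Real.sqrt alpha *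
          (‖(u : Fock)‖ ^ 2 + (⟪(u : Fock), z⟫_ℂ).re) ≤ (Q u u).re := by
  set H := hamiltonian kap eps alpha P with hH
  have hgr : ∀ u : H.domain, ((u : Fock), H u) ∈ H.graph := fun u => H.mem_graph u
  have hE : H.domain ≤ fieldEnergy.domain := fun u hu => by
    obtain ⟨-, -, e, -, -, he, -⟩ := mem_hamiltonian_graph.1 (hgr ⟨u, hu⟩)
    exact LinearPMap.mem_domain_iff.2 ⟨e, mem_fieldEnergy_graph.2 he⟩
  have hV : ∀ j, H.domain ≤ (velocity kap eps alpha P j).domain := fun j u hu => by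
    obtain ⟨v, -, -, hv, -⟩ := mem_hamiltonian_graph.1 (hgr ⟨u, hu⟩)
    exact LinearPMap.mem_domain_iff.2 ⟨v j, hv j⟩
  have hfw : ∀ u : H.domain, ∃ y, ((u : Fock), y) ∈ mulGraph (freeWeight P) := fun u => by
    obtain ⟨y, hy, -⟩ := freeWeight_of_hamiltonian hS.nonneg hS.bound hS.support hS.le_one hS.small
      hS.momentum_le (hgr u)
    exact ⟨y, hy⟩
  have hK : ∀ j, H.domain ≤ (fieldMomentum j).domain := fun j u hu => by
    obtain ⟨y, hy⟩ := hfw ⟨u, hu⟩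
    obtain ⟨k, hk⟩ := exists_momentum hy j
    exact LinearPMap.mem_domain_iff.2 ⟨k, mem_fieldMomentum_graph.2 hk⟩
  have hgd : ∀ j, H.domain ≤ (fieldOp (G j)).domain := fun j u hu => by
    obtain ⟨y, hy⟩ := hfw ⟨u, hu⟩
    obtain ⟨a, ha⟩ := exists_fieldOp (hG.bound j)
      (ne_top_of_le_ne_top ENNReal.ofReal_ne_top (wsq_one_add_omega_le hy))
    exact LinearPMap.mem_domain_iff.2 ⟨a, ha⟩
  set E₀ := restrictMap fieldEnergy hE
  set V := fun j => restrictMap (velocity kap eps alpha P j) (hV j)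
  set K := fun j => restrictMap (fieldMomentum j) (hK j)
  set A := fun j => restrictMap (fieldOp (G j)) (hgd j)
  have mE : ∀ u : H.domain, ((u : Fock), E₀ u) ∈ mulGraph omega := fun u =>
    mem_fieldEnergy_graph.1 (restrictMap_mem _ _ u)
  have mV : ∀ (u : H.domain) j, ((u : Fock), V j u) ∈ (velocity kap eps alpha P j).graph :=
    fun u j => restrictMap_mem _ _ u
  have mK : ∀ (u : H.domain) j, ((u : Fock), K j u) ∈ mulGraph fun n x => momentum n x j :=
    fun u j => mem_fieldMomentum_graph.1 (restrictMap_mem _ _ u)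
  have mA : ∀ (u : H.domain) j, ((u : Fock), A j u) ∈ (fieldOp (G j)).graph :=
    fun u j => restrictMap_mem _ _ u
  -- The explicit formula makes sense on all of `D(H)`; it agrees with the commutator where `B` is
  -- defined.
  obtain ⟨Q, hQ⟩ := exists_form E₀ V fun j => (Real.sqrt alpha : ℂ) • A j - K j
  have hQ' : ∀ u v : H.domain, Q u v = ⟪(u : Fock), E₀ v⟫_ℂ + (1 / 2 : ℂ) *
      ∑ j, (⟪V j u, (Real.sqrt alpha : ℂ) • A j v - K j v⟫_ℂ +
        ⟪(Real.sqrt alpha : ℂ) • A j u - K j u, V j v⟫_ℂ) := hQ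
  refine ⟨Q, ⟨?_, ?_, ?_⟩, ?_⟩
  · refine ⟨2 + 3 * (2 * (2 * (Real.sqrt (2 * F) + 1))), fun u v => ?_⟩
    have bu := norm_commutator_terms_le hS hG (hgr u) (mE u) (mV u) (mK u) (mA u)
    have bv := norm_commutator_terms_le hS hG (hgr v) (mE v) (mV v) (mK v) (mA v)
    rw [hQ']
    exact norm_form_le (by norm_num) (by positivity) (by positivity)
      (le_add_of_nonneg_right (norm_nonneg _)) bv.1 bu.2.1 bv.2.2 bu.2.2 bv.2.1
  · intro u v hu hv
    rw [hQ']
    refine (inner_commutator hS hG (hgr u) (hgr v) ?_ ?_ (mE v) (mV u) (mV v) (mK u) (mK v) (mA u)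
      (mA v)).symm
    · rw [← dilationGen_graph]; exact dilationGen.mem_graph ⟨u, hu⟩
    · rw [← dilationGen_graph]; exact dilationGen.mem_graph ⟨v, hv⟩
  · intro u r hr
    obtain ⟨u', z', h1, h2, h3, h4⟩ := exists_approx_dilationGen hS (hgr u) hr
    have hd : u' ∈ H.domain := LinearPMap.mem_domain_iff.2 ⟨z', h1⟩
    refine ⟨⟨u', hd⟩, h2, h3, ?_⟩
    have e : H ⟨u', hd⟩ = z' := LinearPMap.mem_graph_snd_inj _ (hgr ⟨u', hd⟩) h1 rfl
    rwa [e]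
  · intro u z hz
    rw [hQ']
    exact commutator_lower_bound hS hG hz (mE u) (mV u) (mK u) (mA u)

variable {kap : R3 → ℝ} {eps : Fin 2 → R3 → R3} {Lam : ℝ}

/-! ### The coupling function -/

theorem measurable_coupling (hkap : IsCutoff Lam kap) (heps : IsPolarization eps) (j : Fin 3) :
    Measurable (coupling kap eps j) := by
  refine measurable_from_prod_countable_left fun lam => ?_
  have h1 : Measurable fun k : R3 => eps lam k j :=
    (EuclideanSpace.proj (𝕜 := ℝ) j).continuous.measurable.comp (heps.measurable lam)
  exact Complex.measurable_ofReal.comp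
    ((hkap.smooth.continuous.measurable.div measurable_norm.sqrt).mul h1)

theorem coupling_support (hkap : IsCutoff Lam kap) {j : Fin 3} {y : Photon}
    (hy : coupling kap eps j y ≠ 0) : ‖y.1‖ ≤ Lam := by
  have h : kap y.1 ≠ 0 := fun h => hy (by simp [coupling, h])
  simpa using hkap.support (subset_tsupport kap h)

theorem norm_coupling_sq_le (hkap : IsCutoff Lam kap) (heps : IsPolarization eps) (j : Fin 3)
    {y : Photon} (hy : y.1 ≠ 0) : ‖coupling kap eps j y‖ ^ 2 ≤ ‖y.1‖⁻¹ := by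
  have h1 : |eps y.2 y.1 j| ≤ 1 := by
    have := PiLp.norm_apply_le (eps y.2 y.1) j
    rwa [(heps.orthonormal y.1 hy).1 y.2, Real.norm_eq_abs] at this
  have h2 := hkap.mem_Icc y.1
  rw [coupling, Complex.norm_real, Real.norm_eq_abs, sq_abs, mul_pow, div_pow,
    Real.sq_sqrt (norm_nonneg _), ← sq_abs (eps y.2 y.1 j)]
  have h3 : kap y.1 ^ 2 ≤ 1 := pow_le_one₀ h2.1 h2.2
  have h4 : |eps y.2 y.1 j| ^ 2 ≤ 1 := pow_le_one₀ (abs_nonneg _) h1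
  calc kap y.1 ^ 2 / ‖y.1‖ * |eps y.2 y.1 j| ^ 2 ≤ 1 / ‖y.1‖ * 1 := by gcongr
    _ = ‖y.1‖⁻¹ := by rw [mul_one, one_div]

theorem lintegral_fst_photonMeasure {g : R3 → ENNReal} (hg : Measurable g) :
    ∫⁻ y, g y.1 ∂photonMeasure = 2 * ∫⁻ k, g k := by
  rw [photonMeasure, lintegral_prod (fun y : R3 × Fin 2 => g y.1)
    (hg.comp measurable_fst).aemeasurable]
  simp only [lintegral_const]
  rw [lintegral_mul_const _ hg, mul_comm]
  simp

/-- `|h|² (1 + 1/|k|)` is at most `(1 + Λ) |k|⁻²` on the ball of radius `Λ`, and `|k|⁻²` is locally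
integrable in dimension three. -/
theorem photonNormSq_coupling_ne_top (hkap : IsCutoff Lam kap)
    (heps : IsPolarization eps) (j : Fin 3) : photonNormSq (coupling kap eps j) ≠ ⊤ := by
  have hint : IntegrableOn (fun k : R3 => ‖k‖ ^ (-2 : ℝ)) (Metric.ball 0 (Lam + 1)) := by
    refine integrableOn_ball_of_norm_le_rpow (C := 1) (α := 2) (by simp) (by simp; norm_num)
      (ae_of_all _ fun k => ?_)
      (measurable_norm.pow_const (-2 : ℝ)).aestronglyMeasurable
    rw [one_mul, Real.norm_of_nonneg (Real.rpow_nonneg (norm_nonneg _) _)]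
  set g : R3 → ENNReal := (Metric.ball 0 (Lam + 1)).indicator fun k =>
    ENNReal.ofReal ((1 + Lam) * ‖k‖ ^ (-2 : ℝ)) with hg
  have hgm : Measurable g := Measurable.indicator
    ((measurable_norm.pow_const (-2 : ℝ)).const_mul (1 + Lam)).ennreal_ofReal measurableSet_ball
  have hgi : ∫⁻ k, g k ≠ ⊤ := by
    rw [lintegral_indicator measurableSet_ball]
    exact ((hint.const_mul (1 + Lam)).lintegral_lt_top).ne
  refine ne_top_of_le_ne_top (ENNReal.mul_ne_top ENNReal.ofNat_ne_top hgi)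
    ((lintegral_mono_ae ?_).trans_eq (lintegral_fst_photonMeasure hgm))
  filter_upwards [ae_photon_ne_zero] with y hy
  by_cases h0 : coupling kap eps j y = 0
  · simp [h0]
  have h1 := coupling_support hkap h0
  have h2 : 0 < ‖y.1‖ := norm_pos_iff.2 hy
  rw [hg, Set.indicator_of_mem (by simp; linarith)]
  refine ENNReal.ofReal_le_ofReal ?_
  rw [Real.rpow_neg h2.le, Real.rpow_two]
  calc ‖coupling kap eps j y‖ ^ 2 * (1 + ‖y.1‖⁻¹) ≤ ‖y.1‖⁻¹ * (1 + ‖y.1‖⁻¹) := by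
        gcongr; exact norm_coupling_sq_le hkap heps j hy
    _ = (1 + ‖y.1‖) * (‖y.1‖ ^ 2)⁻¹ := by field_simp; ring
    _ ≤ (1 + Lam) * (‖y.1‖ ^ 2)⁻¹ := by gcongr

theorem memLp_two_of_lintegral {f : Photon → ℂ} (hf : AEStronglyMeasurable f photonMeasure)
    (h : ∫⁻ y, ENNReal.ofReal (‖f y‖ ^ 2) ∂photonMeasure ≠ ⊤) : MemLp f 2 photonMeasure := by
  rw [memLp_two_iff_integrable_sq_norm hf]
  refine ⟨hf.norm.pow 2, ?_⟩
  rw [hasFiniteIntegral_iff_ofReal (ae_of_all _ fun y => sq_nonneg _)]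
  exact h.lt_top

theorem memLp_of_photonNormSq {f : Photon → ℂ} (hf : AEStronglyMeasurable f photonMeasure)
    (h : photonNormSq f ≠ ⊤) : MemLp f 2 photonMeasure := by
  refine memLp_two_of_lintegral hf (ne_top_of_le_ne_top h (lintegral_mono fun y => ?_))
  refine ENNReal.ofReal_le_ofReal (le_mul_of_one_le_right (sq_nonneg _) ?_)
  exact le_add_of_nonneg_right (inv_nonneg.2 (norm_nonneg _))

theorem memLp_infraredWeighted {f : Photon → ℂ} (hf : Measurable f)
    (h : photonNormSq f ≠ ⊤) : MemLp (infraredWeighted f) 2 photonMeasure := by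
  have hm : Measurable (infraredWeighted f) :=
    (Complex.measurable_ofReal.comp measurable_fst.norm.sqrt).inv.mul hf
  refine memLp_two_of_lintegral hm.aestronglyMeasurable
    (ne_top_of_le_ne_top h (lintegral_mono fun y => ?_))
  refine ENNReal.ofReal_le_ofReal ?_
  rw [infraredWeighted, norm_mul, mul_pow, norm_inv, inv_pow, Complex.norm_real,
    Real.norm_of_nonneg (Real.sqrt_nonneg _), Real.sq_sqrt (norm_nonneg _), mul_comm]
  exact mul_le_mul_of_nonneg_left (le_add_of_nonneg_left zero_le_one) (sq_nonneg _)

theorem photonNormSq_ne_top {f : Photon → ℂ} (hf : MemLp f 2 photonMeasure)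
    (hf' : MemLp (infraredWeighted f) 2 photonMeasure) : photonNormSq f ≠ ⊤ := by
  obtain ⟨u, hu⟩ := exists_single hf
  obtain ⟨v, hv⟩ := exists_single hf'
  rw [photonNormSq_eq hf.1 hu hv]
  exact ENNReal.add_ne_top.2 ⟨ENNReal.ofReal_ne_top, ENNReal.ofReal_ne_top⟩

/-- The coupling function and its derivative under dilations are bounded by a common constant. -/
theorem exists_dilatedCoupling (hkap : IsCutoff Lam kap)
    (heps : IsPolarization eps) (hreg : RegularCoupling kap eps) :
    ∃ G F, 0 < F ∧ (∀ j, PhotonBound (coupling kap eps j) F) ∧ DilatedCoupling kap eps G F := by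
  choose g hg hg2 hgi using hreg
  have hm := measurable_coupling hkap heps
  have hfin := photonNormSq_coupling_ne_top hkap heps
  have hgI : ∀ j, photonNormSq (Complex.I • g j) ≠ ⊤ := fun j => by
    refine photonNormSq_ne_top ((hg2 j).const_smul _) ?_
    rw [infraredWeighted_smul]
    exact (hgi j).const_smul _
  set F := 1 + (∑ j, (photonNormSq (coupling kap eps j)).toReal +
    ∑ j, (photonNormSq (Complex.I • g j)).toReal) with hF
  have h1 : 0 ≤ ∑ j, (photonNormSq (coupling kap eps j)).toReal :=
    Finset.sum_nonneg fun _ _ => ENNReal.toReal_nonneg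
  have h2 : 0 ≤ ∑ j, (photonNormSq (Complex.I • g j)).toReal :=
    Finset.sum_nonneg fun _ _ => ENNReal.toReal_nonneg
  have hF0 : 0 < F := by linarith
  refine ⟨fun j => Complex.I • g j, F, hF0, fun j => ⟨(hm j).aestronglyMeasurable, hF0, ?_⟩,
    fun j => ⟨(hg2 j).1.const_smul _, hF0, ?_⟩, fun j => ?_⟩
  · have := Finset.single_le_sum (f := fun j => (photonNormSq (coupling kap eps j)).toReal)
      (fun i _ => ENNReal.toReal_nonneg) (Finset.mem_univ j)
    exact (ENNReal.le_ofReal_iff_toReal_le (hfin j) hF0.le).2 (by linarith)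
  · have := Finset.single_le_sum (f := fun j => (photonNormSq (Complex.I • g j)).toReal)
      (fun i _ => ENNReal.toReal_nonneg) (Finset.mem_univ j)
    exact (ENNReal.le_ofReal_iff_toReal_le (hgI j) hF0.le).2 (by linarith)
  · exact tendsto_photonNormSq_dil (hg j)
      (memLp_of_photonNormSq (hm j).aestronglyMeasurable (hfin j)) (hg2 j)
      (memLp_infraredWeighted (hm j) (hfin j)) (hgi j)

/-! ### The vacuum -/

/-- The vacuum vector is an eigenvector of the free Hamiltonian. -/
theorem exists_vacuum : ∃ e : Fock, ‖e‖ = 1 ∧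
    ∀ P : R3, (e, ((1 + ‖P‖ ^ 2 / 2 : ℝ) : ℂ) • e) ∈ mulGraph (freeWeight P) := by
  have hsum : ∑' n, ∫⁻ _ : Conf n, ENNReal.ofReal (‖(if n = 0 then 1 else 0 : ℂ)‖ ^ 2)
      ∂confMeasure n = 1 := by
    rw [tsum_eq_single 0 fun n hn => by simp [hn]]
    simp [confMeasure]
  obtain ⟨e, he⟩ := exists_fock (fun n _ => if n = 0 then 1 else 0)
    (fun n => aestronglyMeasurable_const) (fun n p => ae_of_all _ fun x => rfl)
    (hsum.trans_ne ENNReal.one_ne_top)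
  refine ⟨e, ?_, fun P n => ?_⟩
  · have h1 : wsq (fun _ _ => 1) e = 1 := by
      rw [← hsum]
      refine tsum_congr fun n => lintegral_congr_ae ?_
      filter_upwards [he n] with x hx
      simp [hx]
    rw [wsq_one, ENNReal.ofReal_eq_one] at h1
    exact (pow_eq_one_iff_of_nonneg (norm_nonneg e) two_ne_zero).1 h1
  · beta_reduce
    rw [wave_smul]
    filter_upwards [he n, Lp.coeFn_smul ((1 + ‖P‖ ^ 2 / 2 : ℝ) : ℂ) (wave e n)] with x h1 h2
    rw [h2, Pi.smul_apply, smul_eq_mul, h1]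
    split_ifs with h0
    · subst h0
      simp [freeWeight, omega, momentum]
    · simp

/-! ### The Mourre estimate -/

variable {alpha : ℝ} {P : R3} {F : ℝ}

/-- The lower bound is the form bound of the Hamiltonian, the upper one the energy of the vacuum.
The value `3` is crude: any fixed bound suffices to absorb the error `C √α E(P)`. -/
theorem infSpec_hamiltonian (hS : SmallCoupling kap eps alpha P F Lam)
    (hC : (1 + 12 * F) * Real.sqrt alpha ≤ 1 / 4) :
    ‖P‖ ^ 2 / 2 - (1 + 12 * F) * Real.sqrt alpha ≤ infSpec (hamiltonian kap eps alpha P) ∧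
      infSpec (hamiltonian kap eps alpha P) ≤ 3 := by
  obtain ⟨e, hn, he⟩ := exists_vacuum
  obtain ⟨z, hz, hzn⟩ := hamiltonian_of_freeWeight hS.nonneg hS.bound hS.support hS.le_one
    hS.small hS.momentum_le (he P)
  refine infSpec_bounds (isSelfAdjoint_hamiltonian hS.nonneg hS.bound hS.support hS.le_one
    hS.small hS.momentum_le) (fun u z u' z' h h' => hamiltonian_symm hS.bound h h')
    (fun u z h => hamiltonian_lower_bound hS hC h) hz hn ?_
  rw [norm_smul, hn, mul_one, Complex.norm_real, Real.norm_of_nonneg (by positivity)] at hzn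
  have hP : ‖P‖ ^ 2 ≤ 1 := pow_le_one₀ (norm_nonneg _) (hS.momentum_le.trans (by norm_num))
  have h1 : (⟪e, z⟫_ℂ).re ≤ ‖e‖ * ‖z‖ :=
    (Complex.re_le_norm _).trans (norm_inner_le_norm (𝕜 := ℂ) e z)
  have h2 : (⟪e, z + e⟫_ℂ).re = (⟪e, z⟫_ℂ).re + 1 := by
    rw [inner_add_right, Complex.add_re, re_inner_self, hn, one_pow]
  have h3 : (⟪e, z + e⟫_ℂ).re ≤ ‖e‖ * ‖z + e‖ :=
    (Complex.re_le_norm _).trans (norm_inner_le_norm (𝕜 := ℂ) e (z + e))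
  rw [hn, one_mul] at h3
  linarith

theorem spectralProj_mem (T : Fock →ₗ.[ℂ] Fock) (a b : ℝ) (w : Fock) :
    spectralProj T a b w ∈ spectralSubspace T a b := by
  have : CompleteSpace (spectralSubspace T a b) := by unfold spectralSubspace; infer_instance
  exact Submodule.starProjection_apply_mem _ w

theorem re_inner_spectralProj (T : Fock →ₗ.[ℂ] Fock) (a b : ℝ) (w : Fock) :
    (⟪w, spectralProj T a b w⟫_ℂ).re = ‖spectralProj T a b w‖ ^ 2 := by
  have : CompleteSpace (spectralSubspace T a b) := by unfold spectralSubspace; infer_instance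
  exact (inner_re_symm (𝕜 := ℂ) w _).trans
    (Submodule.re_inner_starProjection_eq_normSq (spectralSubspace T a b) w)

theorem mourreEstimate_hamiltonian {G : Fin 3 → Photon → ℂ}
    (hS : SmallCoupling kap eps alpha P F Lam) (hG : DilatedCoupling kap eps G F)
    (hC : (1 + 12 * F) * Real.sqrt alpha ≤ 1 / 4) {sigma : ℝ}
    (hsigma : 20 * (1 + 12 * F) * Real.sqrt alpha ≤ sigma) :
    MourreEstimate (hamiltonian kap eps alpha P) dilationGen
      (infSpec (hamiltonian kap eps alpha P) + sigma)
      (infSpec (hamiltonian kap eps alpha P) + 2 * sigma) (sigma / 2) := by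
  have hF : 0 < F := (hS.bound 0).pos
  set H := hamiltonian kap eps alpha P with hH
  set s := (1 + 12 * F) * Real.sqrt alpha with hs
  have hs0 : 0 ≤ s := by positivity
  have hsig : 20 * s ≤ sigma := by rw [hs]; linarith
  obtain ⟨hE1, hE2⟩ := infSpec_hamiltonian hS hC
  obtain ⟨Q, hQ, hQb⟩ := exists_commutatorForm hS hG
  have hsa : IsSelfAdjoint H := isSelfAdjoint_hamiltonian hS.nonneg hS.bound hS.support hS.le_one
    hS.small hS.momentum_le
  refine ⟨Q, hQ, fun w => ?_⟩
  obtain ⟨z, hz, hz1, -⟩ := spectralSubspace_spec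
    (fun u z u' z' h h' => hamiltonian_symm hS.bound h h') hsa.isClosed
    (by linarith) (spectralProj_mem H (infSpec H + sigma) (infSpec H + 2 * sigma) w)
  refine ⟨LinearPMap.mem_domain_iff.2 ⟨z, hz⟩, ?_⟩
  refine le_trans ?_ (hQb ⟨_, LinearPMap.mem_domain_iff.2 ⟨z, hz⟩⟩ z hz)
  rw [re_inner_spectralProj]
  set x := spectralProj H (infSpec H + sigma) (infSpec H + 2 * sigma) w
  have h1 : (1 - s) * ((infSpec H + sigma) * ‖x‖ ^ 2) ≤ (1 - s) * (⟪x, z⟫_ℂ).re :=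
    mul_le_mul_of_nonneg_left hz1 (by linarith)
  -- From `P²/2 - s ≤ E ≤ 3` and `s ≤ 1/4` the right side is at least `3σ/4 - 5s`; the factor `20`
  -- in the hypothesis on `σ` gives `5s ≤ σ/4`.
  have h2 : sigma / 2 ≤ (1 - s) * (infSpec H + sigma) - ‖P‖ ^ 2 / 2 - s := by
    nlinarith
  have h3 := mul_le_mul_of_nonneg_right h2 (sq_nonneg ‖x‖)
  linarith

/-- Self-adjointness and the Mourre estimate for small coupling, with constants that do not depend
on the total momentum. -/
theorem exists_mourreEstimate (hLam : 0 < Lam) (hkap : IsCutoff Lam kap)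
    (heps : IsPolarization eps) (hreg : RegularCoupling kap eps) :
    ∃ alpha0 : ℝ, 0 < alpha0 ∧ ∃ C0 : ℝ, 0 < C0 ∧
      ∀ (P : R3) (alpha sigma : ℝ), ‖P‖ ≤ 1 / 40 → 0 ≤ alpha → alpha ≤ alpha0 →
        C0 * Real.sqrt alpha ≤ sigma →
        IsSelfAdjoint (hamiltonian kap eps alpha P) ∧
        MourreEstimate (hamiltonian kap eps alpha P) dilationGen
          (infSpec (hamiltonian kap eps alpha P) + sigma)
          (infSpec (hamiltonian kap eps alpha P) + 2 * sigma) (sigma / 2) := by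
  obtain ⟨G, F, hF, hf, hG⟩ := exists_dilatedCoupling hkap heps hreg
  have hK := katoConst_nonneg F Lam
  -- `√α ≤ 1/N` yields at once `√α · katoConst ≤ 1/2` and `(1 + 12F) √α ≤ 1/4`, while `N ≥ 1` gives
  -- `α ≤ 1`.
  set N := 4 * (1 + katoConst F Lam + (1 + 12 * F)) with hN
  have hN0 : 0 < N := by positivity
  refine ⟨(1 / N) ^ 2, by positivity, 20 * (1 + 12 * F), by positivity,
    fun P alpha sigma hP _ hα hsigma => ?_⟩
  have h1 : Real.sqrt alpha * N ≤ 1 := by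
    rw [← le_div_iff₀ hN0]
    exact Real.sqrt_le_iff.2 ⟨by positivity, hα⟩
  have h0 : 0 ≤ Real.sqrt alpha := Real.sqrt_nonneg _
  have h2 : 0 ≤ Real.sqrt alpha * katoConst F Lam := by positivity
  have h3 : 0 ≤ Real.sqrt alpha * F := by positivity
  rw [hN] at h1
  have hS : SmallCoupling kap eps alpha P F Lam :=
    { nonneg := hLam.le
      bound := hf
      support := fun j y => coupling_support hkap
      le_one := hα.trans (pow_le_one₀ (by positivity) (by
        rw [div_le_one hN0, hN]; linarith))
      small := by linarith
      momentum_le := hP }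
  exact ⟨isSelfAdjoint_hamiltonian hS.nonneg hS.bound hS.support hS.le_one hS.small
    hS.momentum_le, mourreEstimate_hamiltonian hS hG (by linarith) hsigma⟩

end QED

end

theorem theorem2p1 (Lam : ℝ) (hLam : 0 < Lam) (kap : QED.R3 → ℝ) (hkap : QED.IsCutoff Lam kap)
    (eps : Fin 2 → QED.R3 → QED.R3) (heps : QED.IsPolarization eps)
    (hreg : QED.RegularCoupling kap eps) :
    ∃ alpha0 : ℝ, 0 < alpha0 ∧ ∃ C0 : ℝ, 0 < C0 ∧
      ∀ (P : QED.R3) (alpha sigma : ℝ), ‖P‖ ≤ 1 / 40 → 0 ≤ alpha → alpha ≤ alpha0 →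
        C0 * Real.sqrt alpha ≤ sigma →
        IsSelfAdjoint (QED.hamiltonian kap eps alpha P) ∧
        QED.MourreEstimate (QED.hamiltonian kap eps alpha P) QED.dilationGen
          (QED.infSpec (QED.hamiltonian kap eps alpha P) + sigma)
          (QED.infSpec (QED.hamiltonian kap eps alpha P) + 2 * sigma) (sigma / 2) := by
  exact QED.exists_mourreEstimate hLam hkap heps hreg
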